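/- **Setting.** Let $\Sigma$ be a smooth three-manifold with a smooth Riemannian metric $q$, let $\alpha>0$ and $\omega$ be smooth functions on $\Sigma$ and $\phi^a$ a smooth vector field on $\Sigma$. The spacetime is $\mathcal M=\mathbb R\times\Sigma$ with the stationary Lorentzian metric $$g=-\alpha^2dt^2+q_{ij}(dx^i+\beta^i dt)(dx^j+\beta^j dt),\qquad \beta^i=-\omega\phi^i ,$$ so that $t^a=\partial_t$ is a Killing field and $t^a=\alpha n^a+\beta^a$ with $n^a$ the future-directed unit normal of the slices $t=\mathrm{const}$. Assume that the spacetime is axisymmetric, i.e. $\phi^a$ is a (not identically vanishing) Killing field of $g$ whose integral curves are complete and $2\pi$-periodic, and that the $t$–$\phi$ orthogonality property holds: through every point at which $\phi^a\ne0$ there is a two-dimensional surface orthogonal to both $t^a$ and $\phi^a$. Let $S_0\subset\Sigma$ be a compact smooth embedded surface, invariant under the flow of $\phi^a$, which divides $\Sigma$ into an inside and an outside region, and let $S=\mathbb R\times S_0$ be the axisymmetric hypersurface obtained by transporting $S_0$ along $t^a$. Let $\hat r^a$ be the outward unit normal of $S_0$ in $\Sigma$ (which is also that of $S$ in $\mathcal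 M$), let $k_{ab}=\tfrac12\,{}^{(3)}\pounds_{\hat r}h_{ab}$ be the extrinsic curvature of $S_0$ in $\Sigma$, where $h_{ab}=q_{ab}-\hat r_a\hat r_b$, and $\bar K_{ab}=\tfrac12\pounds_{\hat r}P_{ab}$ the extrinsic curvature of $S$ in $\mathcal M$, where $P_{ab}=g_{ab}-\hat r_a\hat r_b$. Put $\phi=\sqrt{\phi^a\phi_a}$. At a point of $S_0$ let $(e_1,e_2)$ be an orthonormal basis of the tangent plane of $S_0$ with $\phi^a=\phi\,e_1^a$ (unique up to the sign of $e_2$ where $\phi^a\neq0$; any orthonormal basis where $\phi^a=0$), and put $$k_1=k_{ab}e_1^ae_1^b,\qquad k_2=k_{ab}e_2^ae_2^b,\qquad v_1=-\frac{\phi}{2\alpha}\,\hat r^aD_a\omega .$$ **Definitions.** $S$ is a *transversely trapping surface (TTS)* if every light ray (future-directed null geodesic) emitted from a point of $S$ in a direction tangent to $S$ initially propagates on $S$ or in the inside region. The *TTS condition* is that $\bar K_{ab}k^ak^b\le0$ for every null vector $k^a$ tangent to $S$, at every point of $S$. **Proposition 3.** The following condition is necessary and sufficient for $S$ to be a TTS,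 and it is also necessary and sufficient for the TTS condition to hold on $S$: at every point of $S_0$ (and for every basis $(e_1,e_2)$ as above) one of the following three holds: $$\text{(i)}\quad \frac{\hat r^cD_c\alpha}{\alpha}-k_1\ \ge\ |2v_1|\ >\ 2(k_2-k_1)\ >\ 0;$$ $$\text{(ii)}\quad k_2>k_1,\qquad \frac{\hat r^cD_c\alpha}{\alpha}-k_2\ \ge\ \frac{v_1^2}{k_2-k_1}\qquad\text{and}\qquad k_2-k_1\ \ge\ |v_1|;$$ $$\text{(iii)}\quad \frac{\hat r^cD_c\alpha}{\alpha}-|2v_1|\ \ge\ k_1\ \ge\ k_2 .$$ -/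

import Mathlib

open Set Filter Topology Bundle
open scoped Manifold ContDiff

noncomputable section

namespace TransverselyTrapping

/-! ### Tensor calculus on a manifold without boundary, through the preferred charts -/

section General

variable {E : Type*} [NormedAddCommGroup E] [NormedSpace ℝ E]
  {H : Type*} [TopologicalSpace H] {I : ModelWithCorners ℝ E H}
  {X : Type*} [TopologicalSpace X] [ChartedSpace H X]

/-- The components, at the point with coordinates `y` in the preferred chart at `x₀`, of a
field `T` of bilinear forms. -/
def chartForm (T : ∀ p : X, TangentSpace I p → TangentSpace I p → ℝ) (x₀ : X) (y a b : E) : ℝ :=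
  T ((extChartAt I x₀).symm y)
    (mfderiv 𝓘(ℝ, E) I (extChartAt I x₀).symm y a)
    (mfderiv 𝓘(ℝ, E) I (extChartAt I x₀).symm y b)

/-- The components, at the point with coordinates `y` in the preferred chart at `x₀`, of a
vector field `V`. -/
def chartVector (V : ∀ p : X, TangentSpace I p) (x₀ : X) (y : E) : E :=
  mfderiv I 𝓘(ℝ, E) (extChartAt I x₀) ((extChartAt I x₀).symm y) (V ((extChartAt I x₀).symm y))

/-- The Lie derivative `(£_V T)(u, v)` at `p` of a field of bilinear forms; in components
`V^c ∂_c T_{ab} u^a v^b + T_{cb} (∂_a V^c) u^a v^b + T_{ac} (∂_b V^c) u^a v^b`. -/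
def lieDerivative (V : ∀ p : X, TangentSpace I p)
    (T : ∀ p : X, TangentSpace I p → TangentSpace I p → ℝ) (p : X) (u v : TangentSpace I p) : ℝ :=
  fderiv ℝ (fun y => chartForm T p y u v) (extChartAt I p p) (chartVector V p (extChartAt I p p))
    + T p (fderiv ℝ (chartVector V p) (extChartAt I p p) u) v
    + T p u (fderiv ℝ (chartVector V p) (extChartAt I p p) v)

/-- `V` is a Killing vector field of the metric `g`. -/
def IsKilling (g : ∀ p : X, TangentSpace I p → TangentSpace I p → ℝ)
    (V : ∀ p : X, TangentSpace I p) : Prop :=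
  ∀ (p : X) (u v : TangentSpace I p), lieDerivative V g p u v = 0

/-- The velocity of a curve. -/
def velocity (I : ModelWithCorners ℝ E H) (γ : ℝ → X) (s : ℝ) : TangentSpace I (γ s) :=
  mfderiv 𝓘(ℝ, ℝ) I γ s (1 : ℝ)

/-- The curve `γ` satisfies the affinely parametrised geodesic equation of the metric `g` at the
parameter `s`; in components, `c` being the curve in the preferred chart at `γ s`,
`g_{ab} c''^a w^b + ∂_d g_{ab} c'^d c'^a w^b - (1/2) ∂_d g_{ab} w^d c'^a c'^b = 0` for all `w`,
which is `c''^a + Γ^a_{bd} c'^b c'^d = 0` with one index lowered. -/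
def IsGeodesicAt (g : ∀ p : X, TangentSpace I p → TangentSpace I p → ℝ)
    (γ : ℝ → X) (s : ℝ) : Prop :=
  ContMDiffAt 𝓘(ℝ, ℝ) I 2 γ s ∧
  ∀ w : E,
    let c : ℝ → E := fun τ => extChartAt I (γ s) (γ τ)
    chartForm g (γ s) (c s) (deriv (deriv c) s) w
      + fderiv ℝ (fun y => chartForm g (γ s) y (deriv c s) w) (c s) (deriv c s)
      - (1 / 2) * fderiv ℝ (fun y => chartForm g (γ s) y (deriv c s) (deriv c s)) (c s) w = 0

/-- The derivative of the function `f` in the direction `u`. -/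
def dirDeriv (f : X → ℝ) (p : X) (u : TangentSpace I p) : ℝ := mfderiv I 𝓘(ℝ, ℝ) f p u

/-- Three subsets of `X`: a surface, its inside and its outside. -/
structure Separation (X : Type*) where
  /-- the inside region -/
  inside : Set X
  /-- the surface -/
  surface : Set X
  /-- the outside region -/
  outside : Set X

/-- `f` is a smooth local defining function of the surface near `p`, with nonzero differential,
negative inside and positive outside. -/
def Separation.IsDefiningAt (I : ModelWithCorners ℝ E H) (D : Separation X) (p : X)
    (f : X → ℝ) : Prop :=
  mfderiv I 𝓘(ℝ, ℝ) f p ≠ 0 ∧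
  ∃ U : Set X, IsOpen U ∧ p ∈ U ∧ ContMDiffOn I 𝓘(ℝ, ℝ) ∞ f U ∧
    ∀ x ∈ U, (x ∈ D.inside ↔ f x < 0) ∧ (x ∈ D.surface ↔ f x = 0) ∧ (x ∈ D.outside ↔ 0 < f x)

/-- `D.surface` is a smoothly embedded (two-sided) hypersurface which divides `X` into the open
regions `D.inside` and `D.outside`. -/
structure Separation.IsSmooth (I : ModelWithCorners ℝ E H) (D : Separation X) : Prop where
  isOpen_inside : IsOpen D.inside
  isOpen_outside : IsOpen D.outside
  disjoint_inside_outside : Disjoint D.inside D.outside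
  compl_surface : D.surfaceᶜ = D.inside ∪ D.outside
  exists_defining : ∀ p ∈ D.surface, ∃ f : X → ℝ, D.IsDefiningAt I p f

/-- `u` is tangent to the surface at `p` (all local defining functions have the same kernel). -/
def Separation.IsTangent (D : Separation X) (p : X) (u : TangentSpace I p) : Prop :=
  ∀ f : X → ℝ, D.IsDefiningAt I p f → dirDeriv f p u = 0

/-- `u` points to the outside of the surface at `p`. -/
def Separation.IsOutward (D : Separation X) (p : X) (u : TangentSpace I p) : Prop :=
  ∀ f : X → ℝ, D.IsDefiningAt I p f → 0 < dirDeriv f p u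

/-- On the surface the vector field `r` is the outward unit normal with respect to `g`, and it is
smooth around the surface; its values off the surface are an arbitrary smooth extension. -/
structure IsOutwardUnitNormal [IsManifold I 1 X]
    (g : ∀ p : X, TangentSpace I p → TangentSpace I p → ℝ)
    (D : Separation X) (r : ∀ p : X, TangentSpace I p) : Prop where
  smooth : ∀ p ∈ D.surface, ContMDiffAt I I.tangent ∞ (fun x => (⟨x, r x⟩ : TangentBundle I X)) p
  unit : ∀ p ∈ D.surface, g p (r p) (r p) = 1
  normal : ∀ p ∈ D.surface, ∀ u : TangentSpace I p, D.IsTangent p u → g p (r p) u = 0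
  outward : ∀ p ∈ D.surface, D.IsOutward p (r p)

/-- `g_{ab} - r_a r_b`, which on a surface with unit normal `r` is its induced metric. -/
def inducedMetric (g : ∀ p : X, TangentSpace I p → TangentSpace I p → ℝ)
    (r : ∀ p : X, TangentSpace I p) (p : X) (u v : TangentSpace I p) : ℝ :=
  g p u v - g p (r p) u * g p (r p) v

/-- The extrinsic curvature `(1/2) £_r (g_{ab} - r_a r_b)` of a surface with unit normal `r`,
to be evaluated on vectors tangent to the surface. -/
def extrinsicCurvature (g : ∀ p : X, TangentSpace I p → TangentSpace I p → ℝ)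
    (r : ∀ p : X, TangentSpace I p) (p : X) (u v : TangentSpace I p) : ℝ :=
  (1 / 2) * lieDerivative r (inducedMetric g r) p u v

end General

/-! ### Axisymmetric stationary spacetimes -/

section Spacetime

variable (N : Type*) [TopologicalSpace N] [ChartedSpace (EuclideanSpace ℝ (Fin 3)) N]
  [IsManifold (𝓡 3) ∞ N]

/-- Lapse `α`, Riemannian metric `q` of the slice, rotation field `Φ` and angular velocity `ω`
(the field `angVel`) on the three-dimensional slice `N`. They determine a spacetime metric on `ℝ × N` (`metric` below). -/
structure StationaryData where
  /-- the metric of the slices of constant time -/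
  q : ContMDiffRiemannianMetric (𝓡 3) ∞ (EuclideanSpace ℝ (Fin 3))
    (fun p : N => TangentSpace (𝓡 3) p)
  /-- the lapse function -/
  α : N → ℝ
  /-- the angular velocity `ω`: the shift vector is `-ω Φ` -/
  angVel : N → ℝ
  /-- the rotation field on the slice -/
  Φ : ∀ p : N, TangentSpace (𝓡 3) p
  α_pos : ∀ p, 0 < α p
  α_smooth : ContMDiff (𝓡 3) 𝓘(ℝ, ℝ) ∞ α
  angVel_smooth : ContMDiff (𝓡 3) 𝓘(ℝ, ℝ) ∞ angVel
  Φ_smooth : ContMDiff (𝓡 3) (𝓡 3).tangent ∞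
    (fun x => (⟨x, Φ x⟩ : TangentBundle (𝓡 3) N))

/-- The model with corners of the spacetime `ℝ × N`. -/
abbrev stModel : ModelWithCorners ℝ (ℝ × EuclideanSpace ℝ (Fin 3))
    (ModelProd ℝ (EuclideanSpace ℝ (Fin 3))) :=
  𝓘(ℝ, ℝ).prod (𝓡 3)

variable {N}

/-- The tangent vector of `ℝ × N` with time component `s` and spatial component `u`. -/
def mkVec {x : ℝ × N} (s : ℝ) (u : TangentSpace (𝓡 3) x.2) : TangentSpace stModel x :=
  ((s, u) : ℝ × EuclideanSpace ℝ (Fin 3))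

/-- The time component `dt(v)`. -/
def timePart {x : ℝ × N} (v : TangentSpace stModel x) : ℝ :=
  Prod.fst (α := ℝ) (β := EuclideanSpace ℝ (Fin 3)) v

/-- The spatial component, in the slice. -/
def spacePart {x : ℝ × N} (v : TangentSpace stModel x) : TangentSpace (𝓡 3) x.2 :=
  Prod.snd (α := ℝ) (β := EuclideanSpace ℝ (Fin 3)) v

namespace StationaryData

variable (𝓢 : StationaryData N)

/-- The Riemannian metric of the slice as a plain field of bilinear forms. -/
def sliceMetric (p : N) (u v : TangentSpace (𝓡 3) p) : ℝ := 𝓢.q.inner p u v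

/-- The spacetime metric
`-α² dt² + q_{ij} (dx^i + β^i dt) (dx^j + β^j dt)` with shift vector `β = -ω Φ`. -/
def metric (x : ℝ × N) (v w : TangentSpace stModel x) : ℝ :=
  -(𝓢.α x.2) ^ 2 * timePart v * timePart w
    + 𝓢.q.inner x.2 (spacePart v - (timePart v * 𝓢.angVel x.2) • 𝓢.Φ x.2)
        (spacePart w - (timePart w * 𝓢.angVel x.2) • 𝓢.Φ x.2)

/-- The stationary vector field `t^a = ∂/∂t`; the metric components do not depend on `t`. -/
def killingT (x : ℝ × N) : TangentSpace stModel x := mkVec 1 0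

/-- The rotation field `φ^a` of the spacetime. -/
def killingΦ (x : ℝ × N) : TangentSpace stModel x := mkVec 0 (𝓢.Φ x.2)

/-- The spacetime is axisymmetric: `φ^a` is a Killing field of the spacetime metric which generates
a nontrivial action of `U(1)`. -/
structure IsAxisymmetric : Prop where
  killing : IsKilling 𝓢.metric 𝓢.killingΦ
  periodic : ∀ p : N, ∃ c : ℝ → N, c 0 = p ∧ IsMIntegralCurve (I := 𝓡 3) c 𝓢.Φ ∧
    ∀ s, c (s + 2 * Real.pi) = c s
  nontrivial : ∃ p : N, 𝓢.Φ p ≠ 0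

/-- The t-φ orthogonality property: through every point off the axis there is a two-dimensional
surface orthogonal to both `t^a` and `φ^a`. -/
def TPhiOrthogonality : Prop :=
  ∀ x : ℝ × N, 𝓢.Φ x.2 ≠ 0 →
    ∃ (σ : EuclideanSpace ℝ (Fin 2) → ℝ × N) (W : Set (EuclideanSpace ℝ (Fin 2))),
      IsOpen W ∧ 0 ∈ W ∧ σ 0 = x ∧ ContMDiffOn (𝓡 2) stModel ∞ σ W ∧
      ∀ y ∈ W, Function.Injective (mfderiv (𝓡 2) stModel σ y) ∧
        ∀ a : TangentSpace (𝓡 2) y,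
          𝓢.metric (σ y) (mfderiv (𝓡 2) stModel σ y a) (killingT (σ y)) = 0 ∧
          𝓢.metric (σ y) (mfderiv (𝓡 2) stModel σ y a) (𝓢.killingΦ (σ y)) = 0

end StationaryData

/-- The surface `S = ℝ × S₀` obtained by transporting `S₀` along the integral lines of `t^a`, with
the corresponding inside and outside regions. -/
def Separation.transport (D : Separation N) : Separation (ℝ × N) where
  inside := Prod.snd ⁻¹' D.inside
  surface := Prod.snd ⁻¹' D.surface
  outside := Prod.snd ⁻¹' D.outside

namespace StationaryData

variable (𝓢 : StationaryData N)

/-- The surface `S₀` is invariant under the rotations. -/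
def IsInvariantSurface (S₀ : Set N) : Prop :=
  ∀ c : ℝ → N, IsMIntegralCurve (I := 𝓡 3) c 𝓢.Φ → c 0 ∈ S₀ → ∀ s, c s ∈ S₀

/-- The surface is a transversely trapping surface: every light ray (future-directed affinely
parametrised null geodesic) emitted from a point of the surface in a direction tangent to it
initially propagates on the surface or in the inside region. -/
def IsTTS (B : Separation (ℝ × N)) : Prop :=
  ∀ (γ : ℝ → ℝ × N) (ε : ℝ), 0 < ε →
    (∀ s ∈ Ioo (-ε) ε, IsGeodesicAt (I := stModel) 𝓢.metric γ s) →
    γ 0 ∈ B.surface →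
    B.IsTangent (γ 0) (velocity stModel γ 0) →
    𝓢.metric (γ 0) (velocity stModel γ 0) (velocity stModel γ 0) = 0 →
    0 < timePart (velocity stModel γ 0) →
    ∀ᶠ s in 𝓝[>] (0 : ℝ), γ s ∈ B.surface ∪ B.inside

/-- The TTS condition: `K̄_{ab} k^a k^b ≤ 0` for all null vectors `k` tangent to the surface, where
`K̄` is the extrinsic curvature with respect to the outward unit normal `R`. -/
def TTSCondition (B : Separation (ℝ × N)) (R : ∀ x : ℝ × N, TangentSpace stModel x) : Prop :=
  ∀ x ∈ B.surface, ∀ k : TangentSpace stModel x, B.IsTangent x k → 𝓢.metric x k k = 0 →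
    extrinsicCurvature 𝓢.metric R x k k ≤ 0

/-- `φ = √(φ^a φ_a)`. -/
def rotNorm (p : N) : ℝ := Real.sqrt (𝓢.sliceMetric p (𝓢.Φ p) (𝓢.Φ p))

/-- `v₁ = -(φ / 2α) (r^b D_b ω)`. -/
def v₁ (r : ∀ p : N, TangentSpace (𝓡 3) p) (p : N) : ℝ :=
  -(𝓢.rotNorm p / (2 * 𝓢.α p)) * dirDeriv 𝓢.angVel p (r p)

/-- `(r^c D_c α) / α`. -/
def lapseSlope (r : ∀ p : N, TangentSpace (𝓡 3) p) (p : N) : ℝ :=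
  dirDeriv 𝓢.α p (r p) / 𝓢.α p

/-- `(e₁, e₂)` is an orthonormal basis of the tangent plane of `S₀` at `p` with `Φ = φ e₁`. It is
unique up to the sign of `e₂` off the axis, and any orthonormal basis on the axis. -/
structure IsAdaptedBasis (D : Separation N) (p : N) (e₁ e₂ : TangentSpace (𝓡 3) p) : Prop where
  tangent₁ : D.IsTangent p e₁
  tangent₂ : D.IsTangent p e₂
  unit₁ : 𝓢.sliceMetric p e₁ e₁ = 1
  unit₂ : 𝓢.sliceMetric p e₂ e₂ = 1
  orthogonal : 𝓢.sliceMetric p e₁ e₂ = 0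
  along : 𝓢.Φ p = 𝓢.rotNorm p • e₁

end StationaryData

/-- One of the three systems of inequalities, for `a = (r^c D_c α) / α`. In the second one
`k₁ < k₂` is what makes the quotient meaningful. -/
def ThreeSystems (a k₁ k₂ v₁ : ℝ) : Prop :=
  (a - k₁ ≥ |2 * v₁| ∧ |2 * v₁| > 2 * (k₂ - k₁) ∧ 2 * (k₂ - k₁) > 0) ∨
  (k₂ - k₁ > 0 ∧ a - k₂ ≥ v₁ ^ 2 / (k₂ - k₁) ∧ k₂ - k₁ ≥ |v₁|) ∨
  (a - |2 * v₁| ≥ k₁ ∧ k₁ ≥ k₂)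

/-- At every point of `S₀` one of the three systems of inequalities holds, where `k₁`, `k₂` are
the tetrad components of the extrinsic curvature of `S₀` in the slice. -/
def StationaryData.PointwiseCondition (𝓢 : StationaryData N) (D : Separation N)
    (r : ∀ p : N, TangentSpace (𝓡 3) p) : Prop :=
  ∀ p ∈ D.surface, ∀ e₁ e₂ : TangentSpace (𝓡 3) p, 𝓢.IsAdaptedBasis D p e₁ e₂ →
    ThreeSystems (𝓢.lapseSlope r p)
      (extrinsicCurvature 𝓢.sliceMetric r p e₁ e₁)
      (extrinsicCurvature 𝓢.sliceMetric r p e₂ e₂)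
      (𝓢.v₁ r p)

end Spacetime

end TransverselyTrapping

end

/-! Both equivalences go through the TTS condition.

That `IsTTS` is the same as `TTSCondition` is a general fact about hypersurfaces (`isTTS_iff`). Let
`f` be a local defining function, negative inside. Along a geodesic with tangent initial velocity
`k`, the second derivative of `f` at the start is a positive multiple of the extrinsic curvature on
`(k, k)` (`half_coordLie_eq`, `extCurvAt_eq_coordHess`). If it is positive for some null `k`, the
geodesic with that initial velocity leaves at once (`exists_geodesic_outside`). The converse is
delicate because the curvature may vanish, so the second derivative at the start alone decides
nothing. The tangent null vectors at points of the surface form the zero set of a submersion `(f,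
df(k), g(k,k))` near a nonzero `k`. A function that is nonpositive on this set is bounded above by a
constant times the size of the submersion (`exists_le_mul_norm_of_submersion`). Since geodesics stay
null, `u = f ∘ γ` satisfies `u'' ≤ C (|u| + |u'|)` with `u(0) = u'(0) = 0`, and a Gronwall-type
argument (`nonpos_of_deriv_le`) gives `u ≤ 0` for a short time.

That `TTSCondition` is the same as `PointwiseCondition` is a computation (`ttsCondition_iff`). A
nonzero tangent null vector is `α s` times the sum of the unit normal of the slice and a unit vector
`a e₁ + b e₂`. The curvature of the world sheet on it is `(α s)²` times `-(r·Dα)/α + k₁ a² + k₂ b² +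
2 v₁ a`, provided that the mixed component of the curvature of `S₀` does not contribute. Off the
axis this component vanishes: the orthogonal surfaces make `dΦ♭` vanish on `r` and `e₂`, and the
Killing equation and the invariance of `S₀` turn this into `k(Φ, e₂) = 0`
(`coordLie_rotation_eq_zero`). On the axis `v₁ = 0` and the basis can be rotated so that `a b = 0`.
With `a = x` and `b² = 1 - x²`, what remains is that a quadratic polynomial in `x` is nonpositive on
`[-1, 1]`. The three systems are the cases of a vertex outside the interval, a vertex inside it, and
a convex polynomial (`threeSystems_iff`). -/

noncomputable section

namespace TransverselyTrapping

/-! ### Tensor expressions in a normed space, level sets, and a differential inequality. -/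

section Coordinates

set_option maxSynthPendingDepth 3

variable {E : Type*} [NormedAddCommGroup E] [NormedSpace ℝ E]

/-- The Lie derivative of a field of bilinear forms on a normed space. -/
def coordLie (ρ : E → E) (t : E → E →L[ℝ] E →L[ℝ] ℝ) (y u v : E) : ℝ :=
  fderiv ℝ t y (ρ y) u v + t y (fderiv ℝ ρ y u) v + t y u (fderiv ℝ ρ y v)

/-- The left-hand side of the geodesic equation, with lowered index, for the position `y`,
velocity `k` and acceleration `a`. -/
def coordGeo (t : E → E →L[ℝ] E →L[ℝ] ℝ) (y k a w : E) : ℝ :=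
  t y a w + fderiv ℝ t y k k w - (1 / 2) * fderiv ℝ t y w k k

lemma fderiv_apply₂ {t : E → E →L[ℝ] E →L[ℝ] ℝ} {y : E} (ht : DifferentiableAt ℝ t y)
    (a b d : E) : fderiv ℝ (fun z => t z a b) y d = fderiv ℝ t y d a b := by
  have h := (ht.hasFDerivAt.clm_apply (hasFDerivAt_const a y)).clm_apply (hasFDerivAt_const b y)
  rw [h.fderiv]; simp

/-- Product and chain rule for `t = ψ^* t₀`. The two terms with second derivatives of `ψ` are the
non-tensorial part, which has to cancel in the geodesic equation and in the Lie derivative. -/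
lemma fderiv_pullback {t t₀ : E → E →L[ℝ] E →L[ℝ] ℝ} {ψ : E → E} {y : E}
    (ht : DifferentiableAt ℝ t y) (ht₀ : DifferentiableAt ℝ t₀ (ψ y)) (hψ : ContDiffAt ℝ 2 ψ y)
    (h : ∀ᶠ z in 𝓝 y, ∀ a b, t z a b = t₀ (ψ z) (fderiv ℝ ψ z a) (fderiv ℝ ψ z b)) (d a b : E) :
    fderiv ℝ t y d a b = fderiv ℝ t₀ (ψ y) (fderiv ℝ ψ y d) (fderiv ℝ ψ y a) (fderiv ℝ ψ y b)
      + t₀ (ψ y) (fderiv ℝ (fderiv ℝ ψ) y d a) (fderiv ℝ ψ y b)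
      + t₀ (ψ y) (fderiv ℝ ψ y a) (fderiv ℝ (fderiv ℝ ψ) y d b) := by
  have h1 : HasFDerivAt ψ (fderiv ℝ ψ y) y :=
    (hψ.differentiableAt (by norm_num)).hasFDerivAt
  have h2 : HasFDerivAt (fderiv ℝ ψ) (fderiv ℝ (fderiv ℝ ψ) y) y :=
    ((hψ.fderiv_right (m := 1) (by norm_num)).differentiableAt (by norm_num)).hasFDerivAt
  have h3 : HasFDerivAt (fun z => t₀ (ψ z)) ((fderiv ℝ t₀ (ψ y)).comp (fderiv ℝ ψ y)) y :=
    HasFDerivAt.comp (g := t₀) y ht₀.hasFDerivAt h1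
  have h4 := (h3.clm_apply (h2.clm_apply (hasFDerivAt_const a y))).clm_apply
    (h2.clm_apply (hasFDerivAt_const b y))
  rw [← fderiv_apply₂ ht]
  have h5 : (fun z => t z a b) =ᶠ[𝓝 y]
      fun z => t₀ (ψ z) (fderiv ℝ ψ z a) (fderiv ℝ ψ z b) := h.mono fun z hz => hz a b
  rw [h5.fderiv_eq]
  have h6 := h4.fderiv
  rw [h6]
  simp
  ring

/-- Of the second-derivative terms, the one with `D²ψ(k, k)` joins the acceleration, as for the
second derivative of `ψ ∘ c`. The others, which contain `D²ψ(k, w)`, cancel against the term with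
factor `1/2` by the symmetry of `t₀` and of `D²ψ`. -/
lemma coordGeo_pullback {t t₀ : E → E →L[ℝ] E →L[ℝ] ℝ} {ψ : E → E} {y : E}
    (ht : DifferentiableAt ℝ t y) (ht₀ : DifferentiableAt ℝ t₀ (ψ y)) (hψ : ContDiffAt ℝ 2 ψ y)
    (h : ∀ᶠ z in 𝓝 y, ∀ a b, t z a b = t₀ (ψ z) (fderiv ℝ ψ z a) (fderiv ℝ ψ z b))
    (hsymm : ∀ a b, t₀ (ψ y) a b = t₀ (ψ y) b a) (k a w : E) :
    coordGeo t y k a w = coordGeo t₀ (ψ y) (fderiv ℝ ψ y k)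
      (fderiv ℝ (fderiv ℝ ψ) y k k + fderiv ℝ ψ y a) (fderiv ℝ ψ y w) := by
  have hs : fderiv ℝ (fderiv ℝ ψ) y w k = fderiv ℝ (fderiv ℝ ψ) y k w :=
    (hψ.isSymmSndFDerivAt (by simp)).eq w k
  simp only [coordGeo, fderiv_pullback ht ht₀ hψ h, h.self_of_nhds, map_add,
    _root_.add_apply, hs]
  rw [hsymm (fderiv ℝ ψ y k) (fderiv ℝ (fderiv ℝ ψ) y k w)]
  ring

/-- Differentiating `Dψ ρ = ρ₀ ∘ ψ` shows that `Dψ (Dρ a)` is `Dρ₀ (Dψ a)` minus `D²ψ(ρ, a)`. These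
corrections are exactly the non-tensorial terms of `fderiv_pullback`, with the opposite sign. -/
lemma coordLie_pullback {t t₀ : E → E →L[ℝ] E →L[ℝ] ℝ} {ψ ρ ρ₀ : E → E} {y : E}
    (ht : DifferentiableAt ℝ t y) (ht₀ : DifferentiableAt ℝ t₀ (ψ y)) (hψ : ContDiffAt ℝ 2 ψ y)
    (h : ∀ᶠ z in 𝓝 y, ∀ a b, t z a b = t₀ (ψ z) (fderiv ℝ ψ z a) (fderiv ℝ ψ z b))
    (hρ : DifferentiableAt ℝ ρ y) (hρ₀ : DifferentiableAt ℝ ρ₀ (ψ y))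
    (hρρ : ∀ᶠ z in 𝓝 y, fderiv ℝ ψ z (ρ z) = ρ₀ (ψ z)) (u v : E) :
    coordLie ρ t y u v = coordLie ρ₀ t₀ (ψ y) (fderiv ℝ ψ y u) (fderiv ℝ ψ y v) := by
  have hs := fun a b => (hψ.isSymmSndFDerivAt (by simp)).eq a b
  have h1 : HasFDerivAt ψ (fderiv ℝ ψ y) y :=
    (hψ.differentiableAt (by norm_num)).hasFDerivAt
  have h2 : HasFDerivAt (fderiv ℝ ψ) (fderiv ℝ (fderiv ℝ ψ) y) y :=
    ((hψ.fderiv_right (m := 1) (by norm_num)).differentiableAt (by norm_num)).hasFDerivAt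
  have h3 : ∀ a, fderiv ℝ (fderiv ℝ ψ) y a (ρ y) + fderiv ℝ ψ y (fderiv ℝ ρ y a)
      = fderiv ℝ ρ₀ (ψ y) (fderiv ℝ ψ y a) := by
    intro a
    have e1 := (h2.clm_apply hρ.hasFDerivAt).fderiv
    have e2 := (hρ₀.hasFDerivAt.comp y h1).fderiv
    have e3 := Filter.EventuallyEq.fderiv_eq (𝕜 := ℝ)
      (show (fun z => fderiv ℝ ψ z (ρ z)) =ᶠ[𝓝 y] fun z => ρ₀ (ψ z) from hρρ)
    simp only [Function.comp_def] at e2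
    rw [e1, e2] at e3
    have := congrArg (fun L => L a) e3
    simp at this
    rw [← this]; abel
  have h4 : ∀ a, fderiv ℝ ψ y (fderiv ℝ ρ y a) = fderiv ℝ ρ₀ (ψ y) (fderiv ℝ ψ y a)
      - fderiv ℝ (fderiv ℝ ψ) y (ρ y) a := fun a => by rw [← h3 a, hs a (ρ y)]; abel
  simp only [coordLie, fderiv_pullback ht ht₀ hψ h, h.self_of_nhds, h4, hρρ.self_of_nhds, map_sub,
    _root_.sub_apply]
  ring

/-- A function which vanishes on a level set has vanishing derivative in the directions tangent
to it. -/
lemma fderiv_eq_zero_of_eqOn_levelSet [CompleteSpace E] {F : Type*} [NormedAddCommGroup F]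
    [NormedSpace ℝ F] {f : E → ℝ} {h : E → F} {y : E}
    (hf : ContDiffAt ℝ 1 f y) (hh : ContDiffAt ℝ 1 h y) (hdf : fderiv ℝ f y ≠ 0) (hy : f y = 0)
    (hz : ∀ᶠ z in 𝓝 y, f z = 0 → h z = 0) {u : E} (hu : fderiv ℝ f y u = 0) :
    fderiv ℝ h y u = 0 := by
  refine SeparatingDual.eq_zero_of_forall_dual_eq_zero (R := ℝ) fun φ => ?_
  have hφ : HasStrictFDerivAt (fun z => φ (h z)) (φ.comp (fderiv ℝ h y)) y :=
    φ.hasStrictFDerivAt.comp y (hh.hasStrictFDerivAt (by norm_num))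
  -- Composed with a functional, `h` is constant on the level set. Hence `y` is trivially a
  -- constrained extremum, and the Lagrange multiplier rule makes the derivative proportional to
  -- `df`.
  have hex : IsLocalExtrOn (fun z => φ (h z)) {z | f z = f y} y := by
    left
    filter_upwards [nhdsWithin_le_nhds hz, self_mem_nhdsWithin] with z h1 h2
    rw [h1 (h2.trans hy), hz.self_of_nhds hy]
  obtain ⟨a, b, hab, H⟩ := hex.exists_multipliers_of_hasStrictFDerivAt_1d
    (hf.hasStrictFDerivAt (by norm_num)) hφ
  have hb : b ≠ 0 := by
    rintro rfl
    have ha : a ≠ 0 := by rintro rfl; simp at hab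
    simp [ha] at H
    exact hdf H
  have := congrArg (fun L => L u) H
  simpa [hu, hb] using this

/-- A function `u` with `u(0) = u'(0) = 0` and `u'' ≤ C (|u| + |u'|)` is nonincreasing for a short
time; here `w = u'`. -/
lemma nonpos_of_deriv_le {u w w' : ℝ → ℝ} {C T : ℝ} (hC : 0 ≤ C) (hT : 0 < T) (hT1 : T ≤ 1)
    (hCT : 2 * C * T < 1)
    (hu : ∀ s ∈ Icc 0 T, HasDerivAt u (w s) s) (hw : ∀ s ∈ Icc 0 T, HasDerivAt w (w' s) s)
    (hu0 : u 0 = 0) (hw0 : w 0 = 0) (h : ∀ s ∈ Icc 0 T, w' s ≤ C * (|u s| + |w s|)) :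
    ∀ s ∈ Icc 0 T, u s ≤ 0 := by
  have hwc : ContinuousOn w (Icc 0 T) := fun s hs => (hw s hs).continuousAt.continuousWithinAt
  -- The bound on `w'` is one-sided, so only the growth of `w` is controlled. Therefore `w` is
  -- maximised first, at `τ`, and `|w|` only afterwards, on `[0, τ]`.
  obtain ⟨τ, hτ, hτmax⟩ := isCompact_Icc.exists_isMaxOn (nonempty_Icc.2 hT.le) hwc
  have key : w τ ≤ 0 := by
    by_contra! hpos
    have hsub : Icc 0 τ ⊆ Icc 0 T := Icc_subset_Icc le_rfl hτ.2
    obtain ⟨σ, hσ, hσmax⟩ := isCompact_Icc.exists_isMaxOn (nonempty_Icc.2 hτ.1)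
      (hwc.mono hsub).abs
    set B := |w σ| with hB
    have hB0 : 0 < B := by
      have := hσmax (right_mem_Icc.2 hτ.1)
      simp only [mem_ofPred_eq] at this
      exact lt_of_lt_of_le (abs_pos.2 hpos.ne') this
    have hwB : ∀ s ∈ Icc 0 τ, |w s| ≤ B := fun s hs => hσmax hs
    have huB : ∀ s ∈ Icc 0 τ, |u s| ≤ B := by
      intro s hs
      have := (convex_Icc 0 τ).norm_image_sub_le_of_norm_hasDerivWithin_le
        (fun x hx => (hu x (hsub hx)).hasDerivWithinAt) (fun x hx => hwB x hx)
        (left_mem_Icc.2 hτ.1) hs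
      simp only [hu0, sub_zero, Real.norm_eq_abs, abs_of_nonneg hs.1] at this
      nlinarith [hs.1, (hsub hs).2]
    have hw'B : ∀ s ∈ Icc 0 τ, w' s ≤ 2 * C * B := by
      intro s hs
      have h1 := h s (hsub hs)
      have h2 := mul_le_mul_of_nonneg_left (add_le_add (huB s hs) (hwB s hs)) hC
      linarith
    have hgrow : ∀ s ∈ Icc 0 τ, w τ - w s < B := by
      intro s hs
      have h1 := (convex_Icc 0 τ).image_sub_le_mul_sub_of_deriv_le (C := 2 * C * B) (f := w)
        (hwc.mono hsub)
        (fun x hx => (hw x (hsub (interior_subset hx))).differentiableAt.differentiableWithinAt)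
        (fun x hx => by
          rw [(hw x (hsub (interior_subset hx))).deriv]; exact hw'B x (interior_subset hx))
        s hs τ (right_mem_Icc.2 hτ.1) hs.2
      have h2 : 2 * C * B * (τ - s) ≤ 2 * C * B * T :=
        mul_le_mul_of_nonneg_left (by linarith [hs.1, hτ.2]) (by positivity)
      nlinarith
    -- If `w σ = B`, then `w` grows from `0` at time `0` to at least `B` at `τ`. If `w σ = -B`, it
    -- grows by more than `B` between `σ` and `τ`. Both are excluded by `hgrow`.
    rcases abs_choice (w σ) with h1 | h1
    · have h2 := hgrow 0 (left_mem_Icc.2 hτ.1)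
      have h3 : w σ ≤ w τ := hτmax (hsub hσ)
      rw [hw0] at h2
      linarith
    · have h2 := hgrow σ hσ
      linarith
  intro s hs
  have hanti : AntitoneOn u (Icc 0 T) := by
    refine antitoneOn_of_deriv_nonpos (convex_Icc 0 T)
      (fun x hx => (hu x hx).continuousAt.continuousWithinAt)
      (fun x hx => (hu x (interior_subset hx)).differentiableAt.differentiableWithinAt)
      fun x hx => ?_
    rw [(hu x (interior_subset hx)).deriv]
    exact (hτmax (interior_subset hx)).trans key
  have := hanti (left_mem_Icc.2 hT.le) hs hs.1
  linarith

end Coordinates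

/-! ### Unit normals and extrinsic curvature of level sets in coordinates. -/

section CoordinateHypersurface

set_option maxSynthPendingDepth 3

variable {E : Type*} [NormedAddCommGroup E] [NormedSpace ℝ E]

/-- `ρ` is at `z` a unit normal of the level set of `f`, pointing in the direction in which `f`
increases. -/
structure CoordUnitNormal (t : E → E →L[ℝ] E →L[ℝ] ℝ) (f : E → ℝ) (ρ : E → E) (z : E) : Prop where
  unit : t z (ρ z) (ρ z) = 1
  pos : 0 < fderiv ℝ f z (ρ z)
  normal : ∀ a, fderiv ℝ f z a = 0 → t z (ρ z) a = 0

/-- Subtracting from `a` the multiple of `ρ` with the same `df` leaves a vector in the kernel of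
`df`, to which `ρ` is orthogonal. This form of the normal covector can be differentiated along the
surface. -/
lemma CoordUnitNormal.apply_eq {t : E → E →L[ℝ] E →L[ℝ] ℝ} {f : E → ℝ} {ρ : E → E} {z : E}
    (h : CoordUnitNormal t f ρ z) (a : E) :
    t z (ρ z) a = (fderiv ℝ f z (ρ z))⁻¹ * fderiv ℝ f z a := by
  have h1 := h.normal (a - ((fderiv ℝ f z (ρ z))⁻¹ * fderiv ℝ f z a) • ρ z) (by
    have := h.pos.ne'
    simp
    field_simp
    simp)
  rw [map_sub, map_smul, h.unit, smul_eq_mul, mul_one, sub_eq_zero] at h1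
  exact h1

/-- The induced metric of the level sets with unit normal `ρ`. -/
def coordInduced (t : E → E →L[ℝ] E →L[ℝ] ℝ) (ρ : E → E) (z : E) : E →L[ℝ] E →L[ℝ] ℝ :=
  t z - (t z (ρ z)).smulRight (t z (ρ z))

lemma coordInduced_apply (t : E → E →L[ℝ] E →L[ℝ] ℝ) (ρ : E → E) (z a b : E) :
    coordInduced t ρ z a b = t z a b - t z (ρ z) a * t z (ρ z) b := by
  simp [coordInduced]

lemma contDiffAt_coordInduced {n : WithTop ℕ∞} {t : E → E →L[ℝ] E →L[ℝ] ℝ} {ρ : E → E} {y : E}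
    (ht : ContDiffAt ℝ n t y) (hρ : ContDiffAt ℝ n ρ y) :
    ContDiffAt ℝ n (coordInduced t ρ) y :=
  ht.sub ((ht.clm_apply hρ).smulRight (ht.clm_apply hρ))

/-- The subtracted term is the square of a covector which vanishes on `k`, so it contributes nothing
to first order on `(k, k)`. -/
lemma coordLie_coordInduced {t : E → E →L[ℝ] E →L[ℝ] ℝ} {ρ : E → E} {y k : E}
    (ht : ContDiffAt ℝ 1 t y) (hρ : ContDiffAt ℝ 1 ρ y) (hk : t y (ρ y) k = 0) :
    coordLie ρ (coordInduced t ρ) y k k = coordLie ρ t y k k := by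
  have h1 : fderiv ℝ (coordInduced t ρ) y (ρ y) k k = fderiv ℝ t y (ρ y) k k := by
    rw [← fderiv_apply₂ ((contDiffAt_coordInduced ht hρ).differentiableAt (by norm_num)),
      ← fderiv_apply₂ (ht.differentiableAt (by norm_num))]
    simp only [coordInduced_apply]
    have e1 : DifferentiableAt ℝ (fun z => t z k k) y :=
      ((ht.clm_apply contDiffAt_const).clm_apply contDiffAt_const).differentiableAt (by norm_num)
    have e2 : DifferentiableAt ℝ (fun z => t z (ρ z) k) y :=
      ((ht.clm_apply hρ).clm_apply contDiffAt_const).differentiableAt (by norm_num)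
    rw [(e1.hasFDerivAt.fun_sub (e2.hasFDerivAt.fun_mul e2.hasFDerivAt)).fderiv]
    simp [hk]
  simp only [coordLie, h1, coordInduced_apply, hk]
  ring

/-- Two vector fields which agree on a level set have the same extrinsic Lie derivative in the
directions tangent to it. -/
lemma coordLie_congr_of_eqOn_levelSet [CompleteSpace E] {t : E → E →L[ℝ] E →L[ℝ] ℝ} {f : E → ℝ}
    {ρ ρ' : E → E} {y : E} (hf : ContDiffAt ℝ 1 f y) (hρ : ContDiffAt ℝ 1 ρ y)
    (hρ' : ContDiffAt ℝ 1 ρ' y) (hdf : fderiv ℝ f y ≠ 0) (hy : f y = 0)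
    (h : ∀ᶠ z in 𝓝 y, f z = 0 → ρ z = ρ' z) {k : E} (hk : fderiv ℝ f y k = 0) :
    coordLie ρ t y k k = coordLie ρ' t y k k := by
  have h1 := fderiv_eq_zero_of_eqOn_levelSet hf (h := fun z => ρ z - ρ' z) (hρ.sub hρ') hdf hy
    (h.mono fun z hz hz' => sub_eq_zero.2 (hz hz')) hk
  rw [fderiv_fun_sub (hρ.differentiableAt (by norm_num)) (hρ'.differentiableAt (by norm_num)),
    _root_.sub_apply, sub_eq_zero] at h1
  simp only [coordLie, h1, h.self_of_nhds hy]

/-- The second derivative of `f` along a curve with velocity `k` and acceleration `a`. -/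
def coordHess (f : E → ℝ) (y k a : E) : ℝ := fderiv ℝ (fderiv ℝ f) y k k + fderiv ℝ f y a

/-- The extrinsic curvature of a level set is the second derivative of the defining function along
geodesics. -/
lemma half_coordLie_eq [CompleteSpace E] {t : E → E →L[ℝ] E →L[ℝ] ℝ} {f : E → ℝ} {ρ : E → E}
    {y k a : E} (ht : ContDiffAt ℝ 1 t y) (hf : ContDiffAt ℝ 2 f y) (hρ : ContDiffAt ℝ 1 ρ y)
    (hsymm : ∀ᶠ z in 𝓝 y, ∀ a b, t z a b = t z b a) (hy : f y = 0)
    (hN : ∀ᶠ z in 𝓝 y, f z = 0 → CoordUnitNormal t f ρ z) (hk : fderiv ℝ f y k = 0)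
    (ha : ∀ w, coordGeo t y k a w = 0) :
    (1 / 2) * coordLie ρ t y k k = (fderiv ℝ f y (ρ y))⁻¹ * coordHess f y k a := by
  have hNy := hN.self_of_nhds hy
  have hdf : fderiv ℝ f y ≠ 0 := by
    intro h0
    have := hNy.pos
    simp [h0] at this
  have hdfC : ContDiffAt ℝ 1 (fderiv ℝ f) y := hf.fderiv_right (m := 1) (by norm_num)
  have e1 : ContDiffAt ℝ 1 (fun z => t z (ρ z) k) y :=
    (ht.clm_apply hρ).clm_apply contDiffAt_const
  have e2 : ContDiffAt ℝ 1 (fun z => (fderiv ℝ f z (ρ z))⁻¹) y :=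
    (hdfC.clm_apply hρ).inv hNy.pos.ne'
  have e3 : ContDiffAt ℝ 1 (fun z => fderiv ℝ f z k) y := hdfC.clm_apply contDiffAt_const
  -- The identity `t(ρ, k) = df(k) / df(ρ)`, with `k` frozen, holds along the level set and is
  -- differentiated in the tangent direction `k`. The derivative of `1 / df(ρ)` drops out since
  -- `df(k) = 0`.
  have h0 := fderiv_eq_zero_of_eqOn_levelSet (hf.of_le (by norm_num))
    (h := fun z => t z (ρ z) k - (fderiv ℝ f z (ρ z))⁻¹ * fderiv ℝ f z k) (e1.sub (e2.mul e3))
    hdf hy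
    (hN.mono fun z hz hz' => sub_eq_zero.2 ((hz hz').apply_eq k)) hk
  have d1 := e1.differentiableAt (by norm_num)
  have d2 := e2.differentiableAt (by norm_num)
  have d3 := e3.differentiableAt (by norm_num)
  have dt := ht.differentiableAt (by norm_num)
  have dρ := hρ.differentiableAt (by norm_num)
  have h1 : fderiv ℝ (fun z => t z (ρ z) k) y k
      = fderiv ℝ t y k (ρ y) k + t y (fderiv ℝ ρ y k) k := by
    have := ((dt.hasFDerivAt.clm_apply dρ.hasFDerivAt).clm_apply (hasFDerivAt_const k y)).fderiv
    rw [this]; simp [add_comm]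
  have h2 : fderiv ℝ (fun z => fderiv ℝ f z k) y k = fderiv ℝ (fderiv ℝ f) y k k := by
    have := ((hdfC.differentiableAt (by norm_num)).hasFDerivAt.clm_apply
      (hasFDerivAt_const k y)).fderiv
    rw [this]; simp
  rw [(d1.hasFDerivAt.fun_sub (d2.hasFDerivAt.fun_mul d3.hasFDerivAt)).fderiv] at h0
  simp only [_root_.sub_apply, _root_.add_apply, _root_.smul_apply, h1, h2, hk, smul_eq_mul,
    zero_mul, add_zero] at h0
  -- Testing the geodesic equation with the normal expresses the derivative of `t` along `ρ` on `(k,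
  -- k)` through the acceleration and the derivative along `k`.
  have h3 := ha (ρ y)
  have h4 : t y a (ρ y) = (fderiv ℝ f y (ρ y))⁻¹ * fderiv ℝ f y a := by
    rw [hsymm.self_of_nhds, hNy.apply_eq]
  have h5 : fderiv ℝ t y k k (ρ y) = fderiv ℝ t y k (ρ y) k := by
    rw [← fderiv_apply₂ dt, ← fderiv_apply₂ dt]
    exact congrArg (fun L => L k) (Filter.EventuallyEq.fderiv_eq (𝕜 := ℝ)
      (hsymm.mono fun z hz => hz k (ρ y)))
  simp only [coordGeo, h4, h5] at h3
  simp only [coordLie, coordHess, hsymm.self_of_nhds k]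
  linarith

end CoordinateHypersurface

/-! ### Distance to the zero set of a submersion. -/

section Regularity

/-- Metric regularity: if `G ≤ 0` on the zero set of a submersion `Ψ`, then `G ≤ C ‖Ψ‖`. -/
lemma exists_le_mul_norm_of_submersion {V F : Type*} [NormedAddCommGroup V] [NormedSpace ℝ V]
    [CompleteSpace V] [NormedAddCommGroup F] [NormedSpace ℝ F] [CompleteSpace F]
    {Ψ : V → F} {Ψ' : V →L[ℝ] F} {G : V → ℝ} {z₀ : V} (hΨ : HasStrictFDerivAt Ψ Ψ' z₀)
    (hsurj : Ψ'.range = ⊤) (hG : ContDiffAt ℝ 1 G z₀) (h0 : Ψ z₀ = 0)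
    (h : ∀ᶠ z in 𝓝 z₀, Ψ z = 0 → G z ≤ 0) :
    ∃ C : ℝ, 0 ≤ C ∧ ∀ᶠ z in 𝓝 z₀, G z ≤ C * ‖Ψ z‖ := by
  set g := Ψ'.nonlinearRightInverseOfSurjective hsurj with hg
  have hgpos : 0 < g.nnnorm := Ψ'.nonlinearRightInverseOfSurjective_nnnorm_pos hsurj
  -- With an approximation error of half the covering rate of the derivative, `Ψ` still covers at
  -- the rate `c`.
  set c : NNReal := g.nnnorm⁻¹ / 2 with hc
  have hcpos : 0 < c := by positivity
  obtain ⟨s, hs, hs'⟩ := hΨ.approximates_deriv_on_nhds (Or.inr hcpos)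
  obtain ⟨K, u, hu, hK⟩ := hG.exists_lipschitzOnWith
  obtain ⟨r, hr, hball⟩ := Metric.nhds_basis_closedBall.mem_iff.1
    (inter_mem (inter_mem hs hu) h)
  have hcont : Tendsto (fun z => ‖Ψ z‖ / c) (𝓝 z₀) (𝓝 0) := by
    have := (hΨ.continuousAt.norm).div_const (c : ℝ)
    simpa [ContinuousAt, h0] using this
  refine ⟨K / c, by positivity, ?_⟩
  filter_upwards [hcont.eventually_le_const (half_pos hr),
    Metric.closedBall_mem_nhds z₀ (half_pos hr)]
    with z hz1 hz2
  set ε := ‖Ψ z‖ / c with hε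
  have hε0 : 0 ≤ ε := by positivity
  have hsub : Metric.closedBall z ε ⊆ Metric.closedBall z₀ r :=
    Metric.closedBall_subset_closedBall' (by
      have := Metric.mem_closedBall.1 hz2
      linarith)
  -- The image of the ball of radius `ε = ‖Ψ z‖ / c` about `z` contains the ball of radius `‖Ψ z‖`
  -- about `Ψ z`, hence `0`. So there is a zero of `Ψ` within `ε` of `z`, and the Lipschitz bound
  -- for `G` concludes.
  have hsurjOn := hs'.surjOn_closedBall_of_nonlinearRightInverse g hε0
    (fun x hx => (hball (hsub hx)).1.1)
  have hrad : ((g.nnnorm : ℝ)⁻¹ - c) * ε = ‖Ψ z‖ := by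
    have h1 : (g.nnnorm : ℝ)⁻¹ = 2 * (c : ℝ) := by
      rw [hc]; push_cast; ring
    have h2 : (c : ℝ) ≠ 0 := by exact_mod_cast hcpos.ne'
    rw [h1, hε]
    field_simp
    ring
  rw [hrad] at hsurjOn
  obtain ⟨z', hz', hΨz'⟩ := hsurjOn (show (0 : F) ∈ Metric.closedBall (Ψ z) ‖Ψ z‖ by simp)
  have hz'b := hball (hsub hz')
  have hzb := hball (hsub (Metric.mem_closedBall_self hε0))
  have h1 : G z' ≤ 0 := hz'b.2 hΨz'
  have h2 := hK.dist_le_mul z hzb.1.2 z' hz'b.1.2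
  have h3 : dist z z' ≤ ε := by rw [dist_comm]; exact hz'
  have h4 : G z - G z' ≤ dist (G z) (G z') := le_abs_self _
  have h5 : (K : ℝ) * dist z z' ≤ K * ε := mul_le_mul_of_nonneg_left h3 K.2
  have h6 : (K : ℝ) / c * ‖Ψ z‖ = K * ε := by rw [hε]; ring
  linarith

end Regularity

/-! ### The geodesic equation as an ODE, and how null geodesics leave a level set. -/

section CoordinateGeodesics

set_option maxSynthPendingDepth 3

variable {E : Type*} [NormedAddCommGroup E] [NormedSpace ℝ E]

lemma contDiffAt_flip {X F G : Type*} [NormedAddCommGroup X] [NormedSpace ℝ X]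
    [NormedAddCommGroup F] [NormedSpace ℝ F] [NormedAddCommGroup G] [NormedSpace ℝ G]
    {n : WithTop ℕ∞} {f : X → E →L[ℝ] F →L[ℝ] G} {x : X} (hf : ContDiffAt ℝ n f x) :
    ContDiffAt ℝ n (fun z => (f z).flip) x :=
  (ContinuousLinearMap.flipₗᵢ ℝ E F G).contDiff.contDiffAt.comp x hf

lemma contDiffAt_comp_fst {F G : Type*} [NormedAddCommGroup F] [NormedSpace ℝ F]
    [NormedAddCommGroup G] [NormedSpace ℝ G] {n : WithTop ℕ∞} {f : E → G} {y : E} (k : F)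
    (hf : ContDiffAt ℝ n f y) : ContDiffAt ℝ n (fun z : E × F => f z.1) (y, k) :=
  ContDiffAt.comp (f := Prod.fst) (g := f) (y, k) hf contDiffAt_fst

lemma hasFDerivAt_comp_fst {F G : Type*} [NormedAddCommGroup F] [NormedSpace ℝ F]
    [NormedAddCommGroup G] [NormedSpace ℝ G] {f : E → G} {f' : E →L[ℝ] G} {y : E} (k : F)
    (hf : HasFDerivAt f f' y) :
    HasFDerivAt (fun z : E × F => f z.1) (f'.comp (ContinuousLinearMap.fst ℝ E F)) (y, k) :=
  HasFDerivAt.comp (f := Prod.fst) (g := f) (y, k) hf hasFDerivAt_fst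

/-- The acceleration of the geodesic with position `y` and velocity `k`. -/
def coordAcc (t : E → E →L[ℝ] E →L[ℝ] ℝ) (y k : E) : E :=
  (t y).inverse ((1 / 2 : ℝ) • ((fderiv ℝ t y).flip k).flip k - fderiv ℝ t y k k)

lemma coordGeo_coordAcc {t : E → E →L[ℝ] E →L[ℝ] ℝ} {y : E} (h : (t y).IsInvertible) (k w : E) :
    coordGeo t y k (coordAcc t y k) w = 0 := by
  rw [coordGeo, coordAcc, h.self_apply_inverse]
  simp

lemma eq_coordAcc {t : E → E →L[ℝ] E →L[ℝ] ℝ} {y k a : E} (h : (t y).IsInvertible)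
    (ha : ∀ w, coordGeo t y k a w = 0) : a = coordAcc t y k := by
  apply h.injective
  ext w
  have h1 := ha w
  have h2 := coordGeo_coordAcc h k w
  simp only [coordGeo] at h1 h2
  linarith

lemma contDiffAt_coordAcc [CompleteSpace E] {t : E → E →L[ℝ] E →L[ℝ] ℝ} {y : E} (k : E)
    (ht : ContDiffAt ℝ 3 t y) (h : (t y).IsInvertible) :
    ContDiffAt ℝ 1 (fun z : E × E => coordAcc t z.1 z.2) (y, k) := by
  have h1 : ContDiffAt ℝ 1 (fun z : E × E => (t z.1).inverse) (y, k) :=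
    ContDiffAt.comp (f := fun z : E × E => t z.1) (g := ContinuousLinearMap.inverse) (y, k)
      h.contDiffAt_map_inverse
      (contDiffAt_comp_fst k (ht.of_le (by norm_num)))
  have h2 : ContDiffAt ℝ 1 (fun z : E × E => fderiv ℝ t z.1) (y, k) :=
    contDiffAt_comp_fst k (ht.fderiv_right (m := 1) (by norm_num))
  have h3 : ContDiffAt ℝ 1 (fun z : E × E => (fderiv ℝ t z.1).flip) (y, k) :=
    contDiffAt_flip h2
  have h4 : ContDiffAt ℝ 1 (fun z : E × E => ((fderiv ℝ t z.1).flip z.2).flip) (y, k) :=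
    contDiffAt_flip (h3.clm_apply contDiffAt_snd)
  exact h1.clm_apply (((h4.clm_apply contDiffAt_snd).const_smul (1 / 2 : ℝ)).sub
    ((h2.clm_apply contDiffAt_snd).clm_apply contDiffAt_snd))

lemma contDiffAt_coordHess [CompleteSpace E] {t : E → E →L[ℝ] E →L[ℝ] ℝ} {f : E → ℝ} {y : E}
    (k : E) (ht : ContDiffAt ℝ 3 t y) (h : (t y).IsInvertible) (hf : ContDiffAt ℝ 3 f y) :
    ContDiffAt ℝ 1 (fun z : E × E => coordHess f z.1 z.2 (coordAcc t z.1 z.2)) (y, k) := by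
  have h1 : ContDiffAt ℝ 2 (fderiv ℝ f) y := hf.fderiv_right (m := 2) (by norm_num)
  have h2 : ContDiffAt ℝ 1 (fun z : E × E => fderiv ℝ f z.1) (y, k) :=
    contDiffAt_comp_fst k (h1.of_le (by norm_num))
  have h3 : ContDiffAt ℝ 1 (fun z : E × E => fderiv ℝ (fderiv ℝ f) z.1) (y, k) :=
    contDiffAt_comp_fst k (h1.fderiv_right (m := 1) (by norm_num))
  exact ((h3.clm_apply contDiffAt_snd).clm_apply contDiffAt_snd).add
    (h2.clm_apply (contDiffAt_coordAcc k ht h))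

/-- If the Hessian of a defining function is nonpositive on the null vectors tangent to its zero
set, it is bounded above on all null vectors by the failure to be such a vector. -/
lemma exists_coordHess_le [CompleteSpace E] {t : E → E →L[ℝ] E →L[ℝ] ℝ} {f : E → ℝ} {ρ : E → E}
    {y k : E} (ht : ContDiffAt ℝ 3 t y) (hinv : (t y).IsInvertible) (hf : ContDiffAt ℝ 3 f y)
    (hsymm : ∀ a b, t y a b = t y b a) (hy : f y = 0) (hN : CoordUnitNormal t f ρ y)
    (hk0 : k ≠ 0) (hk : fderiv ℝ f y k = 0) (hnull : t y k k = 0)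
    (h : ∀ᶠ z in 𝓝 y, f z = 0 → ∀ k, fderiv ℝ f z k = 0 → t z k k = 0 →
      coordHess f z k (coordAcc t z k) ≤ 0) :
    ∃ C : ℝ, 0 ≤ C ∧ ∀ᶠ z in 𝓝 (y, k), t z.1 z.2 z.2 = 0 →
      coordHess f z.1 z.2 (coordAcc t z.1 z.2) ≤ C * (|f z.1| + |fderiv ℝ f z.1 z.2|) := by
  have e1 : ContDiffAt ℝ 1 (fun z : E × E => f z.1) (y, k) :=
    contDiffAt_comp_fst k (hf.of_le (by norm_num))
  have e2 : ContDiffAt ℝ 1 (fun z : E × E => fderiv ℝ f z.1) (y, k) :=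
    contDiffAt_comp_fst k (hf.fderiv_right (m := 1) (by norm_num))
  have e3 : ContDiffAt ℝ 1 (fun z : E × E => t z.1) (y, k) :=
    contDiffAt_comp_fst k (ht.of_le (by norm_num))
  have e4 : ContDiffAt ℝ 1 (fun z : E × E => fderiv ℝ f z.1 z.2) (y, k) :=
    e2.clm_apply contDiffAt_snd
  have e5 : ContDiffAt ℝ 1 (fun z : E × E => t z.1 z.2 z.2) (y, k) :=
    (e3.clm_apply contDiffAt_snd).clm_apply contDiffAt_snd
  -- The zeros of `Ψ` are the null vectors tangent to the level set at its points, which is where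
  -- the Hessian is known to be nonpositive.
  set Ψ : E × E → ℝ × ℝ × ℝ := fun z => (f z.1, fderiv ℝ f z.1 z.2, t z.1 z.2 z.2) with hΨdef
  have hΨ : ContDiffAt ℝ 1 Ψ (y, k) := e1.prodMk (e4.prodMk e5)
  have d1 : HasFDerivAt f (fderiv ℝ f y) y :=
    (hf.differentiableAt (by norm_num)).hasFDerivAt
  have d2 : HasFDerivAt (fderiv ℝ f) (fderiv ℝ (fderiv ℝ f) y) y :=
    ((hf.fderiv_right (m := 1) (by norm_num)).differentiableAt (by norm_num)).hasFDerivAt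
  have d3 : HasFDerivAt t (fderiv ℝ t y) y :=
    (ht.differentiableAt (by norm_num)).hasFDerivAt
  have g1 : HasFDerivAt (fun z : E × E => f z.1) _ (y, k) :=
    hasFDerivAt_comp_fst k d1
  have g2 : HasFDerivAt (fun z : E × E => fderiv ℝ f z.1) _ (y, k) :=
    hasFDerivAt_comp_fst k d2
  have g3 : HasFDerivAt (fun z : E × E => t z.1) _ (y, k) :=
    hasFDerivAt_comp_fst k d3
  have g : HasFDerivAt Ψ _ (y, k) := g1.prodMk ((g2.clm_apply hasFDerivAt_snd).prodMk
    ((g3.clm_apply hasFDerivAt_snd).clm_apply hasFDerivAt_snd))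
  have hsurj : (fderiv ℝ Ψ (y, k)).range = ⊤ := by
    rw [g.fderiv]
    have hρ := hN.pos
    have hkρ : t y k (ρ y) = 0 := by rw [hsymm]; exact hN.normal k hk
    -- Nondegeneracy supplies `w`. Since `t(k, ρ) = 0`, its component along `ρ` can be removed
    -- without changing `t(k, w)`. The differential of `Ψ` is then triangular: moving the point
    -- along `ρ` adjusts the first entry, moving the vector along `ρ` the second, and moving it
    -- along `w'` the third.
    obtain ⟨w, hw⟩ : ∃ w, t y k w ≠ 0 := by
      by_contra! hcon
      exact hk0 (hinv.injective (by ext w; simp [hcon w]))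
    rw [eq_top_iff]
    rintro ⟨b₁, b₂, b₃⟩ -
    set δ := (b₁ / fderiv ℝ f y (ρ y)) • ρ y with hδ
    set w' := w - (fderiv ℝ f y w / fderiv ℝ f y (ρ y)) • ρ y with hw'
    have hfw' : fderiv ℝ f y w' = 0 := by
      rw [hw', map_sub, map_smul, smul_eq_mul, div_mul_cancel₀ _ hρ.ne', sub_self]
    have htw' : t y k w' = t y k w := by
      rw [hw', map_sub, map_smul, hkρ, smul_zero, sub_zero]
    have hfδ : fderiv ℝ f y δ = b₁ := by
      rw [hδ, map_smul, smul_eq_mul, div_mul_cancel₀ _ hρ.ne']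
    set c₂ := (b₂ - fderiv ℝ (fderiv ℝ f) y δ k) / fderiv ℝ f y (ρ y) with hc₂
    set c₃ := (b₃ - fderiv ℝ t y δ k k) / (2 * t y k w) with hc₃
    refine ⟨(δ, c₂ • ρ y + c₃ • w'), ?_⟩
    have hkk : t y (c₂ • ρ y + c₃ • w') k = c₃ * t y k w := by
      rw [hsymm, map_add, map_smul, map_smul, hkρ, htw']; simp
    have hkk' : t y k (c₂ • ρ y + c₃ • w') = c₃ * t y k w := by rw [hsymm, hkk]
    have hfk : fderiv ℝ f y (c₂ • ρ y + c₃ • w') = c₂ * fderiv ℝ f y (ρ y) := by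
      rw [map_add, map_smul, map_smul, hfw']; simp
    have h2 : c₂ * fderiv ℝ f y (ρ y) = b₂ - fderiv ℝ (fderiv ℝ f) y δ k :=
      div_mul_cancel₀ _ hρ.ne'
    have h3 : c₃ * t y k w = (b₃ - fderiv ℝ t y δ k k) / 2 := by
      rw [hc₃]; field_simp
    ext
    · simp [hfδ]
    · simp [hfk, h2, -map_add, -map_smul]
    · simp [hkk, hkk', h3, -map_add, -map_smul]; ring
  obtain ⟨C, hC, hC'⟩ := exists_le_mul_norm_of_submersion (hΨ.hasStrictFDerivAt (by norm_num)) hsurj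
    (contDiffAt_coordHess k ht hinv hf) (by simp [hΨdef, hy, hk, hnull])
    (by
      have := (continuousAt_fst (p := (y, k))).eventually h
      filter_upwards [this] with z hz hz0
      simp only [hΨdef, Prod.mk_eq_zero] at hz0
      exact hz hz0.1 z.2 hz0.2.1 hz0.2.2)
  refine ⟨C, hC, hC'.mono fun z hz hz0 => hz.trans (mul_le_mul_of_nonneg_left ?_ hC)⟩
  simp only [hΨdef, hz0, Prod.norm_def, norm_zero, Real.norm_eq_abs]
  have a1 := abs_nonneg (f z.1)
  have a2 := abs_nonneg (fderiv ℝ f z.1 z.2)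
  exact max_le (by linarith) (max_le (by linarith) (by linarith))

/-- Along a curve with velocity `v` and acceleration `a`. -/
lemma hasDerivAt_comp_curve {f : E → ℝ} {c v : ℝ → E} {s : ℝ} {a : E} (hf : ContDiffAt ℝ 2 f (c s))
    (hc : HasDerivAt c (v s) s) (hv : HasDerivAt v a s) :
    HasDerivAt (fun τ => f (c τ)) (fderiv ℝ f (c s) (v s)) s ∧
    HasDerivAt (fun τ => fderiv ℝ f (c τ) (v τ)) (coordHess f (c s) (v s) a) s := by
  have d1 : HasFDerivAt f (fderiv ℝ f (c s)) (c s) :=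
    (hf.differentiableAt (by norm_num)).hasFDerivAt
  have d2 : HasFDerivAt (fderiv ℝ f) (fderiv ℝ (fderiv ℝ f) (c s)) (c s) :=
    ((hf.fderiv_right (m := 1) (by norm_num)).differentiableAt (by norm_num)).hasFDerivAt
  refine ⟨d1.comp_hasDerivAt s hc, ?_⟩
  exact (d2.comp_hasDerivAt s hc).clm_apply hv

/-- Geodesics have velocity of constant length. -/
lemma hasDerivAt_normSq_geodesic {t : E → E →L[ℝ] E →L[ℝ] ℝ} {c v : ℝ → E} {s : ℝ} {a : E}
    (ht : DifferentiableAt ℝ t (c s)) (hsymm : ∀ a b, t (c s) a b = t (c s) b a)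
    (hc : HasDerivAt c (v s) s) (hv : HasDerivAt v a s)
    (hg : coordGeo t (c s) (v s) a (v s) = 0) :
    HasDerivAt (fun τ => t (c τ) (v τ) (v τ)) 0 s := by
  have h1 := ((ht.hasFDerivAt.comp_hasDerivAt s hc).clm_apply hv).clm_apply hv
  refine h1.congr_deriv ?_
  simp only [coordGeo] at hg
  simp only [_root_.add_apply, hsymm (v s) a, Function.comp_apply]
  linarith

/-- A null geodesic which starts tangent to the zero set of `f` does not enter `{f > 0}` at once
if the Hessian of `f` is nonpositive on tangent null vectors. -/
lemma eventually_nonpos_of_coordHess_nonpos [CompleteSpace E] {t : E → E →L[ℝ] E →L[ℝ] ℝ}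
    {f : E → ℝ} {ρ : E → E} {c v a : ℝ → E}
    (ht : ∀ᶠ z in 𝓝 (c 0), ContDiffAt ℝ 3 t z ∧ (t z).IsInvertible ∧ ∀ a b, t z a b = t z b a)
    (hf : ContDiffAt ℝ 3 f (c 0)) (hy : f (c 0) = 0) (hN : CoordUnitNormal t f ρ (c 0))
    (hk0 : v 0 ≠ 0) (hk : fderiv ℝ f (c 0) (v 0) = 0) (hnull : t (c 0) (v 0) (v 0) = 0)
    (h : ∀ᶠ z in 𝓝 (c 0), f z = 0 → ∀ k, fderiv ℝ f z k = 0 → t z k k = 0 →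
      coordHess f z k (coordAcc t z k) ≤ 0)
    (hcurve : ∀ᶠ s in 𝓝 (0 : ℝ), HasDerivAt c (v s) s ∧ HasDerivAt v (a s) s ∧
      ∀ w, coordGeo t (c s) (v s) (a s) w = 0) :
    ∀ᶠ s in 𝓝[>] (0 : ℝ), f (c s) ≤ 0 := by
  obtain ⟨ht0, hinv0, hsymm0⟩ := ht.self_of_nhds
  obtain ⟨C, hC, hC'⟩ := exists_coordHess_le ht0 hinv0 hf hsymm0 hy hN hk0 hk hnull h
  have hcc : ContinuousAt c 0 := hcurve.self_of_nhds.1.continuousAt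
  have hvc : ContinuousAt v 0 := hcurve.self_of_nhds.2.1.continuousAt
  have hev : ∀ᶠ s in 𝓝 (0 : ℝ), (HasDerivAt c (v s) s ∧ HasDerivAt v (a s) s ∧
      ∀ w, coordGeo t (c s) (v s) (a s) w = 0) ∧
      (ContDiffAt ℝ 3 t (c s) ∧ (t (c s)).IsInvertible ∧ ∀ a b, t (c s) a b = t (c s) b a) ∧
      ContDiffAt ℝ 3 f (c s) ∧ (t (c s) (v s) (v s) = 0 →
        coordHess f (c s) (v s) (coordAcc t (c s) (v s))
          ≤ C * (|f (c s)| + |fderiv ℝ f (c s) (v s)|)) := by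
    filter_upwards [hcurve, hcc.eventually ht, hcc.eventually (hf.eventually (by decide)),
      (hcc.prodMk hvc).eventually hC'] with s h1 h2 h3 h4
    exact ⟨h1, h2, h3, h4⟩
  obtain ⟨δ, hδ, hball⟩ := Metric.nhds_basis_closedBall.mem_iff.1 hev
  -- `T` has to stay in the neighbourhood where everything holds and to satisfy `T ≤ 1` and `2 C T <
  -- 1`. The `+ 1` covers `C = 0`.
  set T := min δ (min 1 (1 / (2 * (2 * C + 1)))) with hTdef
  have hT : 0 < T := by positivity
  have hTδ : T ≤ δ := min_le_left _ _
  have hT1 : T ≤ 1 := (min_le_right _ _).trans (min_le_left _ _)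
  have hT2 : T ≤ 1 / (2 * (2 * C + 1)) := (min_le_right _ _).trans (min_le_right _ _)
  have hCT : 2 * C * T < 1 := by
    have := mul_le_mul_of_nonneg_left hT2 (show 0 ≤ 2 * C by positivity)
    refine this.trans_lt ?_
    rw [mul_one_div, div_lt_one (by positivity)]
    linarith
  have hmem : ∀ s ∈ Icc 0 T, s ∈ Metric.closedBall (0 : ℝ) δ := fun s hs => by
    rw [Metric.mem_closedBall, Real.dist_eq, sub_zero, abs_of_nonneg hs.1]
    exact hs.2.trans hTδ
  -- The bound on the Hessian is available on null vectors only, so the velocity must be known to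
  -- remain null.
  have hnull' : ∀ s ∈ Icc 0 T, t (c s) (v s) (v s) = 0 := by
    intro s hs
    have hd : ∀ x ∈ Icc 0 T, HasDerivAt (fun τ => t (c τ) (v τ) (v τ)) 0 x := fun x hx => by
      obtain ⟨⟨h1, h2, h3⟩, ⟨h4, -, h5⟩, -⟩ := hball (hmem x hx)
      exact hasDerivAt_normSq_geodesic (h4.differentiableAt (by norm_num)) h5 h1 h2 (h3 _)
    have := constant_of_has_deriv_right_zero
      (fun x hx => (hd x hx).continuousAt.continuousWithinAt)
      (fun x hx => (hd x (Ico_subset_Icc_self hx)).hasDerivWithinAt) s hs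
    rw [this, hnull]
  have hmain := nonpos_of_deriv_le (u := fun s => f (c s)) (w := fun s => fderiv ℝ f (c s) (v s))
    (w' := fun s => coordHess f (c s) (v s) (a s)) hC hT hT1 hCT
    (fun s hs => by
      obtain ⟨⟨h1, h2, -⟩, -, h4, -⟩ := hball (hmem s hs)
      exact (hasDerivAt_comp_curve (h4.of_le (by norm_num)) h1 h2).1)
    (fun s hs => by
      obtain ⟨⟨h1, h2, -⟩, -, h4, -⟩ := hball (hmem s hs)
      exact (hasDerivAt_comp_curve (h4.of_le (by norm_num)) h1 h2).2)
    hy hk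
    (fun s hs => by
      obtain ⟨⟨-, -, h3⟩, ⟨-, h5, -⟩, -, h7⟩ := hball (hmem s hs)
      have := h7 (hnull' s hs)
      rwa [← eq_coordAcc h5 h3] at this)
  filter_upwards [Ioc_mem_nhdsGT hT] with s hs
  exact hmain s ⟨hs.1.le, hs.2⟩

/-- Second-derivative test with `w = u'`: the slope of `w` at `0` tends to `w' > 0`, so `w > 0` just
after `0` and `u` increases strictly. -/
lemma eventually_pos_of_deriv_pos {u w : ℝ → ℝ} {w' : ℝ}
    (hu : ∀ᶠ s in 𝓝 (0 : ℝ), HasDerivAt u (w s) s)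
    (hw : HasDerivAt w w' 0) (hu0 : u 0 = 0) (hw0 : w 0 = 0) (hpos : 0 < w') :
    ∀ᶠ s in 𝓝[>] (0 : ℝ), 0 < u s := by
  have h1 : ∀ᶠ s in 𝓝[>] (0 : ℝ), 0 < w s := by
    have h2 := (hasDerivAt_iff_tendsto_slope.1 hw).mono_left
      (nhdsWithin_mono 0 (fun x (hx : 0 < x) => hx.ne'))
    filter_upwards [h2.eventually_const_lt hpos, self_mem_nhdsWithin] with s hs hs0
    rw [slope_def_field, hw0, sub_zero, sub_zero] at hs
    exact (div_pos_iff_of_pos_right hs0).1 hs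
  obtain ⟨δ, hδ, hδ'⟩ := mem_nhdsGT_iff_exists_Ioc_subset.1
    (h1.and (nhdsWithin_le_nhds hu))
  filter_upwards [Ioc_mem_nhdsGT hδ] with s hs
  have hmono : StrictMonoOn u (Icc 0 s) := by
    refine strictMonoOn_of_deriv_pos (convex_Icc 0 s) (fun x hx => ?_) (fun x hx => ?_)
    · rcases hx.1.eq_or_lt with rfl | h0
      · exact hu.self_of_nhds.continuousAt.continuousWithinAt
      · exact (hδ' ⟨h0, hx.2.trans hs.2⟩).2.continuousAt.continuousWithinAt
    · rw [interior_Icc] at hx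
      have := hδ' ⟨hx.1, hx.2.le.trans hs.2⟩
      rw [this.2.deriv]
      exact this.1
  have := hmono (left_mem_Icc.2 hs.1.le) (right_mem_Icc.2 hs.1.le) hs.1
  linarith

/-- Existence of geodesics. -/
lemma exists_coord_geodesic [CompleteSpace E] {t : E → E →L[ℝ] E →L[ℝ] ℝ} {y : E} (k : E)
    (ht : ContDiffAt ℝ 3 t y) (hinv : ∀ᶠ z in 𝓝 y, (t z).IsInvertible) :
    ∃ c v : ℝ → E, c 0 = y ∧ v 0 = k ∧ ∀ᶠ s in 𝓝 (0 : ℝ), HasDerivAt c (v s) s ∧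
      HasDerivAt v (coordAcc t (c s) (v s)) s ∧ ContDiffAt ℝ 2 c s ∧
      ∀ w, coordGeo t (c s) (v s) (coordAcc t (c s) (v s)) w = 0 := by
  set F : E × E → E × E := fun z => (z.2, coordAcc t z.1 z.2) with hF
  have hFC : ContDiffAt ℝ 1 F (y, k) :=
    contDiffAt_snd.prodMk (contDiffAt_coordAcc k ht hinv.self_of_nhds)
  obtain ⟨α, hα0, ε, hε, hα⟩ :=
    hFC.exists_forall_mem_closedBall_exists_eq_forall_mem_Ioo_hasDerivAt₀ 0
  have hd : ∀ᶠ s in 𝓝 (0 : ℝ), HasDerivAt α (F (α s)) s := by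
    filter_upwards [Ioo_mem_nhds (show 0 - ε < 0 by linarith) (show 0 < 0 + ε by linarith)]
      with s hs using hα s hs
  have hcont : ContinuousAt α 0 := hd.self_of_nhds.continuousAt
  have hFev : ∀ᶠ s in 𝓝 (0 : ℝ), ContDiffAt ℝ 1 F (α s) :=
    hcont.eventually (by rw [hα0]; exact hFC.eventually (by decide))
  have hinv' : ∀ᶠ s in 𝓝 (0 : ℝ), (t (α s).1).IsInvertible := by
    have : ContinuousAt (fun s => (α s).1) 0 := hcont.fst
    exact this.eventually (p := fun z => (t z).IsInvertible)
      (by simpa only [hα0] using hinv)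
  refine ⟨fun s => (α s).1, fun s => (α s).2, by simp [hα0], by simp [hα0], ?_⟩
  have hall := hd.and (hFev.and hinv')
  obtain ⟨U, hU, hUo, h0U⟩ := eventually_nhds_iff.1 hall
  refine eventually_nhds_iff.2 ⟨U, fun s hs => ?_, hUo, h0U⟩
  -- Bootstrap: `α' = F ∘ α` with `F` of class `C¹` lifts `α` from `C⁰` to `C¹` and then to `C²`,
  -- the regularity which `IsGeodesicAt` demands.
  have hα1 : ∀ n : ℕ, n ≤ 2 → ContDiffOn ℝ n α U := by
    intro n
    induction n with
    | zero =>
      intro _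
      exact contDiffOn_zero.2 fun x hx => (hU x hx).1.continuousAt.continuousWithinAt
    | succ n ih =>
      intro hn
      have h1 := ih (by omega)
      push_cast
      rw [contDiffOn_succ_iff_deriv_of_isOpen hUo]
      refine ⟨fun x hx => (hU x hx).1.differentiableAt.differentiableWithinAt, by simp, ?_⟩
      have h2 : ContDiffOn ℝ n (fun x => F (α x)) U := fun x hx =>
        ContDiffAt.comp_contDiffWithinAt (g := F) x
          ((hU x hx).2.1.of_le (by exact_mod_cast (by omega : n ≤ 1))) (h1 x hx)
      exact h2.congr fun x hx => (hU x hx).1.deriv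
  obtain ⟨h1, h2, h3⟩ := hU s hs
  refine ⟨h1.fst, h1.snd, ?_, fun w => coordGeo_coordAcc h3 _ w⟩
  exact contDiffAt_fst.comp s ((hα1 2 le_rfl).contDiffAt (hUo.mem_nhds hs))

end CoordinateGeodesics

/-! ### Components in the preferred charts and changes of chart. -/

section Charts

set_option maxSynthPendingDepth 3
set_option linter.unusedSectionVars false

variable {E : Type*} [NormedAddCommGroup E] [NormedSpace ℝ E]
  {H : Type*} [TopologicalSpace H] {I : ModelWithCorners ℝ E H} [I.Boundaryless]
  {X : Type*} [TopologicalSpace X] [ChartedSpace H X]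

lemma two_le_infty : (2 : WithTop ℕ∞) ≤ ∞ := by
  exact WithTop.coe_le_coe.2 (le_top : (2 : ℕ∞) ≤ ⊤)

lemma three_le_infty : (3 : WithTop ℕ∞) ≤ ∞ := by
  exact WithTop.coe_le_coe.2 (le_top : (3 : ℕ∞) ≤ ⊤)

lemma one_le_infty : (1 : WithTop ℕ∞) ≤ ∞ := by
  exact_mod_cast (le_top : (1 : ℕ∞) ≤ ⊤)

/-- The differential at `x` of the preferred chart at `x₀`. -/
def chartDiff (I : ModelWithCorners ℝ E H) (x₀ x : X) : E →L[ℝ] E :=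
  mfderiv I 𝓘(ℝ, E) (extChartAt I x₀) x

/-- The differential at `y` of the inverse of the preferred chart at `x₀`. -/
def chartSymmDiff (I : ModelWithCorners ℝ E H) (x₀ : X) (y : E) : E →L[ℝ] E :=
  mfderiv 𝓘(ℝ, E) I (extChartAt I x₀).symm y

/-- The transition map from the chart at `p` to the chart at `x₀`. -/
def chartChange (I : ModelWithCorners ℝ E H) (p x₀ : X) (y : E) : E :=
  extChartAt I x₀ ((extChartAt I p).symm y)

/-- The value of a field of bilinear forms on vectors of the model space. -/
def formAt (T : ∀ p : X, TangentSpace I p → TangentSpace I p → ℝ) (x : X) (a b : E) : ℝ := T x a b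

/-- The value of a vector field, as a vector of the model space. -/
def vecAt (V : ∀ p : X, TangentSpace I p) (x : X) : E := V x

/-- The Lie derivative, on vectors of the model space. -/
def lieAt (V : ∀ p : X, TangentSpace I p) (T : ∀ p : X, TangentSpace I p → TangentSpace I p → ℝ)
    (x : X) (a b : E) : ℝ := lieDerivative V T x a b

variable [IsManifold I ∞ X]

-- `IsOutwardUnitNormal` and sections of the tangent bundle need an `IsManifold I 1` instance. It is
-- derived from the smooth structure and supplied locally by `haveI`.
omit [I.Boundaryless] in
lemma isManifold_one_of_infty : IsManifold I 1 X := IsManifold.of_le (n := ∞) (by simp)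

lemma chartSymmDiff_chartDiff {x₀ x : X} (hx : x ∈ (extChartAt I x₀).source) (u : E) :
    chartSymmDiff I x₀ (extChartAt I x₀ x) (chartDiff I x₀ x u) = u := by
  have := isManifold_one_of_infty (I := I) (X := X)
  have h := mfderivWithin_extChartAt_symm_comp_mfderiv_extChartAt' (I := I) hx
  rw [I.range_eq_univ, mfderivWithin_univ] at h
  exact congrArg (fun L => L u) h

lemma chartDiff_chartSymmDiff {x₀ : X} {y : E} (hy : y ∈ (extChartAt I x₀).target) (u : E) :
    chartDiff I x₀ ((extChartAt I x₀).symm y) (chartSymmDiff I x₀ y u) = u := by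
  have := isManifold_one_of_infty (I := I) (X := X)
  have h := mfderiv_extChartAt_comp_mfderivWithin_extChartAt_symm (I := I) hy
  rw [I.range_eq_univ, mfderivWithin_univ] at h
  exact congrArg (fun L => L u) h

lemma chartDiff_self (x : X) (u : E) : chartDiff I x x u = u := by
  have := isManifold_one_of_infty (I := I) (X := X)
  exact congrArg (fun L => L u) (mfderiv_extChartAt_self (I := I) (x := x))

lemma chartDiff_injective {x₀ x : X} (hx : x ∈ (extChartAt I x₀).source) :
    Function.Injective (chartDiff I x₀ x) :=
  Function.LeftInverse.injective (g := chartSymmDiff I x₀ (extChartAt I x₀ x))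
    fun u => chartSymmDiff_chartDiff hx u

lemma chartDiff_surjective {x₀ x : X} (hx : x ∈ (extChartAt I x₀).source) :
    Function.Surjective (chartDiff I x₀ x) := by
  intro u
  have h := chartDiff_chartSymmDiff ((extChartAt I x₀).map_source hx) u
  rw [(extChartAt I x₀).left_inv hx] at h
  exact ⟨_, h⟩

-- Each tangent space is the model space by definition, so this is `rfl`. The versions typed over
-- `E` allow rewriting of the base point without dependent types.
omit [I.Boundaryless] [IsManifold I ∞ X] in
lemma chartForm_eq (T : ∀ p : X, TangentSpace I p → TangentSpace I p → ℝ) (x₀ : X) (y a b : E) :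
    chartForm T x₀ y a b = formAt T ((extChartAt I x₀).symm y) (chartSymmDiff I x₀ y a)
      (chartSymmDiff I x₀ y b) := rfl

lemma chartForm_chartDiff (T : ∀ p : X, TangentSpace I p → TangentSpace I p → ℝ) {x₀ x : X}
    (hx : x ∈ (extChartAt I x₀).source) (u v : E) :
    chartForm T x₀ (extChartAt I x₀ x) (chartDiff I x₀ x u) (chartDiff I x₀ x v)
      = formAt T x u v := by
  rw [chartForm_eq, chartSymmDiff_chartDiff hx, chartSymmDiff_chartDiff hx,
    (extChartAt I x₀).left_inv hx]

lemma chartForm_self (T : ∀ p : X, TangentSpace I p → TangentSpace I p → ℝ) (x : X)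
    (u v : E) : chartForm T x (extChartAt I x x) u v = formAt T x u v := by
  have h := chartForm_chartDiff T (mem_extChartAt_source (I := I) x) u v
  rwa [chartDiff_self, chartDiff_self] at h

omit [I.Boundaryless] [IsManifold I ∞ X] in
lemma chartVector_eq (V : ∀ p : X, TangentSpace I p) (x₀ : X) (y : E) :
    chartVector V x₀ y = chartDiff I x₀ ((extChartAt I x₀).symm y)
      (vecAt V ((extChartAt I x₀).symm y)) := rfl

omit [I.Boundaryless] [IsManifold I ∞ X] in
lemma chartVector_apply (V : ∀ p : X, TangentSpace I p) {x₀ x : X}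
    (hx : x ∈ (extChartAt I x₀).source) :
    chartVector V x₀ (extChartAt I x₀ x) = chartDiff I x₀ x (vecAt V x) := by
  rw [chartVector_eq, (extChartAt I x₀).left_inv hx]

lemma contDiffAt_chartChange {p x₀ : X} {y : E} (hy : y ∈ (extChartAt I p).target)
    (hx : (extChartAt I p).symm y ∈ (extChartAt I x₀).source) :
    ContDiffAt ℝ ∞ (chartChange I p x₀) y := by
  rw [← contMDiffAt_iff_contDiffAt]
  exact ContMDiffAt.comp (I' := I) y (contMDiffAt_extChartAt' (by rwa [← extChartAt_source I]))
    ((contMDiffOn_extChartAt_symm p).contMDiffAt ((isOpen_extChartAt_target p).mem_nhds hy))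

lemma fderiv_chartChange {p x₀ : X} {y : E} (hy : y ∈ (extChartAt I p).target)
    (hx : (extChartAt I p).symm y ∈ (extChartAt I x₀).source) (a : E) :
    fderiv ℝ (chartChange I p x₀) y a
      = chartDiff I x₀ ((extChartAt I p).symm y) (chartSymmDiff I p y a) := by
  have h1 : MDifferentiableAt 𝓘(ℝ, E) I (extChartAt I p).symm y :=
    ((contMDiffOn_extChartAt_symm (n := ∞) p).contMDiffAt
      ((isOpen_extChartAt_target p).mem_nhds hy)).mdifferentiableAt (by simp)
  have h2 : MDifferentiableAt I 𝓘(ℝ, E) (extChartAt I x₀) ((extChartAt I p).symm y) :=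
    (contMDiffAt_extChartAt' (n := ∞) (by rwa [← extChartAt_source I])).mdifferentiableAt (by simp)
  have h3 := mfderiv_comp y h2 h1
  rw [← mfderiv_eq_fderiv]
  exact congrArg (fun L => L a) h3

omit [IsManifold I ∞ X] in
lemma eventually_target {p : X} {y : E} (hy : y ∈ (extChartAt I p).target) :
    ∀ᶠ z in 𝓝 y, z ∈ (extChartAt I p).target :=
  (isOpen_extChartAt_target p).mem_nhds hy

omit [IsManifold I ∞ X] in
lemma eventually_target_source {p x₀ : X} {y : E} (hy : y ∈ (extChartAt I p).target)
    (hx : (extChartAt I p).symm y ∈ (extChartAt I x₀).source) :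
    ∀ᶠ z in 𝓝 y, z ∈ (extChartAt I p).target ∧
      (extChartAt I p).symm z ∈ (extChartAt I x₀).source :=
  (eventually_target hy).and ((continuousAt_extChartAt_symm'' hy).eventually
    ((isOpen_extChartAt_source x₀).mem_nhds hx))

/-- `t` gives the components of the smooth field of bilinear forms `T` in all preferred charts. -/
structure IsSmoothForm (T : ∀ p : X, TangentSpace I p → TangentSpace I p → ℝ)
    (t : X → E → E →L[ℝ] E →L[ℝ] ℝ) : Prop where
  eq : ∀ x₀, ∀ y ∈ (extChartAt I x₀).target, ∀ a b, chartForm T x₀ y a b = t x₀ y a b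
  smooth : ∀ x₀, ∀ y ∈ (extChartAt I x₀).target, ContDiffAt ℝ ∞ (t x₀) y

section SmoothForm

variable {T : ∀ p : X, TangentSpace I p → TangentSpace I p → ℝ} {t : X → E → E →L[ℝ] E →L[ℝ] ℝ}

omit [I.Boundaryless] [IsManifold I ∞ X] in
lemma IsSmoothForm.differentiableAt (h : IsSmoothForm T t) {x₀ : X} {y : E}
    (hy : y ∈ (extChartAt I x₀).target) : DifferentiableAt ℝ (t x₀) y :=
  (h.smooth x₀ y hy).differentiableAt (by simp)

lemma IsSmoothForm.apply_chartDiff (h : IsSmoothForm T t) {x₀ x : X}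
    (hx : x ∈ (extChartAt I x₀).source) (u v : E) :
    t x₀ (extChartAt I x₀ x) (chartDiff I x₀ x u) (chartDiff I x₀ x v) = formAt T x u v := by
  rw [← h.eq x₀ _ ((extChartAt I x₀).map_source hx), chartForm_chartDiff T hx]

lemma IsSmoothForm.apply_self (h : IsSmoothForm T t) (x : X) (u v : E) :
    t x (extChartAt I x x) u v = formAt T x u v := by
  rw [← h.eq x _ (mem_extChartAt_target x)]
  exact chartForm_self T x u v

lemma IsSmoothForm.pullback (h : IsSmoothForm T t) {p x₀ : X} {y : E}
    (hy : y ∈ (extChartAt I p).target) (hx : (extChartAt I p).symm y ∈ (extChartAt I x₀).source)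
    (a b : E) :
    t p y a b = t x₀ (chartChange I p x₀ y) (fderiv ℝ (chartChange I p x₀) y a)
      (fderiv ℝ (chartChange I p x₀) y b) := by
  rw [fderiv_chartChange hy hx, fderiv_chartChange hy hx, chartChange, h.apply_chartDiff hx,
    ← h.eq p y hy, chartForm_eq]

/-- `lieDerivative` is read in the chart centred at `p`, whose differential at `p` is the identity.
Agreement near `p` with some differentiable `τ` suffices, which also covers the induced metric of a
normal that is smooth only around the surface. -/
lemma lieAt_eq_coordLie {p : X} {τ : E → E →L[ℝ] E →L[ℝ] ℝ}
    (h : ∀ᶠ y in 𝓝 (extChartAt I p p), ∀ a b, chartForm T p y a b = τ y a b)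
    (hτ : DifferentiableAt ℝ τ (extChartAt I p p)) (V : ∀ p : X, TangentSpace I p) (u v : E) :
    lieAt V T p u v = coordLie (chartVector V p) τ (extChartAt I p p) u v := by
  have e : (fun y => chartForm T p y u v) =ᶠ[𝓝 (extChartAt I p p)] fun y => τ y u v :=
    h.mono fun y hy => hy u v
  have h1 : lieAt V T p u v = fderiv ℝ (fun y => chartForm T p y u v) (extChartAt I p p)
      (chartVector V p (extChartAt I p p))
      + formAt T p (fderiv ℝ (chartVector V p) (extChartAt I p p) u) v
      + formAt T p u (fderiv ℝ (chartVector V p) (extChartAt I p p) v) := rfl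
  rw [h1, coordLie, e.fderiv_eq, fderiv_apply₂ hτ, ← h.self_of_nhds, ← h.self_of_nhds,
    chartForm_self, chartForm_self]

lemma IsSmoothForm.lieAt_eq (h : IsSmoothForm T t) (V : ∀ p : X, TangentSpace I p) (p : X)
    (u v : E) : lieAt V T p u v = coordLie (chartVector V p) (t p) (extChartAt I p p) u v :=
  lieAt_eq_coordLie ((eventually_target (mem_extChartAt_target (I := I) p)).mono
    fun y hy => h.eq p y hy) (h.differentiableAt (mem_extChartAt_target p)) V u v

/-- The Lie derivative may be computed in any chart. -/
lemma IsSmoothForm.lieAt_eq_chart (h : IsSmoothForm T t)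
    {V : ∀ p : X, TangentSpace I p} {p x₀ : X} (hp : p ∈ (extChartAt I x₀).source)
    (hV : DifferentiableAt ℝ (chartVector V p) (extChartAt I p p))
    (hV₀ : DifferentiableAt ℝ (chartVector V x₀) (extChartAt I x₀ p))
    (u v : E) :
    lieAt V T p u v = coordLie (chartVector V x₀) (t x₀) (extChartAt I x₀ p)
      (chartDiff I x₀ p u) (chartDiff I x₀ p v) := by
  have hy := mem_extChartAt_target (I := I) p
  have hinv := extChartAt_to_inv (I := I) p
  have hx : (extChartAt I p).symm (extChartAt I p p) ∈ (extChartAt I x₀).source := by rwa [hinv]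
  have hψ : chartChange I p x₀ (extChartAt I p p) = extChartAt I x₀ p := by rw [chartChange, hinv]
  -- At the centre of its own chart the inverse chart has the identity as differential, so the
  -- transition map differentiates to the chart at `x₀`.
  have hd : ∀ a, fderiv ℝ (chartChange I p x₀) (extChartAt I p p) a = chartDiff I x₀ p a := by
    intro a
    rw [fderiv_chartChange hy hx]
    have h1 := chartSymmDiff_chartDiff (mem_extChartAt_source (I := I) p) a
    rw [chartDiff_self] at h1
    rw [h1, hinv]
  rw [h.lieAt_eq, ← hd, ← hd, ← hψ]
  refine coordLie_pullback (h.differentiableAt hy) ?_ ((contDiffAt_chartChange hy hx).of_le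
    two_le_infty) ?_ hV ?_ ?_ u v
  · rw [hψ]; exact h.differentiableAt ((extChartAt I x₀).map_source hp)
  · exact (eventually_target_source hy hx).mono fun z hz => h.pullback hz.1 hz.2
  · rwa [hψ]
  · refine (eventually_target_source hy hx).mono fun z hz => ?_
    rw [fderiv_chartChange hz.1 hz.2, chartChange, chartVector_apply V hz.2]
    congr 1
    have h1 := chartVector_apply V ((extChartAt I p).map_target hz.1)
    rw [(extChartAt I p).right_inv hz.1] at h1
    rw [h1]
    have h2 := chartSymmDiff_chartDiff ((extChartAt I p).map_target hz.1)
      (vecAt V ((extChartAt I p).symm z))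
    rwa [(extChartAt I p).right_inv hz.1] at h2

end SmoothForm

end Charts

/-! ### Second derivative of a curve under a change of coordinates. -/

section Curves

variable {E : Type*} [NormedAddCommGroup E] [NormedSpace ℝ E]

lemma deriv_comp_twice {ψ : E → E} {c : ℝ → E} {s : ℝ} (hψ : ContDiffAt ℝ 2 ψ (c s))
    (hc : ContDiffAt ℝ 2 c s) :
    deriv (fun τ => ψ (c τ)) s = fderiv ℝ ψ (c s) (deriv c s) ∧
    deriv (deriv (fun τ => ψ (c τ))) s = fderiv ℝ (fderiv ℝ ψ) (c s) (deriv c s) (deriv c s)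
      + fderiv ℝ ψ (c s) (deriv (deriv c) s) := by
  have h1 : ∀ᶠ τ in 𝓝 s, deriv (fun τ => ψ (c τ)) τ = fderiv ℝ ψ (c τ) (deriv c τ) := by
    filter_upwards [hc.continuousAt.eventually (hψ.eventually (by decide)),
      hc.eventually (by decide)] with τ h1 h2
    exact ((h1.differentiableAt (by norm_num)).hasFDerivAt.comp_hasDerivAt τ
      (h2.differentiableAt (by norm_num)).hasDerivAt).deriv
  refine ⟨h1.self_of_nhds, ?_⟩
  rw [Filter.EventuallyEq.deriv_eq h1]
  have d2 : HasFDerivAt (fderiv ℝ ψ) (fderiv ℝ (fderiv ℝ ψ) (c s)) (c s) :=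
    ((hψ.fderiv_right (m := 1) (by norm_num)).differentiableAt (by norm_num)).hasFDerivAt
  have d3 : HasDerivAt (deriv c) (deriv (deriv c) s) s :=
    ((((hc.fderiv_right (m := 1) (by norm_num)).clm_apply contDiffAt_const).congr_of_eventuallyEq
      (Eventually.of_forall fun τ => fderiv_apply_one_eq_deriv.symm)).differentiableAt
      (by norm_num)).hasDerivAt
  exact ((d2.comp_hasDerivAt s (hc.differentiableAt (by norm_num)).hasDerivAt).clm_apply d3).deriv

end Curves

/-! ### Vector fields, geodesics and defining functions in a fixed chart. -/

section Hypersurfaces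

set_option maxSynthPendingDepth 3
set_option linter.unusedSectionVars false

variable {E : Type*} [NormedAddCommGroup E] [NormedSpace ℝ E]
  {H : Type*} [TopologicalSpace H] {I : ModelWithCorners ℝ E H} [I.Boundaryless]
  {X : Type*} [TopologicalSpace X] [ChartedSpace H X] [IsManifold I ∞ X]

/-- The trivialisation of the tangent bundle at `x₀` is the differential of the chart at `x₀`, so
smoothness of a section is smoothness of its components. -/
lemma contDiffAt_chartVector {V : ∀ p : X, TangentSpace I p} {x₀ x : X}
    (hx : x ∈ (extChartAt I x₀).source)
    (hV : haveI := isManifold_one_of_infty (I := I) (X := X)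
      ContMDiffAt I I.tangent ∞ (fun x => (⟨x, V x⟩ : TangentBundle I X)) x) :
    ContDiffAt ℝ ∞ (chartVector V x₀) (extChartAt I x₀ x) := by
  have := isManifold_one_of_infty (I := I) (X := X)
  have hx' : x ∈ (chartAt H x₀).source := by rwa [← extChartAt_source I]
  have h1 : ContMDiffAt I 𝓘(ℝ, E) ∞ (fun z => chartDiff I x₀ z (vecAt V z)) x := by
    have h2 := ((trivializationAt E (TangentSpace I) x₀).contMDiffAt_section_iff (n := ∞) (IB := I)
      (by simpa using hx')).1 hV
    refine h2.congr_of_eventuallyEq ?_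
    filter_upwards [(chartAt H x₀).open_source.mem_nhds hx'] with z hz
    have h3 := TangentBundle.continuousLinearMapAt_trivializationAt (𝕜 := ℝ) (I := I) hz
    have h4 : chartDiff I x₀ z (vecAt V z) =
      (trivializationAt E (TangentSpace I) x₀).continuousLinearMapAt ℝ z (V z) :=
      (congrArg (fun L => L (V z)) h3).symm
    rw [h4, Trivialization.continuousLinearMapAt_apply,
      Trivialization.coe_linearMapAt_of_mem _ (by simpa using hz)]
  rw [← contMDiffAt_iff_contDiffAt]
  have hy := (extChartAt I x₀).map_source hx
  refine ContMDiffAt.comp (I' := I) (g := fun z => chartDiff I x₀ z (vecAt V z))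
    (f := (extChartAt I x₀).symm) _ ?_ ((contMDiffOn_extChartAt_symm x₀).contMDiffAt
      ((isOpen_extChartAt_target x₀).mem_nhds hy))
  rwa [(extChartAt I x₀).left_inv hx]


section Geodesics

variable {T : ∀ p : X, TangentSpace I p → TangentSpace I p → ℝ} {t : X → E → E →L[ℝ] E →L[ℝ] ℝ}

/-- The components of a curve in the preferred chart at `x₀`. -/
def chartCurve (I : ModelWithCorners ℝ E H) (γ : ℝ → X) (x₀ : X) (τ : ℝ) : E :=
  extChartAt I x₀ (γ τ)

/-- The velocity of a curve, as a vector of the model space. -/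
def velAt (I : ModelWithCorners ℝ E H) (γ : ℝ → X) (s : ℝ) : E := velocity I γ s

lemma contDiffAt_chartCurve {γ : ℝ → X} {s : ℝ} {x₀ : X} {n : WithTop ℕ∞} (hn : n ≤ ∞)
    (hγ : ContMDiffAt 𝓘(ℝ, ℝ) I n γ s) (hs : γ s ∈ (extChartAt I x₀).source) :
    ContDiffAt ℝ n (chartCurve I γ x₀) s := by
  rw [← contMDiffAt_iff_contDiffAt]
  exact ContMDiffAt.comp (I' := I) s
    ((contMDiffAt_extChartAt' (n := ∞) (by rwa [← extChartAt_source I])).of_le hn) hγ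

lemma deriv_chartCurve {γ : ℝ → X} {s : ℝ} {x₀ : X}
    (hγ : ContMDiffAt 𝓘(ℝ, ℝ) I 1 γ s) (hs : γ s ∈ (extChartAt I x₀).source) :
    deriv (chartCurve I γ x₀) s = chartDiff I x₀ (γ s) (velAt I γ s) := by
  have h1 : MDifferentiableAt I 𝓘(ℝ, E) (extChartAt I x₀) (γ s) :=
    (contMDiffAt_extChartAt' (n := ∞) (by rwa [← extChartAt_source I])).mdifferentiableAt (by simp)
  have h3 := mfderiv_comp s h1 (hγ.mdifferentiableAt (by simp))
  rw [← fderiv_apply_one_eq_deriv, ← mfderiv_eq_fderiv]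
  exact congrArg (fun L => L (1 : ℝ)) h3

lemma IsSmoothForm.symm (h : IsSmoothForm T t) (hsymm : ∀ x a b, formAt T x a b = formAt T x b a)
    {x₀ : X} {y : E} (hy : y ∈ (extChartAt I x₀).target) (a b : E) : t x₀ y a b = t x₀ y b a := by
  rw [← h.eq x₀ y hy, ← h.eq x₀ y hy, chartForm_eq, chartForm_eq, hsymm]

lemma isGeodesicAt_iff_self (h : IsSmoothForm T t) (γ : ℝ → X) (s : ℝ) :
    IsGeodesicAt (I := I) T γ s ↔ ContMDiffAt 𝓘(ℝ, ℝ) I 2 γ s ∧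
      ∀ w, coordGeo (t (γ s)) (extChartAt I (γ s) (γ s)) (deriv (chartCurve I γ (γ s)) s)
        (deriv (deriv (chartCurve I γ (γ s))) s) w = 0 := by
  have hy := mem_extChartAt_target (I := I) (γ s)
  have e : ∀ a b, (fun y => chartForm T (γ s) y a b)
      =ᶠ[𝓝 (extChartAt I (γ s) (γ s))] fun y => t (γ s) y a b :=
    fun a b => (eventually_target hy).mono fun y hy => h.eq (γ s) y hy a b
  have e' : ∀ a b d, fderiv ℝ (fun y => chartForm T (γ s) y a b) (extChartAt I (γ s) (γ s)) d
      = fderiv ℝ (t (γ s)) (extChartAt I (γ s) (γ s)) d a b := fun a b d => by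
    rw [(e a b).fderiv_eq, fderiv_apply₂ (h.differentiableAt hy)]
  refine and_congr_right fun _ => forall_congr' fun w => ?_
  change chartForm T (γ s) (extChartAt I (γ s) (γ s)) (deriv (deriv (chartCurve I γ (γ s))) s) w
    + fderiv ℝ (fun y => chartForm T (γ s) y (deriv (chartCurve I γ (γ s)) s) w)
      (extChartAt I (γ s) (γ s)) (deriv (chartCurve I γ (γ s)) s)
    - (1 / 2) * fderiv ℝ (fun y => chartForm T (γ s) y (deriv (chartCurve I γ (γ s)) s)
      (deriv (chartCurve I γ (γ s)) s)) (extChartAt I (γ s) (γ s)) w = 0 ↔ _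
  rw [e', e', h.eq (γ s) _ hy, coordGeo]

/-- The geodesic equation may be checked in any chart. -/
lemma isGeodesicAt_iff_chart (h : IsSmoothForm T t)
    (hsymm : ∀ x a b, formAt T x a b = formAt T x b a) {γ : ℝ → X} {s : ℝ} {x₀ : X}
    (hs : γ s ∈ (extChartAt I x₀).source) :
    IsGeodesicAt (I := I) T γ s ↔ ContMDiffAt 𝓘(ℝ, ℝ) I 2 γ s ∧
      ∀ w, coordGeo (t x₀) (chartCurve I γ x₀ s) (deriv (chartCurve I γ x₀) s)
        (deriv (deriv (chartCurve I γ x₀)) s) w = 0 := by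
  -- By definition the equation at `s` is read in the chart centred at `γ s`, which moves with `s`.
  -- The ODE arguments need one fixed chart, and `coordGeo_pullback` along the transition map
  -- provides it.
  rw [isGeodesicAt_iff_self h]
  refine and_congr_right fun hγ => ?_
  have hy := mem_extChartAt_target (I := I) (γ s)
  have hinv := extChartAt_to_inv (I := I) (γ s)
  have hx : (extChartAt I (γ s)).symm (extChartAt I (γ s) (γ s)) ∈ (extChartAt I x₀).source := by
    rwa [hinv]
  have hψC : ContDiffAt ℝ 2 (chartChange I (γ s) x₀) (chartCurve I γ (γ s) s) :=
    (contDiffAt_chartChange hy hx).of_le two_le_infty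
  have hψ : chartChange I (γ s) x₀ (extChartAt I (γ s) (γ s)) = chartCurve I γ x₀ s := by
    rw [chartChange, hinv, chartCurve]
  have hcc := contDiffAt_chartCurve two_le_infty hγ (mem_extChartAt_source (I := I) (γ s))
  have hc : chartCurve I γ x₀
      =ᶠ[𝓝 s] fun τ => chartChange I (γ s) x₀ (chartCurve I γ (γ s) τ) := by
    filter_upwards [hγ.continuousAt.eventually (extChartAt_source_mem_nhds (I := I) (γ s))]
      with τ hτ
    rw [chartChange, chartCurve, chartCurve, (extChartAt I (γ s)).left_inv hτ]
  obtain ⟨d1, d2⟩ := deriv_comp_twice hψC hcc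
  rw [hc.deriv_eq, hc.deriv.deriv_eq, d1, d2, ← hψ]
  have key := fun w => coordGeo_pullback (h.differentiableAt hy)
    (h.differentiableAt (x₀ := x₀) (y := chartChange I (γ s) x₀ (extChartAt I (γ s) (γ s)))
      (by rw [hψ]; exact (extChartAt I x₀).map_source hs)) hψC
    ((eventually_target_source hy hx).mono fun z hz => h.pullback hz.1 hz.2)
    (fun a b => h.symm hsymm (by rw [hψ]; exact (extChartAt I x₀).map_source hs) a b)
    (deriv (chartCurve I γ (γ s)) s) (deriv (deriv (chartCurve I γ (γ s))) s) w
  constructor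
  · intro H w
    obtain ⟨w', rfl⟩ := chartDiff_surjective hs w
    have h1 : chartDiff I x₀ (γ s) w' = fderiv ℝ (chartChange I (γ s) x₀)
        (extChartAt I (γ s) (γ s)) w' := by
      rw [fderiv_chartChange hy hx]
      have h1 := chartSymmDiff_chartDiff (mem_extChartAt_source (I := I) (γ s)) w'
      rw [chartDiff_self] at h1
      rw [h1, hinv]
    rw [h1]
    exact (key w').symm.trans (H w')
  · intro H w
    exact (key w).trans (H _)

end Geodesics

section DefiningFunctions

variable {D : Separation X}

/-- The components of a function in the preferred chart at `x₀`. -/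
def chartFun (I : ModelWithCorners ℝ E H) (f : X → ℝ) (x₀ : X) (y : E) : ℝ :=
  f ((extChartAt I x₀).symm y)

/-- The directional derivative, on vectors of the model space. -/
def dirAt (I : ModelWithCorners ℝ E H) (f : X → ℝ) (x : X) : E →L[ℝ] ℝ := mfderiv I 𝓘(ℝ, ℝ) f x

lemma contDiffAt_chartFun {f : X → ℝ} {x₀ x : X} (hx : x ∈ (extChartAt I x₀).source)
    (hf : ContMDiffAt I 𝓘(ℝ, ℝ) ∞ f x) : ContDiffAt ℝ ∞ (chartFun I f x₀) (extChartAt I x₀ x) := by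
  rw [← contMDiffAt_iff_contDiffAt]
  refine ContMDiffAt.comp (I' := I) (g := f) (f := (extChartAt I x₀).symm) _ ?_
    ((contMDiffOn_extChartAt_symm x₀).contMDiffAt ((isOpen_extChartAt_target x₀).mem_nhds
      ((extChartAt I x₀).map_source hx)))
  rwa [(extChartAt I x₀).left_inv hx]

lemma fderiv_chartFun {f : X → ℝ} {x₀ x : X} (hx : x ∈ (extChartAt I x₀).source)
    (hf : MDifferentiableAt I 𝓘(ℝ, ℝ) f x) (u : E) :
    fderiv ℝ (chartFun I f x₀) (extChartAt I x₀ x) (chartDiff I x₀ x u) = dirAt I f x u := by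
  have hy := (extChartAt I x₀).map_source hx
  have h1 : MDifferentiableAt 𝓘(ℝ, E) I (extChartAt I x₀).symm (extChartAt I x₀ x) :=
    ((contMDiffOn_extChartAt_symm (n := ∞) x₀).contMDiffAt
      ((isOpen_extChartAt_target x₀).mem_nhds hy)).mdifferentiableAt (by simp)
  have h2 : MDifferentiableAt I 𝓘(ℝ, ℝ) f ((extChartAt I x₀).symm (extChartAt I x₀ x)) := by
    rwa [(extChartAt I x₀).left_inv hx]
  have h3 : fderiv ℝ (chartFun I f x₀) (extChartAt I x₀ x) (chartDiff I x₀ x u)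
      = dirAt I f ((extChartAt I x₀).symm (extChartAt I x₀ x))
        (chartSymmDiff I x₀ (extChartAt I x₀ x) (chartDiff I x₀ x u)) := by
    have h3 := mfderiv_comp (extChartAt I x₀ x) h2 h1
    rw [← mfderiv_eq_fderiv]
    exact congrArg (fun L => L (chartDiff I x₀ x u)) h3
  rw [h3, chartSymmDiff_chartDiff hx, (extChartAt I x₀).left_inv hx]

lemma Separation.IsDefiningAt.contMDiffAt {f : X → ℝ} {p : X} (h : D.IsDefiningAt I p f) :
    ContMDiffAt I 𝓘(ℝ, ℝ) ∞ f p := by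
  obtain ⟨-, U, hU, hp, hf, -⟩ := h
  exact hf.contMDiffAt (hU.mem_nhds hp)

lemma Separation.IsDefiningAt.eventually {f : X → ℝ} {p : X} (h : D.IsDefiningAt I p f) :
    ∀ᶠ x in 𝓝 p, ContMDiffAt I 𝓘(ℝ, ℝ) ∞ f x ∧
      (x ∈ D.inside ↔ f x < 0) ∧ (x ∈ D.surface ↔ f x = 0) ∧ (x ∈ D.outside ↔ 0 < f x) := by
  obtain ⟨-, U, hU, hp, hf, hfU⟩ := h
  filter_upwards [hU.mem_nhds hp] with x hx
  exact ⟨hf.contMDiffAt (hU.mem_nhds hx), hfU x hx⟩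

lemma Separation.IsDefiningAt.fderiv_ne_zero {f : X → ℝ} {p x₀ : X} (h : D.IsDefiningAt I p f)
    (hp : p ∈ (extChartAt I x₀).source) :
    fderiv ℝ (chartFun I f x₀) (extChartAt I x₀ p) ≠ 0 := by
  intro h0
  refine h.1 ?_
  ext u
  have h1 := fderiv_chartFun hp (h.contMDiffAt.mdifferentiableAt (by simp)) u
  rw [h0] at h1
  exact h1.symm

/-- A nonvanishing differential is an open condition, and the sign conditions already hold on an
open set. -/
lemma Separation.IsDefiningAt.eventually_isDefiningAt {f : X → ℝ} {p : X}
    (h : D.IsDefiningAt I p f) : ∀ᶠ x in 𝓝 p, D.IsDefiningAt I x f := by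
  have hp := mem_extChartAt_source (I := I) p
  have h1 : ContinuousAt (fun x => fderiv ℝ (chartFun I f p) (extChartAt I p x)) p :=
    ContinuousAt.comp (g := fderiv ℝ (chartFun I f p))
      (((contDiffAt_chartFun hp h.contMDiffAt).fderiv_right (m := 1) two_le_infty).continuousAt)
      (continuousAt_extChartAt p)
  have h2 := h1.eventually_ne (h.fderiv_ne_zero hp)
  obtain ⟨-, U, hU, hpU, hf, hfU⟩ := h
  filter_upwards [h2, hU.mem_nhds hpU, extChartAt_source_mem_nhds (I := I) p] with x hx hxU hxs
  refine ⟨fun h0 => hx ?_, U, hU, hxU, hf, hfU⟩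
  ext u
  obtain ⟨u', rfl⟩ := chartDiff_surjective hxs u
  rw [fderiv_chartFun hxs ((hf.contMDiffAt (hU.mem_nhds hxU)).mdifferentiableAt (by simp))]
  exact congrArg (fun L => L u') h0

/-- Two defining functions have the same zero set near `p`, so each has vanishing derivative in the
directions tangent to the level set of the other. One function thus decides tangency. -/
lemma isTangent_iff [CompleteSpace E] {f : X → ℝ} {p : X} (h : D.IsDefiningAt I p f)
    (hp : p ∈ D.surface) (u : E) : D.IsTangent (I := I) p u ↔ dirAt I f p u = 0 := by
  refine ⟨fun H => H f h, fun H f' h' => ?_⟩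
  change dirAt I f' p u = 0
  have hps := mem_extChartAt_source (I := I) p
  rw [← fderiv_chartFun hps (h'.contMDiffAt.mdifferentiableAt (by simp))]
  rw [← fderiv_chartFun hps (h.contMDiffAt.mdifferentiableAt (by simp))] at H
  have hc : Tendsto (extChartAt I p).symm (𝓝 (extChartAt I p p)) (𝓝 p) := by
    have := continuousAt_extChartAt_symm (I := I) p
    rwa [ContinuousAt, extChartAt_to_inv] at this
  refine fderiv_eq_zero_of_eqOn_levelSet
    ((contDiffAt_chartFun hps h.contMDiffAt).of_le one_le_infty)
    ((contDiffAt_chartFun hps h'.contMDiffAt).of_le one_le_infty) (h.fderiv_ne_zero hps) ?_ ?_ H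
  · rw [chartFun, extChartAt_to_inv]
    exact h.eventually.self_of_nhds.2.2.1.1 hp
  · filter_upwards [hc.eventually h.eventually, hc.eventually h'.eventually] with z h1 h2 h3
    exact h2.2.2.1.1 (h1.2.2.1.2 h3)

end DefiningFunctions

end Hypersurfaces

/-! ### Extrinsic curvature against the behaviour of null geodesics on a manifold. -/

section LightRays

set_option maxSynthPendingDepth 3
set_option linter.unusedSectionVars false

variable {E : Type*} [NormedAddCommGroup E] [NormedSpace ℝ E] [FiniteDimensional ℝ E]
  {H : Type*} [TopologicalSpace H] {I : ModelWithCorners ℝ E H} [I.Boundaryless]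
  {X : Type*} [TopologicalSpace X] [ChartedSpace H X] [IsManifold I ∞ X]
  {g : ∀ p : X, TangentSpace I p → TangentSpace I p → ℝ} {t : X → E → E →L[ℝ] E →L[ℝ] ℝ}
  {D : Separation X} {R : ∀ p : X, TangentSpace I p}

/-- An injective linear map from `E` to its dual is bijective by equality of dimensions, and
continuity of the inverse is automatic. -/
lemma isInvertible_of_nondegenerate {L : E →L[ℝ] E →L[ℝ] ℝ}
    (h : ∀ a, (∀ b, L a b = 0) → a = 0) : L.IsInvertible := by
  have hinj : Function.Injective (L : E →ₗ[ℝ] E →L[ℝ] ℝ) := by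
    rw [← LinearMap.ker_eq_bot, LinearMap.ker_eq_bot']
    intro a ha
    exact h a fun b => by
      have : L a = 0 := ha
      rw [this]; rfl
  have hdim : Module.finrank ℝ E = Module.finrank ℝ (E →L[ℝ] ℝ) := by
    rw [← (LinearMap.toContinuousLinearMap (𝕜 := ℝ) (E := E) (F' := ℝ)).finrank_eq]
    exact (Subspace.dual_finrank_eq (K := ℝ) (V := E)).symm
  refine ⟨(LinearMap.linearEquivOfInjective (L : E →ₗ[ℝ] E →L[ℝ] ℝ) hinj
    hdim).toContinuousLinearEquiv, ?_⟩
  ext a b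
  rfl

lemma IsSmoothForm.isInvertible (h : IsSmoothForm g t)
    (hnd : ∀ x a, (∀ b, formAt g x a b = 0) → a = 0) {x₀ : X} {y : E}
    (hy : y ∈ (extChartAt I x₀).target) : (t x₀ y).IsInvertible := by
  refine isInvertible_of_nondegenerate fun a ha => ?_
  have hx := (extChartAt I x₀).map_target hy
  have h1 : chartSymmDiff I x₀ y a = 0 := by
    refine hnd ((extChartAt I x₀).symm y) _ fun b => ?_
    have h2 := ha (chartDiff I x₀ ((extChartAt I x₀).symm y) b)
    rw [← h.eq x₀ y hy, chartForm_eq] at h2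
    have h3 := chartSymmDiff_chartDiff hx b
    rw [(extChartAt I x₀).right_inv hy] at h3
    rwa [h3] at h2
  have h4 := chartDiff_chartSymmDiff hy a
  rw [h1, map_zero] at h4
  exact h4.symm

/-- The outward unit normal has smooth components in a chart. -/
lemma contDiffAt_chartVector_normal (hR : haveI := isManifold_one_of_infty (I := I) (X := X)
      IsOutwardUnitNormal g D R) {x x₀ : X} (hx : x ∈ D.surface)
    (hxs : x ∈ (extChartAt I x₀).source) :
    ContDiffAt ℝ ∞ (chartVector R x₀) (extChartAt I x₀ x) := by
  have := isManifold_one_of_infty (I := I) (X := X)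
  exact contDiffAt_chartVector hxs (hR.smooth x hx)

lemma coordUnitNormal_chart (h : IsSmoothForm g t)
    (hR : haveI := isManifold_one_of_infty (I := I) (X := X)
      IsOutwardUnitNormal g D R) {f : X → ℝ} {x x₀ : X} (hf : D.IsDefiningAt I x f)
    (hx : x ∈ D.surface) (hxs : x ∈ (extChartAt I x₀).source) :
    CoordUnitNormal (t x₀) (chartFun I f x₀) (chartVector R x₀) (extChartAt I x₀ x) := by
  have := isManifold_one_of_infty (I := I) (X := X)
  have hd := fun u => fderiv_chartFun hxs (hf.contMDiffAt.mdifferentiableAt (by simp)) u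
  constructor
  · rw [chartVector_apply R hxs, h.apply_chartDiff hxs]
    exact hR.unit x hx
  · rw [chartVector_apply R hxs, hd]
    exact hR.outward x hx f hf
  · intro a ha
    obtain ⟨u, rfl⟩ := chartDiff_surjective hxs a
    rw [hd] at ha
    rw [chartVector_apply R hxs, h.apply_chartDiff hxs]
    exact hR.normal x hx u ((isTangent_iff hf hx u).2 ha)

lemma eventually_coordUnitNormal (h : IsSmoothForm g t)
    (hR : haveI := isManifold_one_of_infty (I := I) (X := X)
      IsOutwardUnitNormal g D R) {f : X → ℝ} {x x₀ : X} (hf : D.IsDefiningAt I x f)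
    (hxs : x ∈ (extChartAt I x₀).source) :
    ∀ᶠ z in 𝓝 (extChartAt I x₀ x), chartFun I f x₀ z = 0 →
      CoordUnitNormal (t x₀) (chartFun I f x₀) (chartVector R x₀) z := by
  have hy := (extChartAt I x₀).map_source hxs
  have hc : Tendsto (extChartAt I x₀).symm (𝓝 (extChartAt I x₀ x)) (𝓝 x) := by
    have := continuousAt_extChartAt_symm'' (I := I) hy
    rwa [ContinuousAt, (extChartAt I x₀).left_inv hxs] at this
  filter_upwards [hc.eventually hf.eventually_isDefiningAt, hc.eventually hf.eventually,
    eventually_target hy] with z h1 h2 h3 h4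
  have h5 := coordUnitNormal_chart h hR h1 (h2.2.2.1.2 h4) ((extChartAt I x₀).map_target h3)
  rwa [(extChartAt I x₀).right_inv h3] at h5

/-- The extrinsic curvature, on vectors of the model space. -/
def extCurvAt (g : ∀ p : X, TangentSpace I p → TangentSpace I p → ℝ)
    (R : ∀ p : X, TangentSpace I p) (x : X) (a b : E) : ℝ := extrinsicCurvature g R x a b

/-- The extrinsic curvature of a hypersurface in tangent directions, in any chart. -/
lemma extCurvAt_eq_coordLie (h : IsSmoothForm g t)
    (hR : haveI := isManifold_one_of_infty (I := I) (X := X)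
      IsOutwardUnitNormal g D R) {f : X → ℝ} {x x₀ : X} (hf : D.IsDefiningAt I x f)
    (hx : x ∈ D.surface) (hxs : x ∈ (extChartAt I x₀).source) {k : E} (hk : dirAt I f x k = 0) :
    extCurvAt g R x k k = (1 / 2) * coordLie (chartVector R x₀) (t x₀) (extChartAt I x₀ x)
      (chartDiff I x₀ x k) (chartDiff I x₀ x k) := by
  have hxx := mem_extChartAt_source (I := I) x
  have hy := mem_extChartAt_target (I := I) x
  have hRx := contDiffAt_chartVector_normal hR hx hxx
  have htx := h.smooth x _ hy
  have hN := coordUnitNormal_chart h hR hf hx hxx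
  have e1 : extCurvAt g R x k k = (1 / 2) * lieAt R (inducedMetric g R) x k k := rfl
  -- The induced metric is put into components first. Its normal part is then dropped by
  -- `coordLie_coordInduced`, and only the Lie derivative of `g` itself is moved to the chart at
  -- `x₀`.
  have e2 : ∀ᶠ y in 𝓝 (extChartAt I x x), ∀ a b, chartForm (inducedMetric g R) x y a b
      = coordInduced (t x) (chartVector R x) y a b := by
    filter_upwards [eventually_target hy] with y hy a b
    have hys := (extChartAt I x).map_target hy
    have e3 : chartForm (inducedMetric g R) x y a b = chartForm g x y a b
      - formAt g ((extChartAt I x).symm y) (vecAt R ((extChartAt I x).symm y))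
          (chartSymmDiff I x y a)
        * formAt g ((extChartAt I x).symm y) (vecAt R ((extChartAt I x).symm y))
          (chartSymmDiff I x y b) := rfl
    have e4 : chartSymmDiff I x y (chartVector R x y) = vecAt R ((extChartAt I x).symm y) := by
      have h1 := chartSymmDiff_chartDiff hys (vecAt R ((extChartAt I x).symm y))
      rwa [(extChartAt I x).right_inv hy] at h1
    rw [e3, coordInduced_apply, ← h.eq x y hy, ← h.eq x y hy, ← h.eq x y hy, chartForm_eq g,
      chartForm_eq g, chartForm_eq g, e4]
  rw [e1, lieAt_eq_coordLie e2 ((contDiffAt_coordInduced htx hRx).differentiableAt (by simp)),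
    coordLie_coordInduced (htx.of_le one_le_infty) (hRx.of_le one_le_infty), ← h.lieAt_eq,
    h.lieAt_eq_chart hxs (hRx.differentiableAt (by simp))
      ((contDiffAt_chartVector_normal hR hx hxs).differentiableAt (by simp))]
  refine hN.normal k ?_
  have := fderiv_chartFun hxx (hf.contMDiffAt.mdifferentiableAt (by simp)) k
  rwa [hk, chartDiff_self] at this

/-- The extrinsic curvature is, up to a positive factor, the Hessian of a defining function. -/
lemma extCurvAt_eq_coordHess (h : IsSmoothForm g t)
    (hsymm : ∀ x a b, formAt g x a b = formAt g x b a)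
    (hnd : ∀ x a, (∀ b, formAt g x a b = 0) → a = 0)
    (hR : haveI := isManifold_one_of_infty (I := I) (X := X)
      IsOutwardUnitNormal g D R) {f : X → ℝ} {x x₀ : X} (hf : D.IsDefiningAt I x f)
    (hx : x ∈ D.surface) (hxs : x ∈ (extChartAt I x₀).source) {k : E} (hk : dirAt I f x k = 0) :
    ∃ c : ℝ, 0 < c ∧ extCurvAt g R x k k = c * coordHess (chartFun I f x₀) (extChartAt I x₀ x)
      (chartDiff I x₀ x k) (coordAcc (t x₀) (extChartAt I x₀ x) (chartDiff I x₀ x k)) := by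
  have hy := (extChartAt I x₀).map_source hxs
  refine ⟨_, inv_pos.2 (coordUnitNormal_chart h hR hf hx hxs).pos, ?_⟩
  rw [extCurvAt_eq_coordLie h hR hf hx hxs hk]
  refine half_coordLie_eq ((h.smooth x₀ _ hy).of_le one_le_infty)
    ((contDiffAt_chartFun hxs hf.contMDiffAt).of_le two_le_infty)
    ((contDiffAt_chartVector_normal hR hx hxs).of_le one_le_infty)
    ((eventually_target hy).mono fun z hz => h.symm hsymm hz) ?_
    (eventually_coordUnitNormal h hR hf hxs) ?_
    (coordGeo_coordAcc (h.isInvertible hnd hy) _)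
  · rw [chartFun, (extChartAt I x₀).left_inv hxs]
    exact hf.eventually.self_of_nhds.2.2.1.1 hx
  · rw [fderiv_chartFun hxs (hf.contMDiffAt.mdifferentiableAt (by simp)), hk]

/-- If the extrinsic curvature is nonpositive on tangent null vectors, null geodesics which start
tangent to the surface do not leave to the outside at once. -/
theorem eventually_mem_of_extrinsicCurvature_nonpos (h : IsSmoothForm g t)
    (hsymm : ∀ x a b, formAt g x a b = formAt g x b a)
    (hnd : ∀ x a, (∀ b, formAt g x a b = 0) → a = 0)
    (hD : D.IsSmooth I)
    (hR : haveI := isManifold_one_of_infty (I := I) (X := X)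
      IsOutwardUnitNormal g D R)
    (hcurv : ∀ x ∈ D.surface, ∀ k : E, D.IsTangent (I := I) x k → formAt g x k k = 0 →
      extCurvAt g R x k k ≤ 0)
    {γ : ℝ → X} (hγ : ∀ᶠ s in 𝓝 (0 : ℝ), IsGeodesicAt (I := I) g γ s) (h0 : γ 0 ∈ D.surface)
    (htan : D.IsTangent (I := I) (γ 0) (velAt I γ 0 : E))
    (hnull : formAt g (γ 0) (velAt I γ 0) (velAt I γ 0) = 0) (hne : velAt I γ 0 ≠ 0) :
    ∀ᶠ s in 𝓝[>] (0 : ℝ), γ s ∈ D.surface ∪ D.inside := by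
  obtain ⟨f, hf⟩ := hD.exists_defining _ h0
  set p := γ 0 with hp
  have hps := mem_extChartAt_source (I := I) p
  have hy := mem_extChartAt_target (I := I) p
  have hc2 : ContMDiffAt 𝓘(ℝ, ℝ) I 2 γ 0 := hγ.self_of_nhds.1
  have hsource : ∀ᶠ s in 𝓝 (0 : ℝ), γ s ∈ (extChartAt I p).source :=
    hc2.continuousAt.eventually (extChartAt_source_mem_nhds (I := I) p)
  have hv : deriv (chartCurve I γ p) 0 = velAt I γ 0 := by
    rw [deriv_chartCurve (hc2.of_le (by norm_num)) hps, ← hp, chartDiff_self]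
  have hc0 : chartCurve I γ p 0 = extChartAt I p p := rfl
  have hsymmc : Tendsto (extChartAt I p).symm (𝓝 (extChartAt I p p)) (𝓝 p) := by
    have := continuousAt_extChartAt_symm (I := I) p
    rwa [ContinuousAt, extChartAt_to_inv] at this
  have key := eventually_nonpos_of_coordHess_nonpos (t := t p) (f := chartFun I f p)
    (ρ := chartVector R p) (c := chartCurve I γ p) (v := deriv (chartCurve I γ p))
    (a := deriv (deriv (chartCurve I γ p)))
    (by
      rw [hc0]
      exact (eventually_target hy).mono fun z hz =>
        ⟨(h.smooth p z hz).of_le three_le_infty, h.isInvertible hnd hz, h.symm hsymm hz⟩)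
    ((contDiffAt_chartFun hps hf.contMDiffAt).of_le three_le_infty)
    (by
      rw [hc0, chartFun, extChartAt_to_inv]
      exact hf.eventually.self_of_nhds.2.2.1.1 h0)
    (coordUnitNormal_chart h hR hf h0 hps) (by rwa [hv])
    (by
      rw [hc0, hv, ← chartDiff_self (I := I) p (velAt I γ 0),
        fderiv_chartFun hps (hf.contMDiffAt.mdifferentiableAt (by simp))]
      exact (isTangent_iff hf h0 _).1 htan)
    (by
      rw [hc0, hv, h.apply_self]
      exact hnull)
    (by
      rw [hc0]
      filter_upwards [hsymmc.eventually hf.eventually_isDefiningAt,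
        hsymmc.eventually hf.eventually, eventually_target hy] with z h1 h2 h3 h4 k hk hkk
      have hxs := (extChartAt I p).map_target h3
      have hx := h2.2.2.1.2 h4
      obtain ⟨k, rfl⟩ := chartDiff_surjective hxs k
      have hz := (extChartAt I p).right_inv h3
      have e1 := fderiv_chartFun hxs (h1.contMDiffAt.mdifferentiableAt (by simp)) k
      have e2 := h.apply_chartDiff hxs k k
      rw [hz] at e1 e2
      rw [e1] at hk
      rw [e2] at hkk
      obtain ⟨c, hc, hcc⟩ := extCurvAt_eq_coordHess h hsymm hnd hR h1 hx hxs hk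
      have := hcurv _ hx k ((isTangent_iff h1 hx k).2 hk) hkk
      rw [hcc, hz] at this
      exact nonpos_of_mul_nonpos_right this hc)
    (by
      filter_upwards [hγ, hsource] with s h1 h2
      have h3 := (isGeodesicAt_iff_chart h hsymm h2).1 h1
      have h4 := contDiffAt_chartCurve two_le_infty h3.1 h2
      refine ⟨(h4.differentiableAt (by norm_num)).hasDerivAt, ?_, h3.2⟩
      exact ((((h4.fderiv_right (m := 1) (by norm_num)).clm_apply
        contDiffAt_const).congr_of_eventuallyEq
        (Eventually.of_forall fun τ => fderiv_apply_one_eq_deriv.symm)).differentiableAt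
        (by norm_num)).hasDerivAt)
  filter_upwards [key, nhdsWithin_le_nhds hsource,
    nhdsWithin_le_nhds (hc2.continuousAt.eventually hf.eventually)] with s h1 h2 h3
  rw [chartCurve, chartFun, (extChartAt I p).left_inv h2] at h1
  rcases h1.lt_or_eq with h4 | h4
  · exact Or.inr (h3.2.1.2 h4)
  · exact Or.inl (h3.2.2.1.2 h4)

/-- Where the extrinsic curvature is positive in a tangent direction, the geodesic in this
direction leaves to the outside at once. -/
theorem exists_geodesic_outside (h : IsSmoothForm g t)
    (hsymm : ∀ x a b, formAt g x a b = formAt g x b a)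
    (hnd : ∀ x a, (∀ b, formAt g x a b = 0) → a = 0)
    (hD : D.IsSmooth I)
    (hR : haveI := isManifold_one_of_infty (I := I) (X := X)
      IsOutwardUnitNormal g D R) {p : X} (hp : p ∈ D.surface) {k : E}
    (htan : D.IsTangent (I := I) p k) (hpos : 0 < extCurvAt g R p k k) :
    ∃ γ : ℝ → X, γ 0 = p ∧ velAt I γ 0 = k ∧ (∀ᶠ s in 𝓝 (0 : ℝ), IsGeodesicAt (I := I) g γ s) ∧
      ∀ᶠ s in 𝓝[>] (0 : ℝ), γ s ∈ D.outside := by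
  obtain ⟨f, hf⟩ := hD.exists_defining _ hp
  have hps := mem_extChartAt_source (I := I) p
  have hy := mem_extChartAt_target (I := I) p
  obtain ⟨c, v, hc0, hv0, hcv⟩ := exists_coord_geodesic (t := t p) (y := extChartAt I p p) k
    ((h.smooth p _ hy).of_le three_le_infty)
    ((eventually_target hy).mono fun z hz => h.isInvertible hnd hz)
  have hcc : ContinuousAt c 0 := hcv.self_of_nhds.1.continuousAt
  have htarget : ∀ᶠ s in 𝓝 (0 : ℝ), c s ∈ (extChartAt I p).target :=
    hcc.eventually (by rw [hc0]; exact eventually_target hy)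
  set γ : ℝ → X := fun s => (extChartAt I p).symm (c s) with hγdef
  have hγ0 : γ 0 = p := by rw [hγdef]; simp only [hc0, extChartAt_to_inv]
  -- Derivatives of the chart curve at `s` depend on its values near `s`, so the properties are
  -- needed on a neighbourhood of each such `s`.
  have hall := (hcv.and htarget).eventually_nhds
  have hγC : ∀ᶠ s in 𝓝 (0 : ℝ), ContMDiffAt 𝓘(ℝ, ℝ) I 2 γ s := by
    filter_upwards [hcv, htarget] with s h1 h2
    exact ContMDiffAt.comp (I' := 𝓘(ℝ, E)) (g := (extChartAt I p).symm) s
      (((contMDiffOn_extChartAt_symm (n := ∞) p).contMDiffAt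
        ((isOpen_extChartAt_target p).mem_nhds h2)).of_le two_le_infty)
      (contMDiffAt_iff_contDiffAt.2 h1.2.2.1)
  have hchart : ∀ᶠ s in 𝓝 (0 : ℝ), chartCurve I γ p =ᶠ[𝓝 s] c ∧ deriv (chartCurve I γ p) s = v s ∧
      deriv (deriv (chartCurve I γ p)) s = coordAcc (t p) (c s) (v s) := by
    filter_upwards [hall] with s hs
    have e1 : chartCurve I γ p =ᶠ[𝓝 s] c := hs.mono fun τ hτ => (extChartAt I p).right_inv hτ.2
    have e2 : deriv (chartCurve I γ p) =ᶠ[𝓝 s] v :=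
      e1.deriv.trans (hs.mono fun τ hτ => hτ.1.1.deriv)
    exact ⟨e1, e2.self_of_nhds, by rw [e2.deriv_eq, hs.self_of_nhds.1.2.1.deriv]⟩
  refine ⟨γ, hγ0, ?_, ?_, ?_⟩
  · have h1 := deriv_chartCurve (hγC.self_of_nhds.of_le (by norm_num)) (x₀ := p)
      (by rw [hγ0]; exact hps)
    rw [hγ0, chartDiff_self, hchart.self_of_nhds.2.1, hv0] at h1
    exact h1.symm
  · filter_upwards [hγC, hchart, hcv, htarget] with s h1 h2 h3 h4
    refine (isGeodesicAt_iff_chart h hsymm ((extChartAt I p).map_target h4)).2 ⟨h1, fun w => ?_⟩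
    rw [h2.2.1, h2.2.2, h2.1.self_of_nhds]
    exact h3.2.2.2 w
  · have hk := (isTangent_iff hf hp k).1 htan
    obtain ⟨b, hb, hbb⟩ := extCurvAt_eq_coordHess h hsymm hnd hR hf hp hps hk
    rw [hbb, chartDiff_self] at hpos
    have hpos' := (mul_pos_iff_of_pos_left hb).1 hpos
    have hfC : ∀ᶠ z in 𝓝 (extChartAt I p p), ContDiffAt ℝ 2 (chartFun I f p) z :=
      ((contDiffAt_chartFun hps hf.contMDiffAt).of_le two_le_infty).eventually (by decide)
    have hd : ∀ᶠ s in 𝓝 (0 : ℝ), HasDerivAt (fun τ => chartFun I f p (c τ))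
        (fderiv ℝ (chartFun I f p) (c s) (v s)) s ∧
        HasDerivAt (fun τ => fderiv ℝ (chartFun I f p) (c τ) (v τ))
          (coordHess (chartFun I f p) (c s) (v s) (coordAcc (t p) (c s) (v s))) s := by
      filter_upwards [hcv, hcc.eventually (by rw [hc0]; exact hfC)] with s h1 h2
      exact hasDerivAt_comp_curve h2 h1.1 h1.2.1
    -- Along the geodesic `f` vanishes to first order at the start, and its second derivative is
    -- positive there.
    have hpos2 := eventually_pos_of_deriv_pos (hd.mono fun s hs => hs.1) hd.self_of_nhds.2
      (by
        rw [hc0, chartFun, extChartAt_to_inv]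
        exact hf.eventually.self_of_nhds.2.2.1.1 hp)
      (by
        rw [hc0, hv0, ← chartDiff_self (I := I) p k,
          fderiv_chartFun hps (hf.contMDiffAt.mdifferentiableAt (by simp)), hk])
      (by rw [hc0, hv0]; exact hpos')
    have hγc : ContinuousAt γ 0 := hγC.self_of_nhds.continuousAt
    filter_upwards [hpos2, nhdsWithin_le_nhds (hγc.eventually
      (by rw [hγ0]; exact hf.eventually))] with s h1 h2
    exact h2.2.2.2.2 h1

end LightRays

/-! ### Components of the slice metric and of the spacetime metric; nondegeneracy. -/

section SpacetimeCharts

set_option maxSynthPendingDepth 3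
set_option linter.unusedSectionVars false

variable {N : Type*} [TopologicalSpace N] [ChartedSpace (EuclideanSpace ℝ (Fin 3)) N]
  [IsManifold (𝓡 3) ∞ N]

lemma contDiffAt_clm₂_of_components {E F : Type*} [NormedAddCommGroup E] [NormedSpace ℝ E]
    [FiniteDimensional ℝ E] [NormedAddCommGroup F] [NormedSpace ℝ F] {n : WithTop ℕ∞}
    {t : F → E →L[ℝ] E →L[ℝ] ℝ} {s : Set F} (hs : IsOpen s)
    (h : ∀ a b, ∀ z ∈ s, ContDiffAt ℝ n (fun z => t z a b) z) {z : F} (hz : z ∈ s) :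
    ContDiffAt ℝ n t z := by
  have : ContDiffOn ℝ n t s := by
    refine contDiffOn_clm_apply.2 fun a => contDiffOn_clm_apply.2 fun b => ?_
    exact fun z hz => (h a b z hz).contDiffWithinAt
  exact this.contDiffAt (hs.mem_nhds hz)

namespace StationaryData

variable (𝓢 : StationaryData N)

/-- The metric of the slice as a bilinear form on the model space. -/
def sliceForm (p : N) :
    EuclideanSpace ℝ (Fin 3) →L[ℝ] EuclideanSpace ℝ (Fin 3) →L[ℝ] ℝ := 𝓢.q.inner p

/-- The components of the metric of the slice in the chart at `x₀`. -/
def sliceComp (x₀ : N) (y : EuclideanSpace ℝ (Fin 3)) :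
    EuclideanSpace ℝ (Fin 3) →L[ℝ] EuclideanSpace ℝ (Fin 3) →L[ℝ] ℝ :=
  (𝓢.sliceForm ((extChartAt (𝓡 3) x₀).symm y)).bilinearComp (chartSymmDiff (𝓡 3) x₀ y)
    (chartSymmDiff (𝓡 3) x₀ y)

/-- In the trivialisation at `x₀` this coordinate field is the constant `a`. It serves to extract
smooth components from the smooth bundle metric. -/
lemma contMDiffAt_coordinate_field {x₀ x : N}
    (hx : x ∈ (extChartAt (𝓡 3) x₀).source)
    (a : EuclideanSpace ℝ (Fin 3)) :
    ContMDiffAt (𝓡 3) (𝓡 3).tangent ∞ (fun z =>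
      (⟨z, chartSymmDiff (𝓡 3) x₀ (extChartAt (𝓡 3) x₀ z) a⟩ : TangentBundle (𝓡 3) N)) x := by
  have hx' : x ∈ (chartAt (EuclideanSpace ℝ (Fin 3)) x₀).source := by
    rwa [← extChartAt_source (𝓡 3)]
  refine ((trivializationAt (EuclideanSpace ℝ (Fin 3)) (TangentSpace (𝓡 3))
    x₀).contMDiffAt_section_iff (n := ∞) (IB := 𝓡 3) (by simpa using hx')).2 ?_
  refine (contMDiffAt_const (c := a)).congr_of_eventuallyEq ?_
  filter_upwards [(chartAt (EuclideanSpace ℝ (Fin 3)) x₀).open_source.mem_nhds hx'] with z hz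
  have hz' : z ∈ (extChartAt (𝓡 3) x₀).source := by rwa [extChartAt_source]
  have h3 := TangentBundle.continuousLinearMapAt_trivializationAt (𝕜 := ℝ) (I := 𝓡 3) hz
  have h5 := chartDiff_chartSymmDiff ((extChartAt (𝓡 3) x₀).map_source hz') a
  rw [(extChartAt (𝓡 3) x₀).left_inv hz'] at h5
  have h4 : chartDiff (𝓡 3) x₀ z (chartSymmDiff (𝓡 3) x₀ (extChartAt (𝓡 3) x₀ z) a) =
    (trivializationAt (EuclideanSpace ℝ (Fin 3)) (TangentSpace (𝓡 3)) x₀).continuousLinearMapAt ℝ z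
      (chartSymmDiff (𝓡 3) x₀ (extChartAt (𝓡 3) x₀ z) a) :=
    (congrArg (fun L : EuclideanSpace ℝ (Fin 3) →L[ℝ] EuclideanSpace ℝ (Fin 3) => L
      (chartSymmDiff (𝓡 3) x₀ (extChartAt (𝓡 3) x₀ z) a)) h3).symm
  rw [h5, Trivialization.continuousLinearMapAt_apply,
    Trivialization.coe_linearMapAt_of_mem _ (by simpa using hz)] at h4
  exact h4.symm

lemma isSmoothForm_slice : IsSmoothForm 𝓢.sliceMetric 𝓢.sliceComp := by
  refine ⟨fun x₀ y _ a b => rfl, fun x₀ y hy => ?_⟩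
  refine contDiffAt_clm₂_of_components (isOpen_extChartAt_target x₀) (fun a b z hz => ?_) hy
  have hx := (extChartAt (𝓡 3) x₀).map_target hz
  have h1 : ContMDiffAt (𝓡 3) 𝓘(ℝ, ℝ) ∞ (fun m : N => 𝓢.sliceForm m
      (chartSymmDiff (𝓡 3) x₀ (extChartAt (𝓡 3) x₀ m) a)
      (chartSymmDiff (𝓡 3) x₀ (extChartAt (𝓡 3) x₀ m) b)) ((extChartAt (𝓡 3) x₀).symm z) := by
    have : ContMDiffAt (𝓡 3) ((𝓡 3).prod 𝓘(ℝ)) ∞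
        (fun m ↦ TotalSpace.mk' ℝ (E := Bundle.Trivial N ℝ) m (𝓢.q.inner m
          (chartSymmDiff (𝓡 3) x₀ (extChartAt (𝓡 3) x₀ m) a)
          (chartSymmDiff (𝓡 3) x₀ (extChartAt (𝓡 3) x₀ m) b)))
        ((extChartAt (𝓡 3) x₀).symm z) := by
      apply ContMDiffAt.clm_bundle_apply₂ (F₁ := EuclideanSpace ℝ (Fin 3))
        (F₂ := EuclideanSpace ℝ (Fin 3))
      · exact 𝓢.q.contMDiff.contMDiffAt
      · exact contMDiffAt_coordinate_field hx a
      · exact contMDiffAt_coordinate_field hx b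
    simp only [contMDiffAt_totalSpace] at this
    exact this.2
  have h2 := contDiffAt_chartFun hx h1
  rw [(extChartAt (𝓡 3) x₀).right_inv hz] at h2
  refine h2.congr_of_eventuallyEq ?_
  filter_upwards [eventually_target hz] with w hw
  simp only [chartFun, (extChartAt (𝓡 3) x₀).right_inv hw]
  rfl

end StationaryData

omit [IsManifold (𝓡 3) ∞ N] in
lemma extChartAt_spacetime_symm (x : ℝ × N) (z : ℝ × EuclideanSpace ℝ (Fin 3)) :
    (extChartAt stModel x).symm z = (z.1, (extChartAt (𝓡 3) x.2).symm z.2) := by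
  rw [extChartAt_prod, extChartAt_model_space_eq_id]; rfl

omit [IsManifold (𝓡 3) ∞ N] in
lemma extChartAt_spacetime (x z : ℝ × N) :
    extChartAt stModel x z = (z.1, extChartAt (𝓡 3) x.2 z.2) := by
  rw [extChartAt_prod, extChartAt_model_space_eq_id]; rfl

omit [IsManifold (𝓡 3) ∞ N] in
lemma mem_target_spacetime (x : ℝ × N) (z : ℝ × EuclideanSpace ℝ (Fin 3)) :
    z ∈ (extChartAt stModel x).target ↔ z.2 ∈ (extChartAt (𝓡 3) x.2).target := by
  rw [extChartAt_prod, PartialEquiv.prod_target, extChartAt_model_space_eq_id]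
  exact and_iff_right (mem_univ _)

/-- The preferred chart of the product is the identity in time and the chart of the slice in space.
-/
lemma chartSymmDiff_spacetime (x : ℝ × N) {z : ℝ × EuclideanSpace ℝ (Fin 3)}
    (hz : z.2 ∈ (extChartAt (𝓡 3) x.2).target) (v : ℝ × EuclideanSpace ℝ (Fin 3)) :
    chartSymmDiff stModel x z v = (v.1, chartSymmDiff (𝓡 3) x.2 z.2 v.2) := by
  have h0 : ((extChartAt stModel x).symm : ℝ × EuclideanSpace ℝ (Fin 3) → ℝ × N)
      = fun z => (z.1, (extChartAt (𝓡 3) x.2).symm z.2) :=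
    funext fun z => extChartAt_spacetime_symm x z
  have h1 : MDifferentiableAt 𝓘(ℝ, EuclideanSpace ℝ (Fin 3)) (𝓡 3) (extChartAt (𝓡 3) x.2).symm
      z.2 := ((contMDiffOn_extChartAt_symm (n := ∞) x.2).contMDiffAt
    ((isOpen_extChartAt_target x.2).mem_nhds hz)).mdifferentiableAt (by simp)
  have h2 : MDifferentiableAt 𝓘(ℝ, ℝ × EuclideanSpace ℝ (Fin 3)) 𝓘(ℝ, EuclideanSpace ℝ (Fin 3))
      (Prod.snd : ℝ × EuclideanSpace ℝ (Fin 3) → _) z := differentiableAt_snd.mdifferentiableAt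
  have h3 : MDifferentiableAt 𝓘(ℝ, ℝ × EuclideanSpace ℝ (Fin 3)) 𝓘(ℝ, ℝ)
      (Prod.fst : ℝ × EuclideanSpace ℝ (Fin 3) → _) z := differentiableAt_fst.mdifferentiableAt
  have h4 := mfderiv_prodMk (I' := 𝓘(ℝ, ℝ)) h3 (h1.comp z h2)
  have h5 := mfderiv_comp z h1 h2
  have h6 : chartSymmDiff stModel x z v
      = (mfderiv 𝓘(ℝ, ℝ × EuclideanSpace ℝ (Fin 3)) stModel
        (fun z : ℝ × EuclideanSpace ℝ (Fin 3) => ((z.1, (extChartAt (𝓡 3) x.2).symm z.2) : ℝ × N))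
        z : (ℝ × EuclideanSpace ℝ (Fin 3)) →L[ℝ] (ℝ × EuclideanSpace ℝ (Fin 3))) v := by
    unfold chartSymmDiff
    rw [h0]
    rfl
  have h7 : (mfderiv 𝓘(ℝ, ℝ × EuclideanSpace ℝ (Fin 3)) 𝓘(ℝ, ℝ)
      (Prod.fst : ℝ × EuclideanSpace ℝ (Fin 3) → _) z :
        (ℝ × EuclideanSpace ℝ (Fin 3)) →L[ℝ] ℝ) v = v.1 := by
    rw [mfderiv_eq_fderiv, fderiv_fst]; rfl
  have h8 : (mfderiv 𝓘(ℝ, ℝ × EuclideanSpace ℝ (Fin 3)) 𝓘(ℝ, EuclideanSpace ℝ (Fin 3))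
      (Prod.snd : ℝ × EuclideanSpace ℝ (Fin 3) → _) z :
        (ℝ × EuclideanSpace ℝ (Fin 3)) →L[ℝ] EuclideanSpace ℝ (Fin 3)) v = v.2 := by
    rw [mfderiv_eq_fderiv, fderiv_snd]; rfl
  rw [h6]
  have h9 := congrArg (fun L => L v) h4
  have h10 := congrArg (fun L => L v) h5
  refine h9.trans (Prod.ext h7 ?_)
  refine h10.trans ?_
  change chartSymmDiff (𝓡 3) x.2 z.2 _ = chartSymmDiff (𝓡 3) x.2 z.2 v.2
  exact congrArg _ h8

lemma chartDiff_spacetime (x : ℝ × N) {z : ℝ × N} (hz : z.2 ∈ (extChartAt (𝓡 3) x.2).source)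
    (v : ℝ × EuclideanSpace ℝ (Fin 3)) :
    chartDiff stModel x z v = (v.1, chartDiff (𝓡 3) x.2 z.2 v.2) := by
  have hz2 := (extChartAt (𝓡 3) x.2).map_source hz
  have hy : extChartAt stModel x z ∈ (extChartAt stModel x).target := by
    rw [mem_target_spacetime, extChartAt_spacetime]; exact hz2
  have hinv : (extChartAt stModel x).symm (extChartAt stModel x z) = z := by
    rw [extChartAt_spacetime_symm, extChartAt_spacetime]
    simp only [(extChartAt (𝓡 3) x.2).left_inv hz]
  have h1 := chartDiff_chartSymmDiff hy (v.1, chartDiff (𝓡 3) x.2 z.2 v.2)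
  rw [hinv, chartSymmDiff_spacetime x (by rw [extChartAt_spacetime]; exact hz2),
    extChartAt_spacetime] at h1
  simp only [chartSymmDiff_chartDiff hz] at h1
  exact h1

lemma chartVector_spacetime (V : ∀ x : ℝ × N, TangentSpace stModel x) (x : ℝ × N)
    {z : ℝ × EuclideanSpace ℝ (Fin 3)} (hz : z.2 ∈ (extChartAt (𝓡 3) x.2).target) :
    chartVector V x z = ((vecAt V ((z.1, (extChartAt (𝓡 3) x.2).symm z.2) : ℝ × N)).1,
      chartDiff (𝓡 3) x.2 ((extChartAt (𝓡 3) x.2).symm z.2)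
        (vecAt V ((z.1, (extChartAt (𝓡 3) x.2).symm z.2) : ℝ × N)).2) := by
  rw [chartVector_eq, extChartAt_spacetime_symm,
    chartDiff_spacetime x ((extChartAt (𝓡 3) x.2).map_target hz)]

/-- The components of a stationary metric, in terms of those of the slice. -/
def stForm (α Ω : EuclideanSpace ℝ (Fin 3) → ℝ) (Φ : EuclideanSpace ℝ (Fin 3) →
    EuclideanSpace ℝ (Fin 3)) (q : EuclideanSpace ℝ (Fin 3) →
      EuclideanSpace ℝ (Fin 3) →L[ℝ] EuclideanSpace ℝ (Fin 3) →L[ℝ] ℝ)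
    (z : ℝ × EuclideanSpace ℝ (Fin 3)) :
    (ℝ × EuclideanSpace ℝ (Fin 3)) →L[ℝ] (ℝ × EuclideanSpace ℝ (Fin 3)) →L[ℝ] ℝ :=
  (-(α z.2) ^ 2) • (ContinuousLinearMap.fst ℝ ℝ (EuclideanSpace ℝ (Fin 3))).smulRight
      (ContinuousLinearMap.fst ℝ ℝ (EuclideanSpace ℝ (Fin 3)))
    + (q z.2).bilinearComp
      (ContinuousLinearMap.snd ℝ ℝ (EuclideanSpace ℝ (Fin 3))
        - (ContinuousLinearMap.fst ℝ ℝ (EuclideanSpace ℝ (Fin 3))).smulRight (Ω z.2 • Φ z.2))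
      (ContinuousLinearMap.snd ℝ ℝ (EuclideanSpace ℝ (Fin 3))
        - (ContinuousLinearMap.fst ℝ ℝ (EuclideanSpace ℝ (Fin 3))).smulRight (Ω z.2 • Φ z.2))

lemma stForm_apply (α Ω : EuclideanSpace ℝ (Fin 3) → ℝ) (Φ : EuclideanSpace ℝ (Fin 3) →
    EuclideanSpace ℝ (Fin 3)) (q : EuclideanSpace ℝ (Fin 3) →
      EuclideanSpace ℝ (Fin 3) →L[ℝ] EuclideanSpace ℝ (Fin 3) →L[ℝ] ℝ)
    (z v w : ℝ × EuclideanSpace ℝ (Fin 3)) :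
    stForm α Ω Φ q z v w = -(α z.2) ^ 2 * v.1 * w.1
      + q z.2 (v.2 - (v.1 * Ω z.2) • Φ z.2) (w.2 - (w.1 * Ω z.2) • Φ z.2) := by
  simp only [stForm, _root_.add_apply, _root_.smul_apply, ContinuousLinearMap.smulRight_apply,
    ContinuousLinearMap.bilinearComp_apply, _root_.sub_apply, ContinuousLinearMap.coe_fst',
    ContinuousLinearMap.coe_snd', smul_smul, smul_eq_mul]

namespace StationaryData

variable (𝓢 : StationaryData N)

/-- The components of the rotation field in the chart at `p`. -/
def rotComp (p : N) : EuclideanSpace ℝ (Fin 3) → EuclideanSpace ℝ (Fin 3) := chartVector 𝓢.Φ p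

/-- The components of the spacetime metric in the chart at `x`. -/
def stComp (x : ℝ × N) : ℝ × EuclideanSpace ℝ (Fin 3) →
    (ℝ × EuclideanSpace ℝ (Fin 3)) →L[ℝ] (ℝ × EuclideanSpace ℝ (Fin 3)) →L[ℝ] ℝ :=
  stForm (chartFun (𝓡 3) 𝓢.α x.2) (chartFun (𝓡 3) 𝓢.angVel x.2) (𝓢.rotComp x.2)
    (𝓢.sliceComp x.2)

lemma formAt_metric (x : ℝ × N) (v w : ℝ × EuclideanSpace ℝ (Fin 3)) :
    formAt 𝓢.metric x v w = -(𝓢.α x.2) ^ 2 * v.1 * w.1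
      + 𝓢.sliceForm x.2 (v.2 - (v.1 * 𝓢.angVel x.2) • vecAt 𝓢.Φ x.2)
        (w.2 - (w.1 * 𝓢.angVel x.2) • vecAt 𝓢.Φ x.2) := rfl

lemma contDiffAt_rotComp {p : N} {y : EuclideanSpace ℝ (Fin 3)}
    (hy : y ∈ (extChartAt (𝓡 3) p).target) : ContDiffAt ℝ ∞ (𝓢.rotComp p) y := by
  have h := contDiffAt_chartVector (V := 𝓢.Φ) ((extChartAt (𝓡 3) p).map_target hy)
    (𝓢.Φ_smooth.contMDiffAt)
  rwa [(extChartAt (𝓡 3) p).right_inv hy] at h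

lemma contDiffAt_chartFun_target {f : N → ℝ} (hf : ContMDiff (𝓡 3) 𝓘(ℝ, ℝ) ∞ f) {p : N}
    {y : EuclideanSpace ℝ (Fin 3)} (hy : y ∈ (extChartAt (𝓡 3) p).target) :
    ContDiffAt ℝ ∞ (chartFun (𝓡 3) f p) y := by
  have h := contDiffAt_chartFun ((extChartAt (𝓡 3) p).map_target hy) hf.contMDiffAt
  rwa [(extChartAt (𝓡 3) p).right_inv hy] at h

lemma isSmoothForm_metric : IsSmoothForm 𝓢.metric 𝓢.stComp := by
  refine ⟨fun x z hz a b => ?_, fun x z hz => ?_⟩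
  · rw [mem_target_spacetime] at hz
    have hx := (extChartAt (𝓡 3) x.2).map_target hz
    have h1 : chartSymmDiff (𝓡 3) x.2 z.2 (𝓢.rotComp x.2 z.2)
        = vecAt 𝓢.Φ ((extChartAt (𝓡 3) x.2).symm z.2) := by
      have h1 := chartSymmDiff_chartDiff hx (vecAt 𝓢.Φ ((extChartAt (𝓡 3) x.2).symm z.2))
      rwa [(extChartAt (𝓡 3) x.2).right_inv hz] at h1
    have h2 : ∀ (u : EuclideanSpace ℝ (Fin 3)) (c : ℝ),
        chartSymmDiff (𝓡 3) x.2 z.2 (u - c • 𝓢.rotComp x.2 z.2)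
          = chartSymmDiff (𝓡 3) x.2 z.2 u - c • vecAt 𝓢.Φ ((extChartAt (𝓡 3) x.2).symm z.2) :=
      fun u c => by rw [map_sub, map_smul, h1]
    rw [chartForm_eq, extChartAt_spacetime_symm, chartSymmDiff_spacetime x hz,
      chartSymmDiff_spacetime x hz, formAt_metric, stComp, stForm_apply, sliceComp,
      ContinuousLinearMap.bilinearComp_apply, h2, h2]
    rfl
  · have hopen : IsOpen (extChartAt stModel x).target := isOpen_extChartAt_target x
    refine contDiffAt_clm₂_of_components hopen (fun a b z hz => ?_) hz
    rw [mem_target_spacetime] at hz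
    simp only [stComp, stForm_apply]
    have e1 : ContDiffAt ℝ ∞ (fun z : ℝ × EuclideanSpace ℝ (Fin 3) =>
        chartFun (𝓡 3) 𝓢.α x.2 z.2) z :=
      ContDiffAt.comp (g := chartFun (𝓡 3) 𝓢.α x.2) z
        (contDiffAt_chartFun_target 𝓢.α_smooth hz) contDiffAt_snd
    have e2 : ContDiffAt ℝ ∞ (fun z : ℝ × EuclideanSpace ℝ (Fin 3) =>
        chartFun (𝓡 3) 𝓢.angVel x.2 z.2) z :=
      ContDiffAt.comp (g := chartFun (𝓡 3) 𝓢.angVel x.2) z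
        (contDiffAt_chartFun_target 𝓢.angVel_smooth hz) contDiffAt_snd
    have e3 : ContDiffAt ℝ ∞ (fun z : ℝ × EuclideanSpace ℝ (Fin 3) => 𝓢.rotComp x.2 z.2) z :=
      ContDiffAt.comp (g := 𝓢.rotComp x.2) z (𝓢.contDiffAt_rotComp hz) contDiffAt_snd
    have e4 : ContDiffAt ℝ ∞ (fun z : ℝ × EuclideanSpace ℝ (Fin 3) => 𝓢.sliceComp x.2 z.2) z :=
      ContDiffAt.comp (g := 𝓢.sliceComp x.2) z (𝓢.isSmoothForm_slice.smooth _ _ hz) contDiffAt_snd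
    have e5 : ∀ v : ℝ × EuclideanSpace ℝ (Fin 3), ContDiffAt ℝ ∞ (fun z => v.2 -
        (v.1 * chartFun (𝓡 3) 𝓢.angVel x.2 z.2) • 𝓢.rotComp x.2 z.2) z := fun v =>
      contDiffAt_const.sub ((contDiffAt_const.mul e2).smul e3)
    exact ((((e1.pow 2).neg).mul contDiffAt_const).mul contDiffAt_const).add
      ((e4.clm_apply (e5 a)).clm_apply (e5 b))

lemma sliceForm_symm (p : N) (a b : EuclideanSpace ℝ (Fin 3)) :
    𝓢.sliceForm p a b = 𝓢.sliceForm p b a := 𝓢.q.symm p a b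

lemma sliceForm_pos (p : N) {a : EuclideanSpace ℝ (Fin 3)} (ha : a ≠ 0) :
    0 < 𝓢.sliceForm p a a := 𝓢.q.pos p a ha

lemma formAt_metric_symm (x : ℝ × N) (a b : ℝ × EuclideanSpace ℝ (Fin 3)) :
    formAt 𝓢.metric x a b = formAt 𝓢.metric x b a := by
  rw [formAt_metric, formAt_metric, sliceForm_symm]; ring

/-- Testing with `(0, y)`, where `y` is the shifted spatial part of `a`, gives `q(y, y) = 0`.
Testing with `(1, 0)` then leaves `α²` times the time component. -/
lemma metric_nondegenerate (x : ℝ × N) (a : ℝ × EuclideanSpace ℝ (Fin 3))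
    (h : ∀ b, formAt 𝓢.metric x a b = 0) : a = 0 := by
  have hα := 𝓢.α_pos x.2
  set y := a.2 - (a.1 * 𝓢.angVel x.2) • vecAt 𝓢.Φ x.2 with hy
  have h1 := h (0, y)
  rw [formAt_metric] at h1
  simp only [mul_zero, zero_mul, zero_smul, sub_zero, zero_add] at h1
  have h2 : y = 0 := by
    by_contra hne
    exact (𝓢.sliceForm_pos x.2 hne).ne' h1
  have h3 := h (1, 0)
  rw [formAt_metric, ← hy, h2] at h3
  simp only [map_zero, _root_.zero_apply, add_zero, mul_one] at h3
  have h4 : a.1 = 0 := by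
    rcases mul_eq_zero.1 h3 with h5 | h5
    · exact absurd h5 (by simp [hα.ne'])
    · exact h5
  rw [hy, h4] at h2
  simp only [zero_mul, zero_smul, sub_zero] at h2
  exact Prod.ext h4 h2

end StationaryData

end SpacetimeCharts

/-! ### Consequences of the Killing equation and of closedness for the unit normal. -/

section RotationSymmetry

set_option maxSynthPendingDepth 3

variable {E : Type*} [NormedAddCommGroup E] [NormedSpace ℝ E]

lemma fderiv_apply_field {q : E → E →L[ℝ] E →L[ℝ] ℝ} {ρ : E → E} {y : E}
    (hq : DifferentiableAt ℝ q y) (hρ : DifferentiableAt ℝ ρ y) (a d : E) :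
    fderiv ℝ (fun z => q z (ρ z) a) y d = fderiv ℝ q y d (ρ y) a + q y (fderiv ℝ ρ y d) a := by
  rw [((hq.hasFDerivAt.clm_apply hρ.hasFDerivAt).clm_apply (hasFDerivAt_const a y)).fderiv]
  simp [add_comm]

lemma fderiv_symm {q : E → E →L[ℝ] E →L[ℝ] ℝ} {y : E} (hq : DifferentiableAt ℝ q y)
    (hsymm : ∀ᶠ z in 𝓝 y, ∀ a b, q z a b = q z b a) (d a b : E) :
    fderiv ℝ q y d a b = fderiv ℝ q y d b a := by
  rw [← fderiv_apply₂ hq, ← fderiv_apply₂ hq]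
  exact congrArg (fun L => L d) (Filter.EventuallyEq.fderiv_eq (𝕜 := ℝ)
    (hsymm.mono fun z hz => hz a b))

/-- The unit normal of a surface to which the Killing field `Φ` is tangent commutes with `Φ`, up to
a normal component. -/
lemma bracket_normal_eq_zero [CompleteSpace E] {q : E → E →L[ℝ] E →L[ℝ] ℝ} {f : E → ℝ}
    {r Φ : E → E} {y Y : E} (hq : ContDiffAt ℝ 1 q y) (hf : ContDiffAt ℝ 2 f y)
    (hr : ContDiffAt ℝ 1 r y) (hΦ : ContDiffAt ℝ 1 Φ y)
    (hy : f y = 0) (hN : ∀ᶠ z in 𝓝 y, f z = 0 → CoordUnitNormal q f r z)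
    (hΦt : ∀ᶠ z in 𝓝 y, f z = 0 → fderiv ℝ f z (Φ z) = 0)
    (hK : ∀ u v, coordLie Φ q y u v = 0) (hY : fderiv ℝ f y Y = 0) :
    q y (fderiv ℝ r y (Φ y)) Y = q y (fderiv ℝ Φ y (r y)) Y := by
  have hNy := hN.self_of_nhds hy
  have hΦy := hΦt.self_of_nhds hy
  have hdf : fderiv ℝ f y ≠ 0 := by
    intro h0
    have := hNy.pos
    simp [h0] at this
  have hdfC : ContDiffAt ℝ 1 (fderiv ℝ f) y := hf.fderiv_right (m := 1) (by norm_num)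
  have e1 : ContDiffAt ℝ 1 (fun z => q z (r z) Y) y :=
    (hq.clm_apply hr).clm_apply contDiffAt_const
  have e2 : ContDiffAt ℝ 1 (fun z => (fderiv ℝ f z (r z))⁻¹) y :=
    (hdfC.clm_apply hr).inv hNy.pos.ne'
  have e3 : ContDiffAt ℝ 1 (fun z => fderiv ℝ f z Y) y := hdfC.clm_apply contDiffAt_const
  have e4 : ContDiffAt ℝ 1 (fun z => fderiv ℝ f z (Φ z)) y := hdfC.clm_apply hΦ
  have hf1 : ContDiffAt ℝ 1 f y := hf.of_le (by norm_num)
  -- Two identities on the surface are differentiated tangentially: `q(r, Y) = df(Y) / df(r)` along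
  -- `Φ`, and `df(Φ) = 0` along `Y`. Both produce `D²f(Φ, Y)`.
  have h1 := fderiv_eq_zero_of_eqOn_levelSet hf1
    (h := fun z => q z (r z) Y - (fderiv ℝ f z (r z))⁻¹ * fderiv ℝ f z Y) (e1.sub (e2.mul e3))
    hdf hy
    (hN.mono fun z hz hz' => sub_eq_zero.2 ((hz hz').apply_eq Y)) hΦy
  have h2 := fderiv_eq_zero_of_eqOn_levelSet hf1 e4 hdf hy hΦt hY
  have ddf := (hdfC.differentiableAt (by norm_num)).hasFDerivAt
  have d1 := e1.differentiableAt (by norm_num)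
  have d2 := e2.differentiableAt (by norm_num)
  have d3 := e3.differentiableAt (by norm_num)
  have dq := hq.differentiableAt (by norm_num)
  have dr := hr.differentiableAt (by norm_num)
  have dΦ := hΦ.differentiableAt (by norm_num)
  have h3 : fderiv ℝ (fun z => fderiv ℝ f z Y) y (Φ y) = fderiv ℝ (fderiv ℝ f) y (Φ y) Y := by
    rw [(ddf.clm_apply (hasFDerivAt_const Y y)).fderiv]; simp
  rw [(d1.hasFDerivAt.fun_sub (d2.hasFDerivAt.fun_mul d3.hasFDerivAt)).fderiv] at h1
  simp only [_root_.sub_apply, _root_.add_apply, _root_.smul_apply, smul_eq_mul, h3, hY, zero_mul,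
    add_zero, fderiv_apply_field dq dr] at h1
  rw [(ddf.clm_apply dΦ.hasFDerivAt).fderiv] at h2
  simp only [_root_.add_apply, ContinuousLinearMap.comp_apply, ContinuousLinearMap.flip_apply] at h2
  -- The Killing equation on `(r, Y)` links the two, and the Hessian of `f` and the derivative of
  -- `q` along `Φ` cancel.
  have h4 := hK (r y) Y
  have h5 := hNy.apply_eq (fderiv ℝ Φ y Y)
  have h6 : fderiv ℝ (fderiv ℝ f) y (Φ y) Y = fderiv ℝ (fderiv ℝ f) y Y (Φ y) :=
    (hf.isSymmSndFDerivAt (by simp)).eq _ _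
  simp only [coordLie, h5] at h4
  rw [h6] at h1
  have h7 : fderiv ℝ f y (fderiv ℝ Φ y Y) = - fderiv ℝ (fderiv ℝ f) y Y (Φ y) := by linarith
  rw [h7] at h4
  linarith

/-- If `dΦ♭` vanishes on `r` and a tangent vector `e`, so does the mixed component of the extrinsic
curvature along `Φ` and `e`. -/
lemma coordLie_rotation_eq_zero [CompleteSpace E] {q : E → E →L[ℝ] E →L[ℝ] ℝ} {f : E → ℝ}
    {r Φ : E → E} {y e : E} (hq : ContDiffAt ℝ 1 q y) (hf : ContDiffAt ℝ 2 f y)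
    (hr : ContDiffAt ℝ 1 r y) (hΦ : ContDiffAt ℝ 1 Φ y)
    (hsymm : ∀ᶠ z in 𝓝 y, ∀ a b, q z a b = q z b a) (hy : f y = 0)
    (hN : ∀ᶠ z in 𝓝 y, f z = 0 → CoordUnitNormal q f r z)
    (hΦt : ∀ᶠ z in 𝓝 y, f z = 0 → fderiv ℝ f z (Φ z) = 0)
    (hK : ∀ u v, coordLie Φ q y u v = 0) (he : fderiv ℝ f y e = 0)
    (hF : fderiv ℝ q y (r y) (Φ y) e + q y (fderiv ℝ Φ y (r y)) e
      - (fderiv ℝ q y e (Φ y) (r y) + q y (fderiv ℝ Φ y e) (r y)) = 0) :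
    coordLie r q y (Φ y) e = 0 := by
  have hb := bracket_normal_eq_zero hq hf hr hΦ hy hN hΦt hK he
  have hNy := hN.self_of_nhds hy
  have hdf : fderiv ℝ f y ≠ 0 := by
    intro h0
    have := hNy.pos
    simp [h0] at this
  have dq := hq.differentiableAt (by norm_num)
  have dr := hr.differentiableAt (by norm_num)
  have dΦ := hΦ.differentiableAt (by norm_num)
  -- Differentiating `q(r, Φ) = 0` along `e` gives `q(Dr e, Φ)`. With `hb` for `q(Dr Φ, e)`, the Lie
  -- derivative on `(Φ, e)` becomes the value of `dΦ♭` on `(r, e)`.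
  have h1 := fderiv_eq_zero_of_eqOn_levelSet (hf.of_le (by norm_num))
    (h := fun z => q z (r z) (Φ z)) ((hq.clm_apply hr).clm_apply hΦ) hdf hy
    (by filter_upwards [hN, hΦt] with z h1 h2 h3 using (h1 h3).normal _ (h2 h3)) he
  rw [((dq.hasFDerivAt.clm_apply dr.hasFDerivAt).clm_apply dΦ.hasFDerivAt).fderiv] at h1
  simp only [_root_.add_apply, ContinuousLinearMap.comp_apply, ContinuousLinearMap.flip_apply] at h1
  have hs := hsymm.self_of_nhds
  simp only [coordLie]
  rw [hs (Φ y) (fderiv ℝ r y e)]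
  rw [hs (fderiv ℝ Φ y e) (r y), fderiv_symm dq hsymm e (Φ y) (r y)] at hF
  linarith

/-- A one-form annihilating a surface is closed on it. -/
lemma exterior_derivative_eq_zero {P : Type*} [NormedAddCommGroup P] [NormedSpace ℝ P]
    {q : E → E →L[ℝ] E →L[ℝ] ℝ} {Φ : E → E} {c : P → E} {w₀ : P}
    (hq : DifferentiableAt ℝ q (c w₀)) (hΦ : DifferentiableAt ℝ Φ (c w₀)) (hc : ContDiffAt ℝ 2 c w₀)
    (h : ∀ᶠ w in 𝓝 w₀, ∀ a, q (c w) (Φ (c w)) (fderiv ℝ c w a) = 0) (a b : P) :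
    fderiv ℝ q (c w₀) (fderiv ℝ c w₀ b) (Φ (c w₀)) (fderiv ℝ c w₀ a)
      + q (c w₀) (fderiv ℝ Φ (c w₀) (fderiv ℝ c w₀ b)) (fderiv ℝ c w₀ a)
      - (fderiv ℝ q (c w₀) (fderiv ℝ c w₀ a) (Φ (c w₀)) (fderiv ℝ c w₀ b)
      + q (c w₀) (fderiv ℝ Φ (c w₀) (fderiv ℝ c w₀ a)) (fderiv ℝ c w₀ b)) = 0 := by
  have dc := (hc.differentiableAt (by norm_num)).hasFDerivAt
  have ddc := ((hc.fderiv_right (m := 1) (by norm_num)).differentiableAt (by norm_num)).hasFDerivAt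
  have g1 : HasFDerivAt (fun w => q (c w)) _ w₀ := HasFDerivAt.comp (g := q) w₀ hq.hasFDerivAt dc
  have g2 : HasFDerivAt (fun w => Φ (c w)) _ w₀ := HasFDerivAt.comp (g := Φ) w₀ hΦ.hasFDerivAt dc
  -- The pulled-back one-form vanishes near `w₀`, hence so does its derivative. Antisymmetrising in
  -- `a` and `b` removes the second derivative of `c`.
  have key : ∀ a b, fderiv ℝ q (c w₀) (fderiv ℝ c w₀ b) (Φ (c w₀)) (fderiv ℝ c w₀ a)
      + q (c w₀) (fderiv ℝ Φ (c w₀) (fderiv ℝ c w₀ b)) (fderiv ℝ c w₀ a)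
      + q (c w₀) (Φ (c w₀)) (fderiv ℝ (fderiv ℝ c) w₀ b a) = 0 := by
    intro a b
    have h1 := ((g1.clm_apply g2).clm_apply (ddc.clm_apply (hasFDerivAt_const a w₀))).fderiv
    have h2 : fderiv ℝ (fun w => q (c w) (Φ (c w)) (fderiv ℝ c w a)) w₀ = 0 := by
      rw [Filter.EventuallyEq.fderiv_eq (h.mono fun w hw => hw a : _ =ᶠ[𝓝 w₀] fun _ => (0 : ℝ))]
      simp
    rw [h1] at h2
    have h3 := congrArg (fun L => L b) h2
    simp at h3
    linarith
  have h1 := key a b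
  have h2 := key b a
  have h3 : fderiv ℝ (fderiv ℝ c) w₀ a b = fderiv ℝ (fderiv ℝ c) w₀ b a :=
    (hc.isSymmSndFDerivAt (by simp)).eq _ _
  rw [h3] at h2
  linarith

lemma coordLie_congr {t : E → E →L[ℝ] E →L[ℝ] ℝ} {ρ ρ' : E → E} {y : E} (h : ρ =ᶠ[𝓝 y] ρ')
    (u v : E) : coordLie ρ t y u v = coordLie ρ' t y u v := by
  simp only [coordLie, h.fderiv_eq, h.self_of_nhds]

end RotationSymmetry

/-! ### Lie derivatives of a stationary metric along vector fields of the slice. -/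

section StationaryForm

set_option maxSynthPendingDepth 3

variable {α Ω : EuclideanSpace ℝ (Fin 3) → ℝ}
  {Φ r : EuclideanSpace ℝ (Fin 3) → EuclideanSpace ℝ (Fin 3)}
  {q : EuclideanSpace ℝ (Fin 3) →
    EuclideanSpace ℝ (Fin 3) →L[ℝ] EuclideanSpace ℝ (Fin 3) →L[ℝ] ℝ}
  {z : ℝ × EuclideanSpace ℝ (Fin 3)}

lemma fderiv_lift (hr : DifferentiableAt ℝ r z.2) (v : ℝ × EuclideanSpace ℝ (Fin 3)) :
    fderiv ℝ (fun z : ℝ × EuclideanSpace ℝ (Fin 3) => ((0 : ℝ), r z.2)) z v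
      = (0, fderiv ℝ r z.2 v.2) := by
  have h1 : HasFDerivAt (fun z : ℝ × EuclideanSpace ℝ (Fin 3) => r z.2) _ z :=
    HasFDerivAt.comp (g := r) z hr.hasFDerivAt hasFDerivAt_snd
  rw [((hasFDerivAt_const (0 : ℝ) z).prodMk h1).fderiv]
  simp

lemma fderiv_comp_snd {F : EuclideanSpace ℝ (Fin 3) → ℝ} (hF : DifferentiableAt ℝ F z.2)
    (v : ℝ × EuclideanSpace ℝ (Fin 3)) :
    fderiv ℝ (fun z : ℝ × EuclideanSpace ℝ (Fin 3) => F z.2) z v = fderiv ℝ F z.2 v.2 := by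
  have h1 : HasFDerivAt (fun z : ℝ × EuclideanSpace ℝ (Fin 3) => F z.2) _ z :=
    HasFDerivAt.comp (g := F) z hF.hasFDerivAt hasFDerivAt_snd
  rw [h1.fderiv]
  simp

/-- On purely spatial vectors lapse and shift do not enter. This carries the Killing equation from
the spacetime down to the slice. -/
lemma coordLie_stForm_spatial (hst : DifferentiableAt ℝ (stForm α Ω Φ q) z)
    (hr : DifferentiableAt ℝ r z.2) (hq : DifferentiableAt ℝ q z.2)
    (u v : EuclideanSpace ℝ (Fin 3)) :
    coordLie (fun z : ℝ × EuclideanSpace ℝ (Fin 3) => ((0 : ℝ), r z.2)) (stForm α Ω Φ q) z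
        (0, u) (0, v)
      = coordLie r q z.2 u v := by
  rw [coordLie, ← fderiv_apply₂ hst, fderiv_lift hr, fderiv_lift hr]
  simp only [stForm_apply, mul_zero, zero_mul, zero_smul, sub_zero, zero_add]
  have h1 : DifferentiableAt ℝ (fun y => q y u v) z.2 :=
    (hq.clm_apply (differentiableAt_const u)).clm_apply (differentiableAt_const v)
  rw [fderiv_comp_snd h1, fderiv_apply₂ hq, coordLie]

/-- The Lie derivative of a stationary metric along the lift of a vector field on the slice. -/
lemma half_coordLie_stForm (hst : DifferentiableAt ℝ (stForm α Ω Φ q) z)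
    (hr : DifferentiableAt ℝ r z.2) (hq : DifferentiableAt ℝ q z.2) (hα : DifferentiableAt ℝ α z.2)
    (hΩ : DifferentiableAt ℝ Ω z.2) (hΦ : DifferentiableAt ℝ Φ z.2)
    (hsymm : ∀ᶠ y in 𝓝 z.2, ∀ a b, q y a b = q y b a) (s : ℝ) (Y : EuclideanSpace ℝ (Fin 3)) :
    (1 / 2) * coordLie (fun z : ℝ × EuclideanSpace ℝ (Fin 3) => ((0 : ℝ), r z.2)) (stForm α Ω Φ q) z
        (s, Y + (s * Ω z.2) • Φ z.2) (s, Y + (s * Ω z.2) • Φ z.2)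
      = -(α z.2 * fderiv ℝ α z.2 (r z.2)) * s ^ 2 + (1 / 2) * coordLie r q z.2 Y Y
        + s * Ω z.2 * (q z.2 (fderiv ℝ r z.2 (Φ z.2)) Y - q z.2 (fderiv ℝ Φ z.2 (r z.2)) Y)
        - s * fderiv ℝ Ω z.2 (r z.2) * q z.2 (Φ z.2) Y := by
  have hs := hsymm.self_of_nhds
  set y := z.2 with hy
  -- `v` is held constant while the metric is differentiated. Only at `y` itself does subtracting
  -- the shift term give back `Y`.
  set v := Y + (s * Ω y) • Φ y with hv
  have hvY : v - (s * Ω y) • Φ y = Y := by rw [hv]; abel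
  have hG : HasFDerivAt (fun y => -(α y) ^ 2 * s * s
      + q y (v - (s * Ω y) • Φ y) (v - (s * Ω y) • Φ y)) _ y :=
    (((hα.hasFDerivAt.pow 2).neg.mul_const s).mul_const s).fun_add
      ((hq.hasFDerivAt.clm_apply ((hasFDerivAt_const v y).fun_sub
        ((hΩ.hasFDerivAt.const_mul s).fun_smul hΦ.hasFDerivAt))).clm_apply
        ((hasFDerivAt_const v y).fun_sub ((hΩ.hasFDerivAt.const_mul s).fun_smul hΦ.hasFDerivAt)))
  rw [coordLie, ← fderiv_apply₂ hst, fderiv_lift hr]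
  simp only [stForm_apply, ← hy]
  rw [fderiv_comp_snd (F := fun y => -(α y) ^ 2 * s * s
      + q y (v - (s * Ω y) • Φ y) (v - (s * Ω y) • Φ y)) hG.differentiableAt, ← hy, hG.fderiv, hvY]
  have hrv : fderiv ℝ r y v = fderiv ℝ r y Y + (s * Ω y) • fderiv ℝ r y (Φ y) := by
    rw [hv, map_add, map_smul]
  simp only [hrv, coordLie]
  simp
  simp only [hs Y]
  ring

end StationaryForm

/-! ### Nonpositivity of a quadratic polynomial on an interval. -/

section Algebra

/-- The three systems of inequalities express that a quadratic function is nonpositive on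
`[-1, 1]`. -/
lemma threeSystems_iff (a k₁ k₂ v : ℝ) : ThreeSystems a k₁ k₂ v ↔
    ∀ x : ℝ, x ^ 2 ≤ 1 → -a + k₁ * x ^ 2 + k₂ * (1 - x ^ 2) + 2 * v * x ≤ 0 := by
  have habs : |2 * v| = 2 * |v| := by rw [abs_mul, abs_two]
  constructor
  · rintro (⟨h1, h2, h3⟩ | ⟨h1, h2, h3⟩ | ⟨h1, h2⟩) x hx
    -- The polynomial is concave with its vertex `v / (k₂ - k₁)` outside `[-1, 1]`, so an endpoint
    -- value dominates.
    · have hx1 : |x| ≤ 1 := (sq_le_one_iff_abs_le_one x).1 hx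
      have hvx : v * x ≤ |v| * |x| := by rw [← abs_mul]; exact le_abs_self _
      have hsq : x ^ 2 = |x| ^ 2 := (sq_abs x).symm
      rw [habs] at h1 h2
      have := abs_nonneg x
      rw [hsq]
      nlinarith [mul_nonneg (sub_nonneg.2 hx1) (abs_nonneg v),
        mul_nonneg (sub_nonneg.2 hx1) (show 0 ≤ |v| - (k₂ - k₁) by linarith),
        mul_nonneg (mul_nonneg (sub_nonneg.2 hx1) this) h3.le]
    · have h4 : v ^ 2 / (k₂ - k₁) = v ^ 2 / (k₂ - k₁) ^ 2 * (k₂ - k₁) := by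
        field_simp
      -- Completing the square bounds the polynomial by its value at the vertex.
      have h5 := mul_nonneg h1.le (sq_nonneg (x - v / (k₂ - k₁)))
      have h6 : (k₂ - k₁) * (x - v / (k₂ - k₁)) ^ 2
          = (k₂ - k₁) * x ^ 2 - 2 * v * x + v ^ 2 / (k₂ - k₁) := by
        field_simp
        ring
      linarith
    -- Here the polynomial is convex in `x`, or affine, and the endpoints decide.
    · have hx1 : |x| ≤ 1 := (sq_le_one_iff_abs_le_one x).1 hx
      have hvx : v * x ≤ |v| * |x| := by rw [← abs_mul]; exact le_abs_self _
      rw [habs] at h1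
      nlinarith [mul_nonneg (sub_nonneg.2 hx1) (abs_nonneg v),
        mul_nonneg (sub_nonneg.2 hx) (sub_nonneg.2 h2)]
  · intro h
    have hp := h 1 (by norm_num)
    have hm := h (-1) (by norm_num)
    have hav : -a + k₁ + 2 * |v| ≤ 0 := by
      rcases abs_cases v with ⟨h1, -⟩ | ⟨h1, -⟩ <;> rw [h1] <;> linarith
    rcases le_or_gt k₂ k₁ with hk | hk
    · right; right
      rw [habs]
      exact ⟨by linarith, hk⟩
    · have hd : 0 < k₂ - k₁ := sub_pos.2 hk
      rcases le_or_gt |v| (k₂ - k₁) with hv | hv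
      · right; left
        refine ⟨hd, ?_, hv⟩
        -- Conversely, when the vertex lies in the interval it is the test point.
        have h1 : (v / (k₂ - k₁)) ^ 2 ≤ 1 := by
          rw [sq_le_one_iff_abs_le_one, abs_div, abs_of_pos hd]
          exact (div_le_one hd).2 hv
        have h2 := h _ h1
        have h3 : k₁ * (v / (k₂ - k₁)) ^ 2 + k₂ * (1 - (v / (k₂ - k₁)) ^ 2)
            + 2 * v * (v / (k₂ - k₁)) = k₂ + v ^ 2 / (k₂ - k₁) := by
          field_simp
          ring
        linarith
      · left
        rw [habs]
        exact ⟨by linarith, by linarith, by linarith⟩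

end Algebra

/-! ### Orthonormal bases and planes in dimension three. -/

section LinearAlgebra

set_option maxSynthPendingDepth 3

variable {V : Type*} [NormedAddCommGroup V] [NormedSpace ℝ V]

/-- A plane in a three-dimensional space contains a unit vector orthogonal to a given vector. -/
lemma exists_orthonormal_completion (hV : Module.finrank ℝ V = 3) {q : V →L[ℝ] V →L[ℝ] ℝ}
    (hpos : ∀ a, a ≠ 0 → 0 < q a a) (L : V →L[ℝ] ℝ) (e : V) :
    ∃ e', L e' = 0 ∧ q e' e' = 1 ∧ q e e' = 0 := by
  have : FiniteDimensional ℝ V := Module.finite_of_finrank_pos (by rw [hV]; norm_num)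
  let M : V →ₗ[ℝ] ℝ × ℝ := (L : V →ₗ[ℝ] ℝ).prod (q e : V →ₗ[ℝ] ℝ)
  have hM : LinearMap.ker M ≠ ⊥ := LinearMap.ker_ne_bot_of_finrank_lt (by
    rw [hV, Module.finrank_prod]; simp)
  obtain ⟨m, hm, hm0⟩ := Submodule.exists_mem_ne_zero_of_ne_bot hM
  have hm' : L m = 0 ∧ q e m = 0 := by
    have : M m = 0 := hm
    exact Prod.ext_iff.1 this
  have hmm := hpos m hm0
  refine ⟨(Real.sqrt (q m m))⁻¹ • m, by simp [hm'.1], ?_, by simp [hm'.2]⟩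
  simp only [map_smul, _root_.smul_apply, smul_eq_mul]
  have h1 := Real.mul_self_sqrt hmm.le
  have h2 : Real.sqrt (q m m) ≠ 0 := (Real.sqrt_pos.2 hmm).ne'
  field_simp
  rw [sq]; exact h1.symm

/-- The map `(L, q e, q e')` to `ℝ³` is onto, as seen on `n, e, e'`, hence injective by dimension.
Both sides have the same image. -/
lemma eq_add_of_orthonormal (hV : Module.finrank ℝ V = 3) {q : V →L[ℝ] V →L[ℝ] ℝ}
    (hsymm : ∀ a b, q a b = q b a) {L : V →L[ℝ] ℝ} {n e e' : V}
    (hn : L n ≠ 0) (hnL : ∀ a, L a = 0 → q n a = 0) (he : L e = 0) (he' : L e' = 0)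
    (hee : q e e = 1) (hee' : q e' e' = 1) (h : q e e' = 0) {Y : V} (hY : L Y = 0) :
    Y = q e Y • e + q e' Y • e' := by
  have : FiniteDimensional ℝ V := Module.finite_of_finrank_pos (by rw [hV]; norm_num)
  let M : V →ₗ[ℝ] ℝ × ℝ × ℝ :=
    (L : V →ₗ[ℝ] ℝ).prod ((q e : V →ₗ[ℝ] ℝ).prod (q e' : V →ₗ[ℝ] ℝ))
  have hM : ∀ v, M v = (L v, q e v, q e' v) := fun v => rfl
  have hen : q e n = 0 := by rw [hsymm]; exact hnL e he
  have hen' : q e' n = 0 := by rw [hsymm]; exact hnL e' he'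
  have h' : q e' e = 0 := by rw [hsymm]; exact h
  have hsurj : Function.Surjective M := by
    rintro ⟨a, b, c⟩
    refine ⟨(a / L n) • n + b • e + c • e', ?_⟩
    rw [hM]
    simp [he, he', hee, hee', h, h', hen, hen', hn]
  have hinj : Function.Injective M :=
    (LinearMap.injective_iff_surjective_of_finrank_eq_finrank
      (by rw [hV]; simp [Module.finrank_prod])).2 hsurj
  apply hinj
  rw [hM, hM]
  simp [he, he', hee, hee', h, h', hY]

/-- A plane in the orthogonal complement of a nonzero vector of a three-dimensional space is the
whole complement. -/
lemma exists_preimage_of_orthogonal {P : Type*} [NormedAddCommGroup P] [NormedSpace ℝ P]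
    (hV : Module.finrank ℝ V = 3) (hP : Module.finrank ℝ P = 2) {L : V →L[ℝ] ℝ} (hL : L ≠ 0)
    {C : P →L[ℝ] V} (hC : Function.Injective C) (hLC : ∀ a, L (C a) = 0) {v : V} (hv : L v = 0) :
    ∃ a, C a = v := by
  have : FiniteDimensional ℝ V := Module.finite_of_finrank_pos (by rw [hV]; norm_num)
  have : FiniteDimensional ℝ P := Module.finite_of_finrank_pos (by rw [hP]; norm_num)
  have hle : LinearMap.range (C : P →ₗ[ℝ] V) ≤ LinearMap.ker (L : V →ₗ[ℝ] ℝ) := by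
    rintro _ ⟨a, rfl⟩
    exact hLC a
  have h1 : Module.finrank ℝ (LinearMap.range (C : P →ₗ[ℝ] V)) = 2 := by
    rw [LinearMap.finrank_range_of_inj hC, hP]
  have h2 : Module.finrank ℝ (LinearMap.ker (L : V →ₗ[ℝ] ℝ)) = 2 := by
    have h3 := LinearMap.finrank_range_add_finrank_ker (L : V →ₗ[ℝ] ℝ)
    have h4 : LinearMap.range (L : V →ₗ[ℝ] ℝ) = ⊤ :=
      LinearMap.range_eq_top.2 (LinearMap.surjective (by
        intro h
        exact hL (ContinuousLinearMap.coe_injective h)))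
    rw [h4, finrank_top, Module.finrank_self, hV] at h3
    omega
  have h5 := Submodule.eq_of_le_of_finrank_eq hle (h1.trans h2.symm)
  have h6 : v ∈ LinearMap.range (C : P →ₗ[ℝ] V) := by rw [h5]; exact hv
  exact h6

end LinearAlgebra

/-! ### Uniqueness of the unit normal, and its lift to the spacetime. -/

section UniqueNormal

set_option maxSynthPendingDepth 3

variable {E : Type*} [NormedAddCommGroup E] [NormedSpace ℝ E]

/-- The outward unit normal is unique. -/
lemma CoordUnitNormal.unique {t : E → E →L[ℝ] E →L[ℝ] ℝ} {f : E → ℝ} {ρ ρ' : E → E} {z : E}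
    (h : CoordUnitNormal t f ρ z) (h' : CoordUnitNormal t f ρ' z) (hinv : (t z).IsInvertible) :
    ρ z = ρ' z := by
  set c := fderiv ℝ f z (ρ z) with hc
  set c' := fderiv ℝ f z (ρ' z) with hc'
  have hcpos : 0 < c := h.pos
  have hcpos' : 0 < c' := h'.pos
  -- Lowering the index turns both sides into `df`. Applying `df` then gives `c² = c'²`, and both
  -- factors are positive.
  have h1 : c • ρ z = c' • ρ' z := by
    obtain ⟨e, he⟩ := hinv
    apply e.injective
    have e1 : ∀ v, e v = t z v := fun v => congrArg (fun L => L v) he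
    rw [e1, e1]
    ext a
    simp only [map_smul, _root_.smul_apply, smul_eq_mul, h.apply_eq a, h'.apply_eq a]
    rw [← mul_assoc, ← mul_assoc, mul_inv_cancel₀ hcpos.ne', mul_inv_cancel₀ hcpos'.ne']
  have h2 : c * c = c' * c' := by
    have := congrArg (fderiv ℝ f z) h1
    simpa only [map_smul, smul_eq_mul, ← hc, ← hc'] using this
  have h3 : c = c' := by nlinarith
  rw [h3] at h1
  exact smul_right_injective _ hcpos'.ne' h1

variable {α Ω : EuclideanSpace ℝ (Fin 3) → ℝ}
  {Φ r : EuclideanSpace ℝ (Fin 3) → EuclideanSpace ℝ (Fin 3)}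
  {q : EuclideanSpace ℝ (Fin 3) →
    EuclideanSpace ℝ (Fin 3) →L[ℝ] EuclideanSpace ℝ (Fin 3) →L[ℝ] ℝ}
  {z : ℝ × EuclideanSpace ℝ (Fin 3)}

/-- The lift of the unit normal of a rotationally symmetric surface in the slice is the unit normal
of the world sheet of the surface. -/
lemma coordUnitNormal_lift {F : EuclideanSpace ℝ (Fin 3) → ℝ} (hF : DifferentiableAt ℝ F z.2)
    (h : CoordUnitNormal q F r z.2) (hΦ : fderiv ℝ F z.2 (Φ z.2) = 0) :
    CoordUnitNormal (stForm α Ω Φ q) (fun z => F z.2) (fun z => ((0 : ℝ), r z.2)) z := by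
  refine ⟨?_, ?_, fun a ha => ?_⟩
  · simpa [stForm_apply] using h.unit
  · simpa [fderiv_comp_snd hF] using h.pos
  · rw [fderiv_comp_snd hF] at ha
    rw [stForm_apply]
    simp only [mul_zero, zero_mul, zero_smul, sub_zero, zero_add]
    exact h.normal _ (by rw [map_sub, map_smul, ha, hΦ]; simp)

end UniqueNormal

/-! ### The world sheet of a surface and the tangency of the rotation field. -/

section Transport

set_option maxSynthPendingDepth 3
set_option linter.unusedSectionVars false

variable {N : Type*} [TopologicalSpace N] [ChartedSpace (EuclideanSpace ℝ (Fin 3)) N]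
  [IsManifold (𝓡 3) ∞ N]

lemma dirAt_comp_snd {f : N → ℝ} {x : ℝ × N} (hf : MDifferentiableAt (𝓡 3) 𝓘(ℝ, ℝ) f x.2)
    (v : ℝ × EuclideanSpace ℝ (Fin 3)) :
    dirAt stModel (fun x : ℝ × N => f x.2) x v = dirAt (𝓡 3) f x.2 v.2 := by
  have h1 := mfderiv_comp (I := stModel) (g := f) x hf (mdifferentiableAt_snd (I := 𝓘(ℝ, ℝ)))
  rw [mfderiv_snd] at h1
  exact congrArg (fun L => L v) h1

variable {D : Separation N}

lemma Separation.IsDefiningAt.transport {f : N → ℝ} {x : ℝ × N}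
    (h : D.IsDefiningAt (𝓡 3) x.2 f) :
    D.transport.IsDefiningAt stModel x (fun x : ℝ × N => f x.2) := by
  have hd := h.contMDiffAt.mdifferentiableAt (by simp)
  obtain ⟨h0, U, hU, hxU, hf, hfU⟩ := h
  refine ⟨fun h1 => h0 ?_, Prod.snd ⁻¹' U, hU.preimage continuous_snd, hxU, ?_, ?_⟩
  · ext u
    have h2 := dirAt_comp_snd hd ((0 : ℝ), u)
    have h3 : dirAt stModel (fun x : ℝ × N => f x.2) x = 0 := h1
    rw [h3] at h2
    exact h2.symm
  · exact hf.comp contMDiffOn_snd fun y hy => hy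
  · exact fun y hy => hfU y.2 hy

lemma Separation.IsSmooth.transport (h : D.IsSmooth (𝓡 3)) : D.transport.IsSmooth stModel := by
  refine ⟨h.isOpen_inside.preimage continuous_snd, h.isOpen_outside.preimage continuous_snd,
    h.disjoint_inside_outside.preimage _, ?_, fun x hx => ?_⟩
  · exact congrArg (fun s => Prod.snd ⁻¹' s) h.compl_surface
  · obtain ⟨f, hf⟩ := h.exists_defining x.2 hx
    exact ⟨_, hf.transport⟩

/-- The rotation field is tangent to a rotationally invariant surface. -/
lemma StationaryData.dirAt_rotation_eq_zero {𝓢 : StationaryData N}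
    (haxi : 𝓢.IsAxisymmetric) (hinv : 𝓢.IsInvariantSurface D.surface) {f : N → ℝ} {p : N}
    (hf : D.IsDefiningAt (𝓡 3) p f) (hp : p ∈ D.surface) :
    dirAt (𝓡 3) f p (vecAt 𝓢.Φ p) = 0 := by
  obtain ⟨c, hc0, hc, -⟩ := haxi.periodic p
  have h1 := hc 0
  have hf0 : MDifferentiableAt (𝓡 3) 𝓘(ℝ, ℝ) f (c 0) := by
    rw [hc0]; exact hf.contMDiffAt.mdifferentiableAt (by simp)
  have h2 : HasFDerivAt (f ∘ c) ((dirAt (𝓡 3) f (c 0)).comp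
      ((1 : ℝ →L[ℝ] ℝ).smulRight (vecAt 𝓢.Φ (c 0)))) 0 :=
    (hf0.hasMFDerivAt.comp (I := 𝓘(ℝ, ℝ)) 0 h1).hasFDerivAt
  have h3 : f ∘ c =ᶠ[𝓝 0] fun _ => (0 : ℝ) := by
    have := h1.continuousAt.eventually (by rw [hc0]; exact hf.eventually)
    filter_upwards [this] with s hs
    exact hs.2.2.1.1 (hinv c hc (by rwa [hc0]) s)
  have h4 := h2.congr_of_eventuallyEq h3.symm
  have h5 := h4.unique (hasFDerivAt_const (0 : ℝ) (0 : ℝ))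
  have h6 := congrArg (fun L : ℝ →L[ℝ] ℝ => L 1) h5
  have h7 : dirAt (𝓡 3) f (c 0) ((1 : ℝ) • vecAt 𝓢.Φ (c 0)) = 0 := h6
  rwa [one_smul, hc0] at h7

end Transport

/-! ### The extrinsic curvature of the world sheet in terms of the slice. -/

section WorldSheet

set_option maxSynthPendingDepth 3
set_option linter.unusedSectionVars false

variable {N : Type*} [TopologicalSpace N] [ChartedSpace (EuclideanSpace ℝ (Fin 3)) N]
  [IsManifold (𝓡 3) ∞ N] {𝓢 : StationaryData N} {D : Separation N}
  {r : ∀ p : N, TangentSpace (𝓡 3) p} {R : ∀ x : ℝ × N, TangentSpace stModel x}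

namespace StationaryData

/-- The rotation field is a Killing field of the slice. -/
lemma coordLie_rotComp_eq_zero (haxi : 𝓢.IsAxisymmetric) (p : N)
    (u v : EuclideanSpace ℝ (Fin 3)) :
    coordLie (𝓢.rotComp p) (𝓢.sliceComp p) (extChartAt (𝓡 3) p p) u v = 0 := by
  have hy := mem_extChartAt_target (I := 𝓡 3) p
  have hz := mem_extChartAt_target (I := stModel) ((0, p) : ℝ × N)
  have hz2 : (extChartAt stModel ((0, p) : ℝ × N) (0, p)).2 = extChartAt (𝓡 3) p p := by
    rw [extChartAt_spacetime]
  have h1 : lieAt 𝓢.killingΦ 𝓢.metric ((0, p) : ℝ × N) (0, u) (0, v) = 0 :=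
    haxi.killing _ _ _
  rw [𝓢.isSmoothForm_metric.lieAt_eq,
    coordLie_congr (ρ' := fun z : ℝ × EuclideanSpace ℝ (Fin 3) => ((0 : ℝ), 𝓢.rotComp p z.2))
      ((eventually_target hz).mono fun z hz' => by
        rw [mem_target_spacetime] at hz'
        rw [chartVector_spacetime _ _ hz']
        rfl)] at h1
  have h2 := 𝓢.isSmoothForm_metric.differentiableAt hz
  rw [stComp] at h1 h2
  rw [coordLie_stForm_spatial h2, hz2] at h1
  · exact h1
  · rw [hz2]; exact (𝓢.contDiffAt_rotComp hy).differentiableAt (by simp)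
  · rw [hz2]; exact 𝓢.isSmoothForm_slice.differentiableAt hy

lemma rotComp_self (p : N) : 𝓢.rotComp p (extChartAt (𝓡 3) p p) = vecAt 𝓢.Φ p := by
  rw [rotComp, chartVector_apply _ (mem_extChartAt_source p), chartDiff_self]

lemma eventually_fderiv_rotComp_eq_zero (haxi : 𝓢.IsAxisymmetric)
    (hinv : 𝓢.IsInvariantSurface D.surface) {f : N → ℝ} {p : N} (hf : D.IsDefiningAt (𝓡 3) p f) :
    ∀ᶠ z in 𝓝 (extChartAt (𝓡 3) p p), chartFun (𝓡 3) f p z = 0 →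
      fderiv ℝ (chartFun (𝓡 3) f p) z (𝓢.rotComp p z) = 0 := by
  have hc : Tendsto (extChartAt (𝓡 3) p).symm (𝓝 (extChartAt (𝓡 3) p p)) (𝓝 p) := by
    have := continuousAt_extChartAt_symm (I := 𝓡 3) p
    rwa [ContinuousAt, extChartAt_to_inv] at this
  filter_upwards [hc.eventually hf.eventually_isDefiningAt, hc.eventually hf.eventually,
    eventually_target (mem_extChartAt_target (I := 𝓡 3) p)] with z h1 h2 h3 h4
  have hxs := (extChartAt (𝓡 3) p).map_target h3
  have h5 := fderiv_chartFun hxs (h1.contMDiffAt.mdifferentiableAt (by simp))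
    (vecAt 𝓢.Φ ((extChartAt (𝓡 3) p).symm z))
  rw [(extChartAt (𝓡 3) p).right_inv h3,
    dirAt_rotation_eq_zero haxi hinv h1 (h2.2.2.1.2 h4)] at h5
  exact h5

/-- On the world sheet of the surface its unit normal is the unit normal of the surface in the
slice. -/
lemma eventually_normal_eq (haxi : 𝓢.IsAxisymmetric)
    (hinv : 𝓢.IsInvariantSurface D.surface)
    (hr : haveI := isManifold_one_of_infty (I := 𝓡 3) (X := N)
      IsOutwardUnitNormal 𝓢.sliceMetric D r)
    (hR : haveI := isManifold_one_of_infty (I := stModel) (X := ℝ × N)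
      IsOutwardUnitNormal 𝓢.metric D.transport R)
    {f : N → ℝ} {x : ℝ × N} (hf : D.IsDefiningAt (𝓡 3) x.2 f) :
    ∀ᶠ z in 𝓝 (extChartAt stModel x x), chartFun (𝓡 3) f x.2 z.2 = 0 →
      chartVector R x z = (0, chartVector r x.2 z.2) := by
  have hz := mem_extChartAt_target (I := stModel) x
  have hz2 : (extChartAt stModel x x).2 = extChartAt (𝓡 3) x.2 x.2 := by
    rw [extChartAt_spacetime]
  have hxs := mem_extChartAt_source (I := 𝓡 3) x.2
  have hsnd : Tendsto Prod.snd (𝓝 (extChartAt stModel x x)) (𝓝 (extChartAt (𝓡 3) x.2 x.2)) := by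
    rw [← hz2]; exact continuous_snd.continuousAt
  have h1 := eventually_coordUnitNormal 𝓢.isSmoothForm_metric hR hf.transport
    (mem_extChartAt_source (I := stModel) x)
  have hF : chartFun stModel (fun x : ℝ × N => f x.2) x
      = fun z => chartFun (𝓡 3) f x.2 z.2 := by
    funext z
    rw [chartFun, extChartAt_spacetime_symm]; rfl
  rw [hF] at h1
  have hd : ∀ᶠ z in 𝓝 (extChartAt (𝓡 3) x.2 x.2),
      ContDiffAt ℝ 1 (chartFun (𝓡 3) f x.2) z :=
    ((contDiffAt_chartFun hxs hf.contMDiffAt).of_le one_le_infty).eventually (by decide)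
  filter_upwards [h1, eventually_target hz,
    hsnd.eventually (eventually_coordUnitNormal 𝓢.isSmoothForm_slice hr hf hxs),
    hsnd.eventually (eventually_fderiv_rotComp_eq_zero haxi hinv hf),
    hsnd.eventually hd] with z e1 e2 e3 e4 e5 hfz
  -- Since `Φ` is tangent to the surface, the shift is too, and the lift of `r` is a unit normal of
  -- the world sheet. Uniqueness identifies it with `R`.
  exact (e1 hfz).unique (coordUnitNormal_lift (e5.differentiableAt (by norm_num)) (e3 hfz) (e4 hfz))
    (𝓢.isSmoothForm_metric.isInvertible 𝓢.metric_nondegenerate e2)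

/-- The extrinsic curvature of the world sheet of the surface. -/
lemma extCurvAt_metric (haxi : 𝓢.IsAxisymmetric)
    (hinv : 𝓢.IsInvariantSurface D.surface)
    (hr : haveI := isManifold_one_of_infty (I := 𝓡 3) (X := N)
      IsOutwardUnitNormal 𝓢.sliceMetric D r)
    (hR : haveI := isManifold_one_of_infty (I := stModel) (X := ℝ × N)
      IsOutwardUnitNormal 𝓢.metric D.transport R)
    {f : N → ℝ} {x : ℝ × N} (hf : D.IsDefiningAt (𝓡 3) x.2 f) (hx : x.2 ∈ D.surface) (s : ℝ)
    {Y : EuclideanSpace ℝ (Fin 3)} (hY : dirAt (𝓡 3) f x.2 Y = 0) :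
    extCurvAt 𝓢.metric R x (s, Y + (s * 𝓢.angVel x.2) • vecAt 𝓢.Φ x.2)
        (s, Y + (s * 𝓢.angVel x.2) • vecAt 𝓢.Φ x.2)
      = -(𝓢.α x.2 * dirAt (𝓡 3) 𝓢.α x.2 (vecAt r x.2)) * s ^ 2
        + extCurvAt 𝓢.sliceMetric r x.2 Y Y
        - s * dirAt (𝓡 3) 𝓢.angVel x.2 (vecAt r x.2) * 𝓢.sliceForm x.2 (vecAt 𝓢.Φ x.2) Y := by
  have hz := mem_extChartAt_target (I := stModel) x
  have hzs := mem_extChartAt_source (I := stModel) x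
  have hy := mem_extChartAt_target (I := 𝓡 3) x.2
  have hz2 : (extChartAt stModel x x).2 = extChartAt (𝓡 3) x.2 x.2 := by
    rw [extChartAt_spacetime]
  have hxs := mem_extChartAt_source (I := 𝓡 3) x.2
  have hfd := hf.contMDiffAt.mdifferentiableAt (n := ∞) (by simp)
  set k : ℝ × EuclideanSpace ℝ (Fin 3) := (s, Y + (s * 𝓢.angVel x.2) • vecAt 𝓢.Φ x.2) with hk
  have hΦ0 := dirAt_rotation_eq_zero haxi hinv hf hx
  have hk0 : dirAt stModel (fun x : ℝ × N => f x.2) x k = 0 := by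
    rw [dirAt_comp_snd hfd, hk, map_add, map_smul, hY, hΦ0, smul_zero, add_zero]
  have hF : chartFun stModel (fun x : ℝ × N => f x.2) x
      = fun z => chartFun (𝓡 3) f x.2 z.2 := by
    funext z
    rw [chartFun, extChartAt_spacetime_symm]; rfl
  have hrC := contDiffAt_chartVector_normal hr hx hxs
  have hrd : DifferentiableAt ℝ (chartVector r x.2) (extChartAt stModel x x).2 := by
    rw [hz2]; exact hrC.differentiableAt (by simp)
  have hfst := contDiffAt_chartFun hzs hf.transport.contMDiffAt
  have h0 : chartFun stModel (fun x : ℝ × N => f x.2) x (extChartAt stModel x x) = 0 := by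
    rw [chartFun, extChartAt_to_inv]
    exact hf.eventually.self_of_nhds.2.2.1.1 hx
  -- `R` and the lift of `r` agree only on the surface, since their extensions are arbitrary. On
  -- tangent vectors this suffices.
  rw [extCurvAt_eq_coordLie 𝓢.isSmoothForm_metric hR hf.transport hx hzs hk0, chartDiff_self,
    coordLie_congr_of_eqOn_levelSet (ρ' := fun z : ℝ × EuclideanSpace ℝ (Fin 3) =>
      ((0 : ℝ), chartVector r x.2 z.2)) (hfst.of_le one_le_infty)
      ((contDiffAt_chartVector_normal hR hx hzs).of_le one_le_infty)
      (contDiffAt_const.prodMk (ContDiffAt.comp (g := chartVector r x.2) _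
        (by rw [hz2]; exact hrC.of_le one_le_infty) contDiffAt_snd))
      (hf.transport.fderiv_ne_zero hzs) h0
      (by rw [hF]; exact eventually_normal_eq haxi hinv hr hR hf)
      (by
        have h1 := fderiv_chartFun hzs (hf.transport.contMDiffAt.mdifferentiableAt (by simp)) k
        rwa [chartDiff_self, hk0] at h1)]
  have hst := 𝓢.isSmoothForm_metric.differentiableAt hz
  rw [stComp] at hst ⊢
  have e1 : chartFun (𝓡 3) 𝓢.angVel x.2 (extChartAt (𝓡 3) x.2 x.2) = 𝓢.angVel x.2 := by
    rw [chartFun, extChartAt_to_inv]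
  have e2 : chartFun (𝓡 3) 𝓢.α x.2 (extChartAt (𝓡 3) x.2 x.2) = 𝓢.α x.2 := by
    rw [chartFun, extChartAt_to_inv]
  have e3 : chartVector r x.2 (extChartAt (𝓡 3) x.2 x.2) = vecAt r x.2 := by
    rw [chartVector_apply r hxs, chartDiff_self]
  have e4 : ∀ {F : N → ℝ}, ContMDiff (𝓡 3) 𝓘(ℝ, ℝ) ∞ F → ∀ v,
      fderiv ℝ (chartFun (𝓡 3) F x.2) (extChartAt (𝓡 3) x.2 x.2) v = dirAt (𝓡 3) F x.2 v := by
    intro F hF v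
    have := fderiv_chartFun hxs (hF.contMDiffAt.mdifferentiableAt (n := ∞) (by simp)) v
    rwa [chartDiff_self] at this
  have e5 := extCurvAt_eq_coordLie 𝓢.isSmoothForm_slice hr hf hx hxs hY
  rw [chartDiff_self] at e5
  have key := half_coordLie_stForm hst hrd
    (by rw [hz2]; exact 𝓢.isSmoothForm_slice.differentiableAt hy)
    (by rw [hz2]; exact (contDiffAt_chartFun_target 𝓢.α_smooth hy).differentiableAt (by simp))
    (by rw [hz2]; exact (contDiffAt_chartFun_target 𝓢.angVel_smooth hy).differentiableAt (by simp))
    (by rw [hz2]; exact (𝓢.contDiffAt_rotComp hy).differentiableAt (by simp))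
    (by
      rw [hz2]
      exact (eventually_target hy).mono fun z hz =>
        𝓢.isSmoothForm_slice.symm 𝓢.sliceForm_symm hz)
    s Y
  rw [hz2, e1, rotComp_self, e2, e3, e4 𝓢.α_smooth, e4 𝓢.angVel_smooth, ← e5,
    𝓢.isSmoothForm_slice.apply_self, 𝓢.isSmoothForm_slice.apply_self] at key
  -- The term carrying an undifferentiated `ω` is the tangential part of the commutator of `r` and
  -- `Φ`, which vanishes.
  have hb := bracket_normal_eq_zero
    ((𝓢.isSmoothForm_slice.smooth x.2 _ hy).of_le one_le_infty)
    ((contDiffAt_chartFun hxs hf.contMDiffAt).of_le two_le_infty) (hrC.of_le one_le_infty)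
    ((𝓢.contDiffAt_rotComp hy).of_le one_le_infty)
    (by rw [chartFun, extChartAt_to_inv]; exact hf.eventually.self_of_nhds.2.2.1.1 hx)
    (eventually_coordUnitNormal 𝓢.isSmoothForm_slice hr hf hxs)
    (eventually_fderiv_rotComp_eq_zero haxi hinv hf) (coordLie_rotComp_eq_zero haxi x.2)
    (Y := Y) (by
      have := fderiv_chartFun hxs hfd Y
      rwa [chartDiff_self, hY] at this)
  rw [rotComp_self, e3, 𝓢.isSmoothForm_slice.apply_self, 𝓢.isSmoothForm_slice.apply_self] at hb
  rw [hb, sub_self, mul_zero, add_zero, 𝓢.isSmoothForm_slice.apply_self] at key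
  exact key

end StationaryData

end WorldSheet

/-! ### The orthogonality property makes the mixed curvature component vanish. -/

section MeridionalSurfaces

set_option maxSynthPendingDepth 3
set_option linter.unusedSectionVars false

variable {N : Type*} [TopologicalSpace N] [ChartedSpace (EuclideanSpace ℝ (Fin 3)) N]
  [IsManifold (𝓡 3) ∞ N] {𝓢 : StationaryData N} {D : Separation N}
  {r : ∀ p : N, TangentSpace (𝓡 3) p}

namespace StationaryData

/-- The projection to the slice of the orthogonal surfaces, in the chart at `p`. -/
lemma exists_meridional_surface (horth : 𝓢.TPhiOrthogonality) {p : N} (hp : 𝓢.Φ p ≠ 0) :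
    ∃ c : EuclideanSpace ℝ (Fin 2) → EuclideanSpace ℝ (Fin 3), c 0 = extChartAt (𝓡 3) p p ∧
      ContDiffAt ℝ 2 c 0 ∧ Function.Injective (fderiv ℝ c 0) ∧
      ∀ᶠ w in 𝓝 0, ∀ a, 𝓢.sliceComp p (c w) (𝓢.rotComp p (c w)) (fderiv ℝ c w a) = 0 := by
  obtain ⟨σ, W, hW, h0W, hσ0, hσ, hW'⟩ := horth ((0, p) : ℝ × N) hp
  have hσa : ∀ w ∈ W, ContMDiffAt (𝓡 2) stModel ∞ σ w := fun w hw =>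
    hσ.contMDiffAt (hW.mem_nhds hw)
  have hs2 : ∀ w ∈ W, ContMDiffAt (𝓡 2) (𝓡 3) ∞ (fun w => (σ w).2) w := fun w hw =>
    (hσa w hw).snd
  have hch : ∀ x ∈ (extChartAt (𝓡 3) p).source,
      ContMDiffAt (𝓡 3) 𝓘(ℝ, EuclideanSpace ℝ (Fin 3)) ∞ (extChartAt (𝓡 3) p) x := fun x hx =>
    contMDiffAt_extChartAt' (by rwa [← extChartAt_source (𝓡 3)])
  have hps := mem_extChartAt_source (I := 𝓡 3) p
  have hs0 : (σ 0).2 = p := by rw [hσ0]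
  let σd : EuclideanSpace ℝ (Fin 2) → EuclideanSpace ℝ (Fin 2) →L[ℝ]
    ℝ × EuclideanSpace ℝ (Fin 3) := fun w => mfderiv (𝓡 2) stModel σ w
  have hd : ∀ w ∈ W, (σ w).2 ∈ (extChartAt (𝓡 3) p).source → ∀ a,
      fderiv ℝ (fun w => extChartAt (𝓡 3) p (σ w).2) w a
        = chartDiff (𝓡 3) p (σ w).2 (σd w a).2 := by
    intro w hw hws a
    have h1 := mfderiv_comp w ((hch _ hws).mdifferentiableAt (by simp))
      ((hs2 w hw).mdifferentiableAt (by simp))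
    have h2 := mfderiv_comp w (mdifferentiableAt_snd (I := 𝓘(ℝ, ℝ)) (I' := 𝓡 3))
      ((hσa w hw).mdifferentiableAt (by simp))
    rw [mfderiv_snd] at h2
    have h3 := congrArg (fun L => L a) h1
    have h4 := congrArg (fun L => L a) h2
    rw [← mfderiv_eq_fderiv]
    exact h3.trans (congrArg (chartDiff (𝓡 3) p (σ w).2) h4)
  -- Given orthogonality to `φ^a`, the product with `t^a` reduces to `-α²` times the time component.
  -- So the surfaces lie in slices of constant time and are orthogonal to `Φ` there.
  have hz : ∀ w ∈ W, ∀ a, (σd w a).1 = 0 ∧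
      𝓢.sliceForm (σ w).2 (vecAt 𝓢.Φ (σ w).2) (σd w a).2 = 0 := by
    intro w hw a
    have h1 : formAt 𝓢.metric (σ w) (σd w a) (1, 0) = 0 := ((hW' w hw).2 a).1
    have h2 : formAt 𝓢.metric (σ w) (σd w a) (0, vecAt 𝓢.Φ (σ w).2) = 0 := ((hW' w hw).2 a).2
    rw [formAt_metric] at h1 h2
    simp only [mul_zero, zero_mul, zero_smul, sub_zero, zero_add, one_mul, zero_sub, map_neg,
      map_smul, mul_one, smul_eq_mul] at h1 h2
    rw [h2] at h1
    have h3 : (σd w a).1 = 0 := by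
      have := (𝓢.α_pos (σ w).2).ne'
      simpa [this] using h1
    rw [h3] at h2
    simp only [zero_mul, zero_smul, sub_zero] at h2
    exact ⟨h3, by rw [sliceForm_symm]; exact h2⟩
  refine ⟨fun w => extChartAt (𝓡 3) p (σ w).2, by simp only [hs0], ?_, ?_, ?_⟩
  · refine ContDiffAt.of_le (n := ∞) ?_ two_le_infty
    rw [← contMDiffAt_iff_contDiffAt]
    exact ContMDiffAt.comp (g := extChartAt (𝓡 3) p) (0 : EuclideanSpace ℝ (Fin 2))
      (hch _ (by rw [hs0]; exact hps)) (hs2 0 h0W)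
  · refine (injective_iff_map_eq_zero _).2 fun a ha => ?_
    have hs : (σ 0).2 ∈ (extChartAt (𝓡 3) p).source := by rw [hs0]; exact hps
    rw [hd 0 h0W hs] at ha
    have h1 : (σd 0 a).2 = 0 := chartDiff_injective hs (by rw [ha, map_zero])
    have h2 : σd 0 a = 0 := Prod.ext (hz 0 h0W a).1 h1
    exact (injective_iff_map_eq_zero (σd 0)).1 (hW' 0 h0W).1 a h2
  · filter_upwards [hW.mem_nhds h0W, (hs2 0 h0W).continuousAt.eventually
      ((isOpen_extChartAt_source (I := 𝓡 3) p).mem_nhds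
        (show (σ 0).2 ∈ (extChartAt (𝓡 3) p).source by rw [hs0]; exact hps))] with w hw hws a
    rw [hd w hw hws, rotComp, chartVector_apply _ hws, 𝓢.isSmoothForm_slice.apply_chartDiff hws]
    exact (hz w hw a).2

/-- The mixed component of the extrinsic curvature along the rotation field vanishes. -/
lemma coordLie_normal_rotation_eq_zero (haxi : 𝓢.IsAxisymmetric) (horth : 𝓢.TPhiOrthogonality)
    (hinv : 𝓢.IsInvariantSurface D.surface)
    (hr : haveI := isManifold_one_of_infty (I := 𝓡 3) (X := N)
      IsOutwardUnitNormal 𝓢.sliceMetric D r)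
    {f : N → ℝ} {p : N} (hf : D.IsDefiningAt (𝓡 3) p f) (hp : p ∈ D.surface) (hΦ : 𝓢.Φ p ≠ 0)
    {e : EuclideanSpace ℝ (Fin 3)} (he : dirAt (𝓡 3) f p e = 0)
    (hΦe : 𝓢.sliceForm p (vecAt 𝓢.Φ p) e = 0) :
    coordLie (chartVector r p) (𝓢.sliceComp p) (extChartAt (𝓡 3) p p) (vecAt 𝓢.Φ p) e = 0 := by
  have hy := mem_extChartAt_target (I := 𝓡 3) p
  have hps := mem_extChartAt_source (I := 𝓡 3) p
  obtain ⟨c, hc0, hc, hcinj, hcΦ⟩ := exists_meridional_surface horth hΦ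
  have hL : 𝓢.sliceForm p (vecAt 𝓢.Φ p) ≠ 0 := by
    intro h
    have := 𝓢.sliceForm_pos p (a := vecAt 𝓢.Φ p) hΦ
    rw [h] at this
    simp at this
  have hself := 𝓢.isSmoothForm_slice.apply_self p
  have hLC : ∀ a, 𝓢.sliceForm p (vecAt 𝓢.Φ p) (fderiv ℝ c 0 a) = 0 := by
    intro a
    have := hcΦ.self_of_nhds a
    rw [hc0, rotComp_self, hself] at this
    exact this
  have hΦt := dirAt_rotation_eq_zero haxi hinv hf hp
  have := isManifold_one_of_infty (I := 𝓡 3) (X := N)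
  have hrΦ : 𝓢.sliceForm p (vecAt 𝓢.Φ p) (vecAt r p) = 0 := by
    rw [sliceForm_symm]
    exact hr.normal p hp _ ((isTangent_iff hf hp (vecAt 𝓢.Φ p)).2 hΦt)
  -- The meridional surface spans the orthogonal complement of `Φ`, which contains both `r` and `e`,
  -- so `dΦ♭` can be evaluated on them.
  obtain ⟨b, hb⟩ := exists_preimage_of_orthogonal (by simp) (by simp) hL hcinj hLC hrΦ
  obtain ⟨a, ha⟩ := exists_preimage_of_orthogonal (by simp) (by simp) hL hcinj hLC hΦe
  have hq := 𝓢.isSmoothForm_slice.smooth p _ hy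
  have hΦs := 𝓢.contDiffAt_rotComp hy
  have hF := exterior_derivative_eq_zero (q := 𝓢.sliceComp p) (Φ := 𝓢.rotComp p)
    (by rw [hc0]; exact hq.differentiableAt (by simp))
    (by rw [hc0]; exact hΦs.differentiableAt (by simp)) hc hcΦ a b
  have hrs : chartVector r p (extChartAt (𝓡 3) p p) = vecAt r p := by
    rw [chartVector_apply r hps, chartDiff_self]
  rw [ha, hb, hc0, ← hrs] at hF
  rw [← rotComp_self]
  refine coordLie_rotation_eq_zero (hq.of_le one_le_infty)
    ((contDiffAt_chartFun hps hf.contMDiffAt).of_le two_le_infty)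
    ((contDiffAt_chartVector_normal hr hp hps).of_le one_le_infty) (hΦs.of_le one_le_infty)
    ((eventually_target hy).mono fun z hz => 𝓢.isSmoothForm_slice.symm 𝓢.sliceForm_symm hz)
    (by rw [chartFun, extChartAt_to_inv]; exact hf.eventually.self_of_nhds.2.2.1.1 hp)
    (eventually_coordUnitNormal 𝓢.isSmoothForm_slice hr hf hps)
    (eventually_fderiv_rotComp_eq_zero haxi hinv hf) (coordLie_rotComp_eq_zero haxi p) ?_ hF
  have h1 := fderiv_chartFun hps (hf.contMDiffAt.mdifferentiableAt (n := ∞) (by simp)) e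
  rwa [chartDiff_self, he] at h1

end StationaryData

end MeridionalSurfaces

/-! ### Null vectors in an adapted basis and the two equivalences. -/

section TransverselyTrappingSurfaces

set_option maxSynthPendingDepth 3
set_option linter.unusedSectionVars false

variable {N : Type*} [TopologicalSpace N] [ChartedSpace (EuclideanSpace ℝ (Fin 3)) N]
  [IsManifold (𝓡 3) ∞ N] {𝓢 : StationaryData N} {D : Separation N}
  {r : ∀ p : N, TangentSpace (𝓡 3) p} {R : ∀ x : ℝ × N, TangentSpace stModel x}

namespace StationaryData

/-- The extrinsic curvature of the surface on a linear combination of two tangent vectors. -/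
lemma extCurvAt_slice_add
    (hr : haveI := isManifold_one_of_infty (I := 𝓡 3) (X := N)
      IsOutwardUnitNormal 𝓢.sliceMetric D r)
    {f : N → ℝ} {p : N} (hf : D.IsDefiningAt (𝓡 3) p f) (hp : p ∈ D.surface)
    {u v : EuclideanSpace ℝ (Fin 3)} (hu : dirAt (𝓡 3) f p u = 0) (hv : dirAt (𝓡 3) f p v = 0)
    (a b : ℝ) :
    extCurvAt 𝓢.sliceMetric r p (a • u + b • v) (a • u + b • v)
      = a ^ 2 * extCurvAt 𝓢.sliceMetric r p u u + b ^ 2 * extCurvAt 𝓢.sliceMetric r p v v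
        + a * b * coordLie (chartVector r p) (𝓢.sliceComp p) (extChartAt (𝓡 3) p p) u v := by
  have hy := mem_extChartAt_target (I := 𝓡 3) p
  have hps := mem_extChartAt_source (I := 𝓡 3) p
  have h := fun {w} => extCurvAt_eq_coordLie 𝓢.isSmoothForm_slice hr hf hp hps (k := w)
  simp only [chartDiff_self] at h
  rw [h hu, h hv, h (by rw [map_add, map_smul, map_smul, hu, hv]; simp)]
  have hs : ∀ᶠ z in 𝓝 (extChartAt (𝓡 3) p p), ∀ a b, 𝓢.sliceComp p z a b = 𝓢.sliceComp p z b a :=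
    (eventually_target hy).mono fun z hz => 𝓢.isSmoothForm_slice.symm 𝓢.sliceForm_symm hz
  have h1 := fderiv_symm (𝓢.isSmoothForm_slice.differentiableAt hy) hs
    (chartVector r p (extChartAt (𝓡 3) p p)) u v
  have h2 := hs.self_of_nhds
  simp only [coordLie, map_add, map_smul, _root_.add_apply, _root_.smul_apply, smul_eq_mul]
  rw [h1, h2 v, h2 u (fderiv ℝ (chartVector r p) (extChartAt (𝓡 3) p p) v)]
  ring

/-- The extrinsic curvature of the world sheet on a tangent null vector, in terms of an adapted
basis. -/
lemma extCurvAt_metric_of_isAdaptedBasis (haxi : 𝓢.IsAxisymmetric) (horth : 𝓢.TPhiOrthogonality)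
    (hinv : 𝓢.IsInvariantSurface D.surface)
    (hr : haveI := isManifold_one_of_infty (I := 𝓡 3) (X := N)
      IsOutwardUnitNormal 𝓢.sliceMetric D r)
    (hR : haveI := isManifold_one_of_infty (I := stModel) (X := ℝ × N)
      IsOutwardUnitNormal 𝓢.metric D.transport R)
    {f : N → ℝ} {x : ℝ × N} (hf : D.IsDefiningAt (𝓡 3) x.2 f) (hx : x.2 ∈ D.surface)
    {e₁ e₂ : EuclideanSpace ℝ (Fin 3)} (he : 𝓢.IsAdaptedBasis D x.2 e₁ e₂) (s : ℝ) {a b : ℝ}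
    (hab : 𝓢.Φ x.2 = 0 → a * b = 0) :
    extCurvAt 𝓢.metric R x
        (s, (𝓢.α x.2 * s) • (a • e₁ + b • e₂) + (s * 𝓢.angVel x.2) • vecAt 𝓢.Φ x.2)
        (s, (𝓢.α x.2 * s) • (a • e₁ + b • e₂) + (s * 𝓢.angVel x.2) • vecAt 𝓢.Φ x.2)
      = (𝓢.α x.2 * s) ^ 2 * (-𝓢.lapseSlope r x.2 + extCurvAt 𝓢.sliceMetric r x.2 e₁ e₁ * a ^ 2
        + extCurvAt 𝓢.sliceMetric r x.2 e₂ e₂ * b ^ 2 + 2 * 𝓢.v₁ r x.2 * a) := by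
  have h1 := (isTangent_iff hf hx e₁).1 he.tangent₁
  have h2 := (isTangent_iff hf hx e₂).1 he.tangent₂
  have hα := (𝓢.α_pos x.2).ne'
  have u1 : 𝓢.sliceForm x.2 e₁ e₁ = 1 := he.unit₁
  have u12 : 𝓢.sliceForm x.2 e₁ e₂ = 0 := he.orthogonal
  have hal : vecAt 𝓢.Φ x.2 = 𝓢.rotNorm x.2 • e₁ := he.along
  -- Off the axis the mixed component vanishes by the orthogonality property. On the axis nothing is
  -- known about it, and `hab` removes its coefficient.
  have hmix : a * b * coordLie (chartVector r x.2) (𝓢.sliceComp x.2)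
      (extChartAt (𝓡 3) x.2 x.2) e₁ e₂ = 0 := by
    by_cases hΦ : 𝓢.Φ x.2 = 0
    · rw [hab hΦ, zero_mul]
    · have h3 := coordLie_normal_rotation_eq_zero haxi horth hinv hr hf hx hΦ h2
        (by rw [hal, map_smul, _root_.smul_apply, u12, smul_zero])
      have h4 : 𝓢.rotNorm x.2 ≠ 0 := by
        intro h0
        rw [h0, zero_smul] at hal
        exact hΦ hal
      rw [hal] at h3
      simp only [coordLie, map_smul, _root_.smul_apply, smul_eq_mul, ← mul_add] at h3
      have h5 := (mul_eq_zero.1 h3).resolve_left h4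
      rw [coordLie, h5, mul_zero]
  have hY : dirAt (𝓡 3) f x.2 ((𝓢.α x.2 * s * a) • e₁ + (𝓢.α x.2 * s * b) • e₂) = 0 := by
    rw [map_add, map_smul, map_smul, h1, h2]; simp
  have hYe : (𝓢.α x.2 * s) • (a • e₁ + b • e₂)
      = (𝓢.α x.2 * s * a) • e₁ + (𝓢.α x.2 * s * b) • e₂ := by
    rw [smul_add, smul_smul, smul_smul]
  have hq : 𝓢.sliceForm x.2 (vecAt 𝓢.Φ x.2) ((𝓢.α x.2 * s * a) • e₁ + (𝓢.α x.2 * s * b) • e₂)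
      = 𝓢.rotNorm x.2 * (𝓢.α x.2 * s * a) := by
    rw [hal]
    simp [u1, u12]
  have hl : 𝓢.lapseSlope r x.2 = dirAt (𝓡 3) 𝓢.α x.2 (vecAt r x.2) / 𝓢.α x.2 := rfl
  have hv : 𝓢.v₁ r x.2 = -(𝓢.rotNorm x.2 / (2 * 𝓢.α x.2))
    * dirAt (𝓡 3) 𝓢.angVel x.2 (vecAt r x.2) := rfl
  rw [hYe, extCurvAt_metric haxi hinv hr hR hf hx s hY, extCurvAt_slice_add hr hf hx h1 h2, hq,
    hl, hv]
  have h6 : 𝓢.α x.2 * s * a * (𝓢.α x.2 * s * b) * coordLie (chartVector r x.2) (𝓢.sliceComp x.2)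
      (extChartAt (𝓡 3) x.2 x.2) e₁ e₂ = 0 := by
    rw [show 𝓢.α x.2 * s * a * (𝓢.α x.2 * s * b) * coordLie (chartVector r x.2) (𝓢.sliceComp x.2)
      (extChartAt (𝓡 3) x.2 x.2) e₁ e₂ = (𝓢.α x.2 * s) ^ 2 * (a * b *
        coordLie (chartVector r x.2) (𝓢.sliceComp x.2) (extChartAt (𝓡 3) x.2 x.2) e₁ e₂) by ring,
      hmix, mul_zero]
  rw [h6]
  field_simp
  ring

/-- The vector is `α s` times the unit normal of the slice plus the spatial vector `Y`, because `t^a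
= α n^a - ω φ^a`. It is null exactly when `Y` has length `α |s|`. -/
lemma formAt_metric_shifted (x : ℝ × N) (s : ℝ) (Y : EuclideanSpace ℝ (Fin 3)) :
    formAt 𝓢.metric x (s, Y + (s * 𝓢.angVel x.2) • vecAt 𝓢.Φ x.2)
      (s, Y + (s * 𝓢.angVel x.2) • vecAt 𝓢.Φ x.2)
      = -(𝓢.α x.2 * s) ^ 2 + 𝓢.sliceForm x.2 Y Y := by
  rw [formAt_metric]
  simp only [add_sub_cancel_right]
  ring

lemma isTangent_transport_iff {f : N → ℝ} {x : ℝ × N} (hf : D.IsDefiningAt (𝓡 3) x.2 f)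
    (hx : x.2 ∈ D.surface) (k : ℝ × EuclideanSpace ℝ (Fin 3)) :
    D.transport.IsTangent (I := stModel) x k ↔ dirAt (𝓡 3) f x.2 k.2 = 0 := by
  rw [isTangent_iff hf.transport hx, dirAt_comp_snd (hf.contMDiffAt.mdifferentiableAt (by simp))]

/-- A tangent plane has an adapted basis with a given direction, if this direction is arbitrary on
the axis and the one of the rotation field elsewhere. -/
lemma exists_isAdaptedBasis (haxi : 𝓢.IsAxisymmetric) (hinv : 𝓢.IsInvariantSurface D.surface)
    {f : N → ℝ} {p : N} (hf : D.IsDefiningAt (𝓡 3) p f) (hp : p ∈ D.surface)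
    {Y : EuclideanSpace ℝ (Fin 3)} (hY : dirAt (𝓡 3) f p Y = 0) (hY0 : Y ≠ 0) :
    ∃ e₁ e₂ : EuclideanSpace ℝ (Fin 3), 𝓢.IsAdaptedBasis D p e₁ e₂ ∧
      (𝓢.Φ p = 0 → 𝓢.sliceForm p e₂ Y = 0) := by
  have hunit : ∀ v : EuclideanSpace ℝ (Fin 3), v ≠ 0 →
      𝓢.sliceForm p ((Real.sqrt (𝓢.sliceForm p v v))⁻¹ • v)
        ((Real.sqrt (𝓢.sliceForm p v v))⁻¹ • v) = 1 := by
    intro v hv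
    have h1 := 𝓢.sliceForm_pos p hv
    have h2 := Real.mul_self_sqrt h1.le
    have h3 := (Real.sqrt_pos.2 h1).ne'
    simp only [map_smul, _root_.smul_apply, smul_eq_mul]
    field_simp
    rw [sq]; exact h2.symm
  have key : ∀ v : EuclideanSpace ℝ (Fin 3), v ≠ 0 → dirAt (𝓡 3) f p v = 0 →
      (vecAt 𝓢.Φ p = 𝓢.rotNorm p • ((Real.sqrt (𝓢.sliceForm p v v))⁻¹ • v)) →
      ∃ e₂, 𝓢.IsAdaptedBasis D p ((Real.sqrt (𝓢.sliceForm p v v))⁻¹ • v) e₂ ∧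
        𝓢.sliceForm p e₂ v = 0 := by
    intro v hv hvt hΦv
    obtain ⟨e₂, h1, h2, h3⟩ := exists_orthonormal_completion (by simp)
      (fun a ha => 𝓢.sliceForm_pos p ha) (dirAt (𝓡 3) f p)
      ((Real.sqrt (𝓢.sliceForm p v v))⁻¹ • v)
    refine ⟨e₂, ⟨?_, ?_, hunit v hv, h2, h3, hΦv⟩, ?_⟩
    · exact (isTangent_iff hf hp _).2 (by rw [map_smul, hvt, smul_zero])
    · exact (isTangent_iff hf hp _).2 h1
    · have h4 := (Real.sqrt_pos.2 (𝓢.sliceForm_pos p hv)).ne'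
      rw [map_smul, _root_.smul_apply, smul_eq_mul] at h3
      rw [sliceForm_symm]
      exact (mul_eq_zero.1 h3).resolve_left (inv_ne_zero h4)
  have hrot : 𝓢.rotNorm p = Real.sqrt (𝓢.sliceForm p (vecAt 𝓢.Φ p) (vecAt 𝓢.Φ p)) := rfl
  -- On the axis the first basis vector is taken along `Y`, so that `Y` has no second component and
  -- the mixed term is not needed.
  by_cases hΦ : vecAt 𝓢.Φ p = 0
  · obtain ⟨e₂, h1, h2⟩ := key Y hY0 hY (by rw [hrot, hΦ]; simp)
    exact ⟨_, e₂, h1, fun _ => h2⟩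
  · obtain ⟨e₂, h1, -⟩ := key _ hΦ (dirAt_rotation_eq_zero haxi hinv hf hp) (by
      rw [← hrot, smul_smul, mul_inv_cancel₀, one_smul]
      rw [hrot]
      exact (Real.sqrt_pos.2 (𝓢.sliceForm_pos p hΦ)).ne')
    exact ⟨_, e₂, h1, fun h => absurd h hΦ⟩

/-- The TTS condition as a pointwise condition on the surface in the slice. -/
theorem ttsCondition_iff (haxi : 𝓢.IsAxisymmetric) (horth : 𝓢.TPhiOrthogonality)
    (hD : D.IsSmooth (𝓡 3)) (hinv : 𝓢.IsInvariantSurface D.surface)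
    (hr : haveI := isManifold_one_of_infty (I := 𝓡 3) (X := N)
      IsOutwardUnitNormal 𝓢.sliceMetric D r)
    (hR : haveI := isManifold_one_of_infty (I := stModel) (X := ℝ × N)
      IsOutwardUnitNormal 𝓢.metric D.transport R) :
    𝓢.TTSCondition D.transport R ↔ 𝓢.PointwiseCondition D r := by
  have := isManifold_one_of_infty (I := 𝓡 3) (X := N)
  constructor
  · intro H
    suffices h : ∀ p ∈ D.surface, ∀ e₁ e₂ : EuclideanSpace ℝ (Fin 3), 𝓢.IsAdaptedBasis D p e₁ e₂ →
        ThreeSystems (𝓢.lapseSlope r p) (extCurvAt 𝓢.sliceMetric r p e₁ e₁)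
          (extCurvAt 𝓢.sliceMetric r p e₂ e₂) (𝓢.v₁ r p) from fun p hp e₁ e₂ he => h p hp e₁ e₂ he
    intro p hp e₁ e₂ he
    obtain ⟨f, hf⟩ := hD.exists_defining p hp
    have hα := 𝓢.α_pos p
    have t1 := (isTangent_iff hf hp e₁).1 he.tangent₁
    have t2 := (isTangent_iff hf hp e₂).1 he.tangent₂
    have u1 : 𝓢.sliceForm p e₁ e₁ = 1 := he.unit₁
    have u2 : 𝓢.sliceForm p e₂ e₂ = 1 := he.unit₂
    have u12 : 𝓢.sliceForm p e₁ e₂ = 0 := he.orthogonal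
    have u21 : 𝓢.sliceForm p e₂ e₁ = 0 := by rw [sliceForm_symm]; exact u12
    have key : ∀ a b : ℝ, a ^ 2 + b ^ 2 = 1 → (𝓢.Φ p = 0 → a * b = 0) →
        -𝓢.lapseSlope r p + extCurvAt 𝓢.sliceMetric r p e₁ e₁ * a ^ 2
          + extCurvAt 𝓢.sliceMetric r p e₂ e₂ * b ^ 2 + 2 * 𝓢.v₁ r p * a ≤ 0 := by
      intro a b hab h0
      have h1 := extCurvAt_metric_of_isAdaptedBasis haxi horth hinv hr hR
        (x := ((0, p) : ℝ × N)) hf hp he 1 h0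
      have h2 := H ((0, p) : ℝ × N) hp
        (1, (𝓢.α p * 1) • (a • e₁ + b • e₂) + (1 * 𝓢.angVel p) • vecAt 𝓢.Φ p)
        ((isTangent_transport_iff hf hp _).2 (by
          simp only [map_add, map_smul, t1, t2, dirAt_rotation_eq_zero haxi hinv hf hp]
          simp))
        ((formAt_metric_shifted ((0, p) : ℝ × N) 1 _).trans (by
          simp only [map_add, map_smul, _root_.add_apply, _root_.smul_apply, u1, u2, u12, u21,
            smul_eq_mul]
          linear_combination (𝓢.α p) ^ 2 * hab))
      have h3 : (𝓢.α p * 1) ^ 2 * (-𝓢.lapseSlope r p + extCurvAt 𝓢.sliceMetric r p e₁ e₁ * a ^ 2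
          + extCurvAt 𝓢.sliceMetric r p e₂ e₂ * b ^ 2 + 2 * 𝓢.v₁ r p * a) ≤ 0 := h1.symm.trans_le h2
      exact nonpos_of_mul_nonpos_right h3 (by positivity)
    refine (threeSystems_iff _ _ _ _).2 fun x hx => ?_
    -- On the axis only the directions `e₁` and `e₂` are tested. With `v₁ = 0` the polynomial is the
    -- combination of the two results with weights `x²` and `1 - x²`.
    by_cases hΦ : 𝓢.Φ p = 0
    · have hv : 𝓢.v₁ r p = 0 := by
        have h1 : 𝓢.rotNorm p = 0 := by
          have h2 : 𝓢.rotNorm p = Real.sqrt (𝓢.sliceForm p (vecAt 𝓢.Φ p) (vecAt 𝓢.Φ p)) := rfl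
          have h3 : vecAt 𝓢.Φ p = 0 := hΦ
          rw [h2, h3]; simp
        rw [v₁, h1]; simp
      have h1 := key 1 0 (by norm_num) (fun _ => by norm_num)
      have h2 := key 0 1 (by norm_num) (fun _ => by norm_num)
      rw [hv] at h1 h2 ⊢
      have h3 := mul_nonneg_of_nonpos_of_nonpos h1 (show -x ^ 2 ≤ 0 by nlinarith [sq_nonneg x])
      have h4 := mul_nonneg_of_nonpos_of_nonpos h2 (sub_nonpos.2 hx)
      change -_ + extCurvAt 𝓢.sliceMetric r p e₁ e₁ * _ + extCurvAt 𝓢.sliceMetric r p e₂ e₂ * _ + _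
        ≤ 0
      linarith
    · have hs := Real.sq_sqrt (sub_nonneg.2 hx)
      have h1 := key x (Real.sqrt (1 - x ^ 2)) (by rw [hs]; ring) (fun h => absurd h hΦ)
      rw [hs] at h1
      exact h1
  · intro H
    suffices h : ∀ x : ℝ × N, x.2 ∈ D.surface → ∀ k : ℝ × EuclideanSpace ℝ (Fin 3),
        D.transport.IsTangent (I := stModel) x k → formAt 𝓢.metric x k k = 0 →
        extCurvAt 𝓢.metric R x k k ≤ 0 from fun x hx k htan hnull => h x hx k htan hnull
    intro x hx k htan hnull
    obtain ⟨f, hf⟩ := hD.exists_defining x.2 hx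
    have hα := 𝓢.α_pos x.2
    have hΦt := dirAt_rotation_eq_zero haxi hinv hf hx
    set s : ℝ := k.1 with hs
    set Y : EuclideanSpace ℝ (Fin 3) := k.2 - (s * 𝓢.angVel x.2) • vecAt 𝓢.Φ x.2 with hYdef
    have hk : k = (s, Y + (s * 𝓢.angVel x.2) • vecAt 𝓢.Φ x.2) :=
      Prod.ext rfl (sub_add_cancel _ _).symm
    rw [hk, formAt_metric_shifted] at hnull
    have hY : dirAt (𝓡 3) f x.2 Y = 0 := by
      have h1 := (isTangent_transport_iff hf hx k).1 htan
      rw [hYdef, map_sub, map_smul, h1, hΦt]; simp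
    rw [hk]
    by_cases hY0 : Y = 0
    · have hs0 : s = 0 := by
        rw [hY0] at hnull
        simpa [hα.ne'] using hnull
      rw [extCurvAt_metric haxi hinv hr hR hf hx s hY, hs0, hY0]
      have h0 := extCurvAt_slice_add hr hf hx hY hY 0 0
      simp only [zero_smul, add_zero] at h0
      rw [h0]
      simp
    · have hYY := 𝓢.sliceForm_pos x.2 hY0
      have hαs : 𝓢.α x.2 * s ≠ 0 := by
        intro h0
        rw [h0] at hnull
        linarith
      obtain ⟨e₁, e₂, he, he2⟩ := exists_isAdaptedBasis haxi hinv hf hx hY hY0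
      have t1 := (isTangent_iff hf hx e₁).1 he.tangent₁
      have t2 := (isTangent_iff hf hx e₂).1 he.tangent₂
      have u1 : 𝓢.sliceForm x.2 e₁ e₁ = 1 := he.unit₁
      have u2 : 𝓢.sliceForm x.2 e₂ e₂ = 1 := he.unit₂
      have u12 : 𝓢.sliceForm x.2 e₁ e₂ = 0 := he.orthogonal
      have u21 : 𝓢.sliceForm x.2 e₂ e₁ = 0 := by rw [sliceForm_symm]; exact u12
      have hrn : 0 < dirAt (𝓡 3) f x.2 (vecAt r x.2) := hr.outward x.2 hx f hf
      have hdec := eq_add_of_orthonormal (by simp) (𝓢.sliceForm_symm x.2) hrn.ne'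
        (fun a ha => hr.normal x.2 hx a ((isTangent_iff hf hx a).2 ha)) t1 t2 u1 u2 u12 hY
      set a := 𝓢.sliceForm x.2 e₁ Y / (𝓢.α x.2 * s) with ha
      set b := 𝓢.sliceForm x.2 e₂ Y / (𝓢.α x.2 * s) with hb
      have hYab : Y = (𝓢.α x.2 * s) • (a • e₁ + b • e₂) := by
        rw [smul_add, smul_smul, smul_smul, ha, hb, mul_div_cancel₀ _ hαs, mul_div_cancel₀ _ hαs]
        exact hdec
      have hab : a ^ 2 + b ^ 2 = 1 := by
        rw [hYab] at hnull
        simp only [map_add, map_smul, _root_.add_apply, _root_.smul_apply, u1, u2, u12, u21,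
            smul_eq_mul] at hnull
        have h1 : (𝓢.α x.2 * s) ^ 2 * (a ^ 2 + b ^ 2 - 1) = 0 := by linear_combination hnull
        have h2 := (mul_eq_zero.1 h1).resolve_left (pow_ne_zero 2 hαs)
        linarith
      have h1 := (threeSystems_iff _ _ _ _).1 (H x.2 hx e₁ e₂ he) a (by nlinarith [sq_nonneg b])
      rw [hYab, extCurvAt_metric_of_isAdaptedBasis haxi horth hinv hr hR hf hx he s
        (fun h => by rw [hb, he2 h]; simp)]
      refine mul_nonpos_of_nonneg_of_nonpos (sq_nonneg _) ?_
      rw [← hab] at h1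
      rw [add_sub_cancel_left] at h1
      exact h1

/-- A surface is transversely trapping if and only if it satisfies the TTS condition. -/
theorem isTTS_iff (hD : D.IsSmooth (𝓡 3))
    (hR : haveI := isManifold_one_of_infty (I := stModel) (X := ℝ × N)
      IsOutwardUnitNormal 𝓢.metric D.transport R) :
    𝓢.IsTTS D.transport ↔ 𝓢.TTSCondition D.transport R := by
  have hst := hD.transport
  constructor
  · intro H
    suffices h : ∀ x : ℝ × N, x.2 ∈ D.surface → ∀ k : ℝ × EuclideanSpace ℝ (Fin 3),
        D.transport.IsTangent (I := stModel) x k → formAt 𝓢.metric x k k = 0 →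
        extCurvAt 𝓢.metric R x k k ≤ 0 from fun x hx k htan hnull => h x hx k htan hnull
    intro x hx k htan hnull
    -- Light rays are future-directed, so this case comes directly from the definition of a TTS. The
    -- curvature is quadratic, hence a past-directed `k` is replaced by `-k`, and a null vector
    -- without time component is zero.
    have key : ∀ k : ℝ × EuclideanSpace ℝ (Fin 3), D.transport.IsTangent (I := stModel) x k →
        formAt 𝓢.metric x k k = 0 → 0 < k.1 → extCurvAt 𝓢.metric R x k k ≤ 0 := by
      intro k htan hnull hk
      by_contra! hpos
      obtain ⟨γ, h0, hv, hgeo, hout⟩ := exists_geodesic_outside 𝓢.isSmoothForm_metric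
        𝓢.formAt_metric_symm 𝓢.metric_nondegenerate hst hR hx htan hpos
      obtain ⟨ε, hε, hball⟩ := Metric.eventually_nhds_iff_ball.1 hgeo
      subst h0
      have h1 := H γ ε hε (fun s hs => hball s (by rwa [Real.ball_eq_Ioo, zero_sub, zero_add])) hx
        (show D.transport.IsTangent (I := stModel) (γ 0)
          (velAt (E := ℝ × EuclideanSpace ℝ (Fin 3)) stModel γ 0) by rwa [hv])
        (show formAt 𝓢.metric (γ 0) (velAt stModel γ 0) (velAt stModel γ 0) = 0 by rwa [hv])
        (show 0 < (velAt stModel γ 0).1 by rwa [hv])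
      obtain ⟨s, hs1, hs2⟩ := (h1.and hout).exists
      rcases hs1 with hs1 | hs1
      · have : γ s ∈ D.transport.surfaceᶜ := by
          rw [hst.compl_surface]; exact Or.inr hs2
        exact this hs1
      · exact Set.disjoint_left.1 hst.disjoint_inside_outside hs1 hs2
    obtain ⟨f, hf⟩ := hD.exists_defining x.2 hx
    have hquad : ∀ (c : ℝ) (v : ℝ × EuclideanSpace ℝ (Fin 3)), formAt 𝓢.metric x (c • v) (c • v)
        = c ^ 2 * formAt 𝓢.metric x v v := by
      intro c v
      rw [← 𝓢.isSmoothForm_metric.apply_self, ← 𝓢.isSmoothForm_metric.apply_self]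
      simp only [map_smul, _root_.smul_apply, smul_eq_mul]
      ring
    have ht := (isTangent_iff hf.transport hx k).1 htan
    have hK : ∀ c : ℝ, extCurvAt 𝓢.metric R x (c • k) (c • k)
        = c ^ 2 * extCurvAt 𝓢.metric R x k k := by
      intro c
      have h := fun {w} => extCurvAt_eq_coordLie 𝓢.isSmoothForm_metric hR hf.transport hx
        (mem_extChartAt_source (I := stModel) x) (k := w)
      simp only [chartDiff_self] at h
      rw [h ht, h (by rw [map_smul, ht, smul_zero])]
      simp only [coordLie, map_smul, _root_.smul_apply, smul_eq_mul]
      ring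
    rcases lt_trichotomy k.1 0 with hk | hk | hk
    · have h1 := key ((-1 : ℝ) • k)
        ((isTangent_iff hf.transport hx _).2 (by rw [map_smul, ht, smul_zero]))
        (by rw [hquad, hnull, mul_zero]) (by simpa using hk)
      rw [hK] at h1
      linarith
    · have h1 : k.2 = 0 := by
        by_contra hne
        rw [formAt_metric, hk] at hnull
        simp only [mul_zero, zero_mul, zero_smul, sub_zero, zero_add] at hnull
        exact (𝓢.sliceForm_pos x.2 hne).ne' hnull
      have h2 : k = (0 : ℝ) • k := by
        rw [zero_smul]; exact Prod.ext hk h1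
      rw [h2, hK]
      simp
    · exact key k htan hnull hk
  · intro H γ ε hε hgeo h0 htan hnull hpos
    refine eventually_mem_of_extrinsicCurvature_nonpos 𝓢.isSmoothForm_metric
      𝓢.formAt_metric_symm 𝓢.metric_nondegenerate hst hR H ?_ h0 htan hnull ?_
    · filter_upwards [Ioo_mem_nhds (neg_lt_zero.2 hε) hε] with s hs using hgeo s hs
    · intro hv
      have h1 : 0 < (velAt stModel γ 0).1 := hpos
      have h2 : (velAt stModel γ 0).1 = 0 := congrArg Prod.fst hv
      exact h1.ne' h2

end StationaryData

end TransverselyTrappingSurfaces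

end TransverselyTrapping

end

open TransverselyTrapping in
theorem proposition3 {N : Type*} [TopologicalSpace N] [T2Space N]
    [ChartedSpace (EuclideanSpace ℝ (Fin 3)) N] [IsManifold (𝓡 3) ∞ N]
    (𝓢 : StationaryData N) (haxi : 𝓢.IsAxisymmetric) (horth : 𝓢.TPhiOrthogonality)
    (D : Separation N) (hD : D.IsSmooth (𝓡 3)) (hcompact : IsCompact D.surface)
    (hinv : 𝓢.IsInvariantSurface D.surface)
    (r : ∀ p : N, TangentSpace (𝓡 3) p) (hr : IsOutwardUnitNormal 𝓢.sliceMetric D r)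
    (R : ∀ x : ℝ × N, TangentSpace stModel x)
    (hR : IsOutwardUnitNormal 𝓢.metric D.transport R) :
    (𝓢.IsTTS D.transport ↔ 𝓢.PointwiseCondition D r) ∧
    (𝓢.TTSCondition D.transport R ↔ 𝓢.PointwiseCondition D r) :=
  ⟨(StationaryData.isTTS_iff hD hR).trans
      (StationaryData.ttsCondition_iff haxi horth hD hinv hr hR),
    StationaryData.ttsCondition_iff haxi horth hD hinv hr hR⟩
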